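/- **Setting (Fermi–Ulam model).** Let $d\in C^\infty(\mathbb R)$ with $d\ge \mathrm{const}>0$, and let $k$ be a natural number; if $k\ge 2$, assume that $d$ and each of its derivatives are bounded on $\mathbb R$. For small $\varepsilon>0$ a particle of unit mass moves freely between a fixed wall at $x=0$ and a moving wall at $x=d(\varepsilon t)$; its velocity changes sign at an impact with the fixed wall, and becomes $2\varepsilon d'(\varepsilon t)-v$ from $v$ at an impact with the moving wall. Put $\tau=\varepsilon t$. Between the walls the action is $I=|v|\,d(\tau)/\pi$, and the phase is, modulo $2\pi$, $\phi=\pi x/d(\tau)$ if $v>0$ and $\phi=\pi(2-x/d(\tau))$ if $v<0$; along a motion $\phi$ is taken as a continuous real-valued function of $t$. In these variables the motion between the walls has the Hamiltonian $$H=\frac{\pi^2I^2}{2d(\tau)^2}-\varepsilon\,\frac{I\,d'(\tau)}{d(\tau)}\,f(\phi),$$ where $f$ is $2\pi$-periodic, $f(\phi)=\phi$ on $(0,\pi)$, $f(\phi)=\phi-2\pi$ on $(\pi,2\pi)$. **Change of variables.** For $r\ge1$ consider the generating function $W=\hat I\phi+\varepsilon S(\hat I,\phi,\tau,\varepsilon)$,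 $S=S_1+\varepsilon S_2+\dots+\varepsilon^{r-2}S_{r-1}$, i.e. $$I=\hat I+\varepsilon\,\partial_\phi S(\hat I,\phi,\tau,\varepsilon),\qquad \hat\phi=\phi+\varepsilon\,\partial_{\hat I} S(\hat I,\phi,\tau,\varepsilon),\tag{1}$$ and $\mathcal H_{\Sigma,r}=\sum_{i=0}^{r-1}\varepsilon^i\mathcal H_i(\hat I,\tau)$ with $\mathcal H_0=\pi^2\hat I^2/(2d(\tau)^2)$. For $\hat I>0$ we require of $S_i(\hat I,\phi,\tau)$ and $\mathcal H_i(\hat I,\tau)$: both are $C^\infty$ in $(\hat I,\tau)$; $S_i$ is continuous, $2\pi$-periodic and of zero mean in $\phi$, and differentiable in $\phi$ away from the odd multiples of $\pi$; and for all $\hat I>0$, all $\tau$ and all $\phi$ that are not odd multiples of $\pi$ the new Hamiltonian satisfies $$H(\hat I+\varepsilon\,\partial_\phi S,\phi,\tau,\varepsilon)+\varepsilon^2\,\partial_\tau S=\mathcal H_{\Sigma,r}(\hat I,\tau,\varepsilon)+O(\varepsilon^r)\qquad(\varepsilon\to0^+).\tag{2}$$ **Statement.** Let $0<a\le b$ and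 $L>0$. Consider motions on $[0,T]$ with $0\le T\le L\varepsilon^{-k}$ for which at $t=0$ the particle is strictly between the walls and $I(0)\in[a,b]$. (A) There are $C,\varepsilon_0>0$, depending only on $d,k,a,b,L$, such that for $0<\varepsilon<\varepsilon_0$ every such motion satisfies $|I(t)-I(0)|\le C\varepsilon$ at all $t\in[0,T]$ that are not impact times. (B) For every $r\ge1$ functions $S_i$, $\mathcal H_i$ as above exist. For any such functions there are $C,\varepsilon_0>0$, depending only on these functions and on $d,k,r,a,b,L$, such that for $0<\varepsilon<\varepsilon_0$ and every such motion the following holds. There is exactly one $J\in[a/2,2b]$ with $I(0)=J+\varepsilon\,\partial_\phi S(J,\phi(0),0,\varepsilon)$. Let $\psi$ be the solution on $[0,T]$ of $\dot\psi=\partial_{\hat I}\mathcal H_{\Sigma,r}(J,\varepsilon t,\varepsilon)$, $\psi(0)=\phi(0)+\varepsilon\,\partial_{\hat I}S(J,\phi(0),0,\varepsilon)$. For every $t\in[0,T]$ there is exactly one $\phi_*(t)\in\mathbb R$ with $\phi_*(t)+\varepsilon\,\partial_{\hat I}S(J,\phi_*(t),\varepsilon t,\varepsilon)=\psi(t)$,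 and 1. $|I(t)-(J+\varepsilon\,\partial_\phi S(J,\phi(t),\varepsilon t,\varepsilon))|\le C\varepsilon^r$ if $t$ is not an impact time; 2. $|\phi(t)-\phi_*(t)|\le C\varepsilon^{r-k}$; 3. if $t$ is not an impact time and there is no odd multiple of $\pi$ in the closed interval between $\phi(t)$ and $\phi_*(t)$, then also $|I(t)-(J+\varepsilon\,\partial_\phi S(J,\phi_*(t),\varepsilon t,\varepsilon))|\le C(\varepsilon^r+\varepsilon^{r-k+1})$. -/

import Mathlib

open Real Set Filter Topology Asymptotics
open scoped ContDiff

namespace FermiUlam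

/-- The `2π`-periodic sawtooth: it equals `φ` on `(0, π)` and `φ - 2π` on `(π, 2π)`.
It is continuous except at the odd multiples of `π`. -/
noncomputable def sawtooth (φ : ℝ) : ℝ := toIcoMod Real.two_pi_pos (-π) φ

/-- `φ` is an odd multiple of `π`, i.e. the phase of an impact with the moving wall. -/
def IsOddPi (φ : ℝ) : Prop := ∃ n : ℤ, φ = (2 * n + 1) * π

/-- The Hamiltonian of the particle between the walls in the action-angle variables `(I, φ)`,
for the distance `d τ`, `τ = ε t`, between the walls; the speed of the right wall is `ε d' τ`. -/
noncomputable def hamiltonian (d : ℝ → ℝ) (ε I φ τ : ℝ) : ℝ :=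
  π ^ 2 * I ^ 2 / (2 * d τ ^ 2) - I * (ε * deriv d τ) / d τ * sawtooth φ

/-- `S = S₁ + ε S₂ + … + ε ^ (r - 2) S_{r-1}`; the arguments of each `S i` are the new action `J`,
the old angle `φ` and the slow time `τ`. -/
noncomputable def genS (S : ℕ → ℝ → ℝ → ℝ → ℝ) (r : ℕ) (ε J φ τ : ℝ) : ℝ :=
  ∑ i ∈ Finset.Icc 1 (r - 1), ε ^ (i - 1) * S i J φ τ

/-- The old action `I = J + ε ∂S/∂φ` for the generating function `J φ + ε S (J, φ, τ, ε)`. -/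
noncomputable def oldAction (S : ℕ → ℝ → ℝ → ℝ → ℝ) (r : ℕ) (ε J φ τ : ℝ) : ℝ :=
  J + ε * deriv (fun p => genS S r ε J p τ) φ

/-- The new angle `φ + ε ∂S/∂J` for the generating function `J φ + ε S (J, φ, τ, ε)`. -/
noncomputable def newAngle (S : ℕ → ℝ → ℝ → ℝ → ℝ) (r : ℕ) (ε J φ τ : ℝ) : ℝ :=
  φ + ε * deriv (fun j => genS S r ε j φ τ) J

/-- The transformed Hamiltonian `H + ∂W/∂t`, `W = J φ + ε S (J, φ, ε t, ε)`, expressed through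
the new action and the old angle. -/
noncomputable def newHamiltonian (d : ℝ → ℝ) (S : ℕ → ℝ → ℝ → ℝ → ℝ) (r : ℕ)
    (ε J φ τ : ℝ) : ℝ :=
  hamiltonian d ε (oldAction S r ε J φ τ) φ τ + ε ^ 2 * deriv (fun s => genS S r ε J φ s) τ

/-- `𝓗_{Σ,r} = 𝓗₀ + ε 𝓗₁ + … + ε ^ (r - 1) 𝓗_{r-1}`. -/
noncomputable def sumH (K : ℕ → ℝ → ℝ → ℝ) (r : ℕ) (ε J τ : ℝ) : ℝ :=
  ∑ i ∈ Finset.range r, ε ^ i * K i J τ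

/-- `S₁, …, S_{r-1}` and `𝓗₀, …, 𝓗_{r-1}` (written `K i`) are the functions of the adiabatic
perturbation procedure of order `r`: the change of variables with generating function
`J φ + ε S` brings the Hamiltonian to the form `𝓗_{Σ,r}(J, τ, ε) + O(ε ^ r)`.
The `S i` have zero average in the angle. -/
structure IsAdiabaticChange (d : ℝ → ℝ) (r : ℕ) (S : ℕ → ℝ → ℝ → ℝ → ℝ)
    (K : ℕ → ℝ → ℝ → ℝ) : Prop where
  smooth_S : ∀ i ∈ Finset.Icc 1 (r - 1), ∀ φ : ℝ,
    ContDiffOn ℝ ∞ (fun p : ℝ × ℝ => S i p.1 φ p.2) (Ioi 0 ×ˢ univ)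
  continuous_S : ∀ i ∈ Finset.Icc 1 (r - 1), ∀ J > 0, ∀ τ : ℝ, Continuous fun φ => S i J φ τ
  differentiable_S : ∀ i ∈ Finset.Icc 1 (r - 1), ∀ J > 0, ∀ τ φ : ℝ, ¬ IsOddPi φ →
    DifferentiableAt ℝ (fun p => S i J p τ) φ
  periodic_S : ∀ i ∈ Finset.Icc 1 (r - 1), ∀ J > 0, ∀ τ : ℝ,
    Function.Periodic (fun φ => S i J φ τ) (2 * π)
  mean_S : ∀ i ∈ Finset.Icc 1 (r - 1), ∀ J > 0, ∀ τ : ℝ, ∫ φ in (0 : ℝ)..2 * π, S i J φ τ = 0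
  smooth_K : ∀ i ∈ Finset.range r,
    ContDiffOn ℝ ∞ (fun p : ℝ × ℝ => K i p.1 p.2) (Ioi 0 ×ˢ univ)
  zero_K : ∀ J > 0, ∀ τ : ℝ, K 0 J τ = π ^ 2 * J ^ 2 / (2 * d τ ^ 2)
  normal_form : ∀ J > 0, ∀ τ φ : ℝ, ¬ IsOddPi φ →
    (fun ε => newHamiltonian d S r ε J φ τ - sumH K r ε J τ) =O[𝓝[>] 0] fun ε => ε ^ r

/-- The motion, for `0 ≤ t ≤ T`, of a particle of unit mass with position `x` and velocity `v`
between a fixed wall at `0` and a moving wall at `d (ε t)`. The velocity is locally constant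
between the walls, it changes its sign at an impact with the fixed wall, and it becomes
`2 w - u` from `u` at an impact with the moving wall, `w = ε d' (ε t)` being the speed of the wall.
The value of `v` at the very moment of an impact is irrelevant. -/
structure IsMotion (d : ℝ → ℝ) (ε T : ℝ) (x v : ℝ → ℝ) : Prop where
  confined : ∀ t ∈ Icc 0 T, 0 ≤ x t ∧ x t ≤ d (ε * t)
  free : ∀ t ∈ Icc 0 T, 0 < x t → x t < d (ε * t) →
    ∀ᶠ s in 𝓝[Icc 0 T] t, x s = x t + v t * (s - t) ∧ v s = v t
  fixed_wall : ∀ t ∈ Icc 0 T, x t = 0 → ∃ u : ℝ,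
    (∀ᶠ s in 𝓝[Icc 0 T ∩ Iio t] t, x s = x t + u * (s - t) ∧ v s = u) ∧
    (∀ᶠ s in 𝓝[Icc 0 T ∩ Ioi t] t, x s = x t + (-u) * (s - t) ∧ v s = -u)
  moving_wall : ∀ t ∈ Icc 0 T, x t = d (ε * t) → ∃ u : ℝ,
    (∀ᶠ s in 𝓝[Icc 0 T ∩ Iio t] t, x s = x t + u * (s - t) ∧ v s = u) ∧
    (∀ᶠ s in 𝓝[Icc 0 T ∩ Ioi t] t,
      x s = x t + (2 * (ε * deriv d (ε * t)) - u) * (s - t) ∧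
      v s = 2 * (ε * deriv d (ε * t)) - u)

/-- At the moment `t` the particle is strictly between the walls. -/
def IsBetween (d : ℝ → ℝ) (ε : ℝ) (x : ℝ → ℝ) (t : ℝ) : Prop := 0 < x t ∧ x t < d (ε * t)

/-- The action `|v| d / π`. -/
noncomputable def action (d : ℝ → ℝ) (ε : ℝ) (v : ℝ → ℝ) (t : ℝ) : ℝ := |v t| * d (ε * t) / π

/-- `φ` is the phase along the motion, as a continuous real-valued function of time: modulo `2π`
it is `π x / d` while the particle moves to the right and `π (2 - x / d)` while it moves to
the left. -/
structure IsPhase (d : ℝ → ℝ) (ε T : ℝ) (x v φ : ℝ → ℝ) : Prop where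
  continuousOn : ContinuousOn φ (Icc 0 T)
  right : ∀ t ∈ Icc 0 T, IsBetween d ε x t → 0 < v t →
    ∃ n : ℤ, φ t = π * (x t / d (ε * t)) + 2 * π * n
  left : ∀ t ∈ Icc 0 T, IsBetween d ε x t → v t < 0 →
    ∃ n : ℤ, φ t = π * (2 - x t / d (ε * t)) + 2 * π * n

end FermiUlam

/-!
Let `θ = sawtooth φ ∈ [-π, π)`. Each `S i` and each `𝓗 i` of the perturbation procedure can be chosen
as a polynomial in `J`, `J⁻¹`, `θ`, `1 / d` and the derivatives of `d`. Such polynomials, together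
with the derivations in `J`, `θ` and `τ`, are formalized as `SymPoly`; a polynomial and all of its
derivatives are bounded as soon as the derivatives of `d` are (`exists_bound_ev`). The polynomials of
the procedure are found order by order: the mean in `θ` of the remainder goes to `𝓗`, and its
oscillating part is removed by integration (`exists_isProcedure`). Conversely, comparison of
coefficients of `ε` shows that the conditions on `S` and `𝓗` determine these functions for `J > 0`
(`IsAdiabaticChange.unique`), so only the explicit ones have to be considered.

The motion is regularized as follows. The momentum `d v - ε d' x` conjugate to `x / d` changes its
sign at every impact, hence `P = |d v - ε d' x| / π = I - ε d d' θ / π ^ 2` is continuous, and so is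
the phase. Both satisfy differential equations for derivatives from the right, even at impacts
(`IsLift`). As a function of `P` and `θ` the Hamiltonian is even in `θ`; by induction on the order,
the functions `S i` and `∂S/∂φ - d d' θ / π ^ 2` therefore take equal
values at `θ = ± π` and are continuous along the motion. So impacts cause no loss of accuracy.

Let `I = G (J, θ, τ)` be the old action for the procedure of order `R`. The normal form implies that
`u = (I - G) / (∂G/∂J)`, computed for the initial value `J` of the new action, satisfies
`|u'| ≤ M ε ^ R (1 + |u|) + N u ^ 2`. A solution that starts at `0` stays `O(ε ^ R t)` as long as the
quadratic term is dominated, which for `t ≤ L ε ^ (-k)` is the case if `R > 2 k`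
(`exists_bound_liftAction_high`). The order `r` itself may be too low for this. With
`R = r + 2 k + 1` the new action of order `R` is conserved with accuracy `ε ^ (R - k) ≤ ε ^ r`, and it
differs from the new action of order `r` by `O(ε ^ r)` (`exists_bound_liftAction`). The new angle then
follows `ψ` with a velocity error `O(ε ^ r)`, which accumulates to `O(ε ^ (r - k))`, and the passage
between the angles is bi-Lipschitz (`exists_bound_lift`).

A motion has a lift while the momentum dominates `ε d' x`, and the conservation of the action gives
back this condition with a margin, so it persists on the whole of `[0, T]` (`exists_isFast`). The
slow time stays in a compact interval if `k ≤ 1`; otherwise the derivatives of `d` are bounded by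
assumption (`exists_bound_slowTimes`).
-/

namespace FermiUlam

/-! ### Differential polynomials in the action, the angle and the distance -/

/-- The indeterminates of the symbolic calculus: the small parameter, the new action and its
inverse, the angle, the inverse of the distance, and the derivatives of the distance. -/
inductive Var : Type
  | eps | act | actInv | ang | distInv
  | dist (n : ℕ)

/-- Polynomials in the indeterminates. The relations `act * actInv = 1` and
`dist 0 * distInv = 1` are not imposed; they hold for the values of the polynomials only. -/
abbrev SymPoly : Type := MvPolynomial Var ℝ

namespace SymPoly

open MvPolynomial

/-- The small parameter `ε` as a polynomial. -/
noncomputable def E : SymPoly := X Var.eps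
/-- The action `J` as a polynomial. -/
noncomputable def A : SymPoly := X Var.act
/-- The inverse action `J⁻¹` as a polynomial. -/
noncomputable def Ai : SymPoly := X Var.actInv
/-- The angle `θ` as a polynomial. -/
noncomputable def Th : SymPoly := X Var.ang
/-- The inverse distance `(d τ)⁻¹` as a polynomial. -/
noncomputable def Di : SymPoly := X Var.distInv
/-- The `n`-th derivative of the distance as a polynomial. -/
noncomputable def Dn (n : ℕ) : SymPoly := X (Var.dist n)

/-- The derivation `∂/∂J`. -/
noncomputable def dAct : Derivation ℝ SymPoly SymPoly :=
  mkDerivation ℝ fun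
    | Var.act => 1
    | Var.actInv => -(Ai ^ 2)
    | _ => 0

/-- The derivation `∂/∂θ`. -/
noncomputable def dAng : Derivation ℝ SymPoly SymPoly := pderiv Var.ang

/-- The derivation `∂/∂τ`. -/
noncomputable def dSlow : Derivation ℝ SymPoly SymPoly :=
  mkDerivation ℝ fun
    | Var.distInv => -(Di ^ 2 * Dn 1)
    | Var.dist n => Dn (n + 1)
    | _ => 0

@[simp] theorem dAct_E : dAct E = 0 := mkDerivation_X ..
@[simp] theorem dAct_A : dAct A = 1 := mkDerivation_X ..
@[simp] theorem dAct_Ai : dAct Ai = -(Ai ^ 2) := mkDerivation_X ..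
@[simp] theorem dAct_Th : dAct Th = 0 := mkDerivation_X ..
@[simp] theorem dAct_Di : dAct Di = 0 := mkDerivation_X ..
@[simp] theorem dAct_Dn (n : ℕ) : dAct (Dn n) = 0 := mkDerivation_X ..
@[simp] theorem dSlow_E : dSlow E = 0 := mkDerivation_X ..
@[simp] theorem dSlow_A : dSlow A = 0 := mkDerivation_X ..
@[simp] theorem dSlow_Ai : dSlow Ai = 0 := mkDerivation_X ..
@[simp] theorem dSlow_Th : dSlow Th = 0 := mkDerivation_X ..
@[simp] theorem dSlow_Di : dSlow Di = -(Di ^ 2 * Dn 1) := mkDerivation_X ..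
@[simp] theorem dSlow_Dn (n : ℕ) : dSlow (Dn n) = Dn (n + 1) := mkDerivation_X ..
@[simp] theorem dAng_E : dAng E = 0 := pderiv_X_of_ne (by simp)
@[simp] theorem dAng_A : dAng A = 0 := pderiv_X_of_ne (by simp)
@[simp] theorem dAng_Ai : dAng Ai = 0 := pderiv_X_of_ne (by simp)
@[simp] theorem dAng_Th : dAng Th = 1 := pderiv_X_self _
@[simp] theorem dAng_Di : dAng Di = 0 := pderiv_X_of_ne (by simp)
@[simp] theorem dAng_Dn (n : ℕ) : dAng (Dn n) = 0 := pderiv_X_of_ne (by simp)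
@[simp] theorem dAng_C (c : ℝ) : dAng (C c) = 0 := derivation_C _ _
@[simp] theorem dAct_C (c : ℝ) : dAct (C c) = 0 := derivation_C _ _
@[simp] theorem dSlow_C (c : ℝ) : dSlow (C c) = 0 := derivation_C _ _

/-- Induction over polynomials with one case for each indeterminate. -/
theorem induct {M : SymPoly → Prop} (p : SymPoly) (hC : ∀ c, M (C c))
    (hadd : ∀ p q, M p → M q → M (p + q)) (hmul : ∀ p q, M p → M q → M (p * q))
    (hE : M E) (hA : M A) (hAi : M Ai) (hTh : M Th) (hDi : M Di) (hDn : ∀ n, M (Dn n)) : M p := by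
  induction p using MvPolynomial.induction_on with
  | C a => exact hC a
  | add p q hp hq => exact hadd p q hp hq
  | mul_X p i hp =>
    refine hmul _ _ hp ?_
    cases i with
    | eps => exact hE
    | act => exact hA
    | actInv => exact hAi
    | ang => exact hTh
    | distInv => exact hDi
    | dist n => exact hDn n

/-- Two derivations of polynomials that commute on the indeterminates commute. -/
theorem comm_of_X (D₁ D₂ : Derivation ℝ SymPoly SymPoly)
    (h : ∀ i, D₁ (D₂ (X i)) = D₂ (D₁ (X i))) (p : SymPoly) : D₁ (D₂ p) = D₂ (D₁ p) := by
  have : ⁅D₁, D₂⁆ = 0 := by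
    refine MvPolynomial.derivation_ext fun i => ?_
    simp [Derivation.commutator_apply, h i]
  have h2 := congrArg (fun D => D p) this
  simpa [Derivation.commutator_apply, sub_eq_zero] using h2

theorem dSlow_dAng (p : SymPoly) : dSlow (dAng p) = dAng (dSlow p) := by
  refine comm_of_X _ _ (fun i => ?_) p
  cases i with
  | eps => change dSlow (dAng E) = dAng (dSlow E); simp
  | act => change dSlow (dAng A) = dAng (dSlow A); simp
  | actInv => change dSlow (dAng Ai) = dAng (dSlow Ai); simp
  | ang => change dSlow (dAng Th) = dAng (dSlow Th); simp
  | distInv => change dSlow (dAng Di) = dAng (dSlow Di); simp [Derivation.leibniz_pow]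
  | dist n => change dSlow (dAng (Dn n)) = dAng (dSlow (Dn n)); simp

theorem dAct_dAng (p : SymPoly) : dAct (dAng p) = dAng (dAct p) := by
  refine comm_of_X _ _ (fun i => ?_) p
  cases i with
  | eps => change dAct (dAng E) = dAng (dAct E); simp
  | act => change dAct (dAng A) = dAng (dAct A); simp
  | actInv => change dAct (dAng Ai) = dAng (dAct Ai); simp [Derivation.leibniz_pow]
  | ang => change dAct (dAng Th) = dAng (dAct Th); simp
  | distInv => change dAct (dAng Di) = dAng (dAct Di); simp
  | dist n => change dAct (dAng (Dn n)) = dAng (dAct (Dn n)); simp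

theorem dAct_dSlow (p : SymPoly) : dAct (dSlow p) = dSlow (dAct p) := by
  refine comm_of_X _ _ (fun i => ?_) p
  cases i with
  | eps => change dAct (dSlow E) = dSlow (dAct E); simp
  | act => change dAct (dSlow A) = dSlow (dAct A); simp
  | actInv => change dAct (dSlow Ai) = dSlow (dAct Ai); simp [Derivation.leibniz_pow]
  | ang => change dAct (dSlow Th) = dSlow (dAct Th); simp
  | distInv => change dAct (dSlow Di) = dSlow (dAct Di); simp [Derivation.leibniz_pow]
  | dist n => change dAct (dSlow (Dn n)) = dSlow (dAct (Dn n)); simp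

/-- The values of the indeterminates. -/
noncomputable def env (d : ℝ → ℝ) (ε J τ θ : ℝ) : Var → ℝ
  | Var.eps => ε
  | Var.act => J
  | Var.actInv => J⁻¹
  | Var.ang => θ
  | Var.distInv => (d τ)⁻¹
  | Var.dist n => iteratedDeriv n d τ

/-- The value of a polynomial. -/
noncomputable def ev (d : ℝ → ℝ) (ε J τ θ : ℝ) : SymPoly →ₐ[ℝ] ℝ := aeval (env d ε J τ θ)

section ev
variable {d : ℝ → ℝ} {ε J τ θ : ℝ}

@[simp] theorem ev_E : ev d ε J τ θ E = ε := aeval_X ..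
@[simp] theorem ev_A : ev d ε J τ θ A = J := aeval_X ..
@[simp] theorem ev_Ai : ev d ε J τ θ Ai = J⁻¹ := aeval_X ..
@[simp] theorem ev_Th : ev d ε J τ θ Th = θ := aeval_X ..
@[simp] theorem ev_Di : ev d ε J τ θ Di = (d τ)⁻¹ := aeval_X ..
@[simp] theorem ev_Dn (n : ℕ) : ev d ε J τ θ (Dn n) = iteratedDeriv n d τ := aeval_X ..
@[simp] theorem ev_C (c : ℝ) : ev d ε J τ θ (C c) = c := by simp [ev]

end ev

attribute [irreducible] ev

/-- The chain rule for the value of a polynomial along a curve. -/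
theorem hasDerivWithinAt_ev {d : ℝ → ℝ} (hd : ContDiff ℝ ∞ d) (hpos : ∀ τ, 0 < d τ) (ε : ℝ)
    {j T θ : ℝ → ℝ} {j' T' θ' : ℝ} {s : Set ℝ} {t : ℝ}
    (hj : HasDerivWithinAt j j' s t) (hT : HasDerivWithinAt T T' s t)
    (hθ : HasDerivWithinAt θ θ' s t) (hJ : j t ≠ 0) (p : SymPoly) :
    HasDerivWithinAt (fun u => ev d ε (j u) (T u) (θ u) p)
      (ev d ε (j t) (T t) (θ t) (dAct p) * j' + ev d ε (j t) (T t) (θ t) (dSlow p) * T' +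
        ev d ε (j t) (T t) (θ t) (dAng p) * θ') s t := by
  have hiter : ∀ n x, HasDerivAt (iteratedDeriv n d) (iteratedDeriv (n + 1) d x) x := fun n x => by
    rw [iteratedDeriv_succ]
    exact ((hd.differentiable_iteratedDeriv n (by exact_mod_cast WithTop.coe_lt_top n)) x).hasDerivAt
  induction p using induct with
  | hC c => simpa using hasDerivWithinAt_const t s c
  | hadd p q hp hq =>
    simp only [map_add]
    exact (hp.fun_add hq).congr_deriv (by ring)
  | hmul p q hp hq =>
    simp only [map_mul, Derivation.leibniz, map_add, smul_eq_mul]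
    exact (hp.fun_mul hq).congr_deriv (by ring)
  | hE => simpa using hasDerivWithinAt_const t s ε
  | hA => simpa using hj
  | hAi =>
    simp only [ev_Ai, dAct_Ai, dSlow_Ai, dAng_Ai, map_zero, zero_mul, add_zero, map_neg, map_pow]
    exact (hj.fun_inv hJ).congr_deriv (by field_simp)
  | hTh => simpa using hθ
  | hDi =>
    simp only [ev_Di, dAct_Di, dSlow_Di, dAng_Di, map_zero, zero_mul, add_zero, map_neg, map_pow,
      map_mul, ev_Dn, zero_add]
    have h0 : HasDerivWithinAt (fun u => d (T u)) (iteratedDeriv 1 d (T t) * T') s t := by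
      have h := hiter 0 (T t)
      rw [iteratedDeriv_zero] at h
      exact h.comp_hasDerivWithinAt t hT
    exact (h0.fun_inv (hpos _).ne').congr_deriv (by field_simp)
  | hDn n =>
    simp only [ev_Dn, dAct_Dn, dSlow_Dn, dAng_Dn, map_zero, zero_mul, add_zero, zero_add]
    exact (hiter n (T t)).comp_hasDerivWithinAt t hT

theorem hasDerivAt_ev_act {d : ℝ → ℝ} (hd : ContDiff ℝ ∞ d) (hpos : ∀ τ, 0 < d τ) (ε : ℝ) {J : ℝ}
    (hJ : J ≠ 0) (τ θ : ℝ) (p : SymPoly) :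
    HasDerivAt (fun j => ev d ε j τ θ p) (ev d ε J τ θ (dAct p)) J := by
  simpa [hasDerivWithinAt_univ] using hasDerivWithinAt_ev hd hpos ε (s := univ) (j := id)
    (hasDerivWithinAt_id J univ) (hasDerivWithinAt_const J univ τ)
    (hasDerivWithinAt_const J univ θ) hJ p

theorem hasDerivAt_ev_slow {d : ℝ → ℝ} (hd : ContDiff ℝ ∞ d) (hpos : ∀ τ, 0 < d τ) (ε : ℝ) {J : ℝ}
    (hJ : J ≠ 0) (τ θ : ℝ) (p : SymPoly) :
    HasDerivAt (fun s => ev d ε J s θ p) (ev d ε J τ θ (dSlow p)) τ := by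
  simpa [hasDerivWithinAt_univ] using hasDerivWithinAt_ev hd hpos ε (s := univ) (T := id)
    (hasDerivWithinAt_const τ univ J) (hasDerivWithinAt_id τ univ)
    (hasDerivWithinAt_const τ univ θ) hJ p

theorem hasDerivAt_ev_ang {d : ℝ → ℝ} (hd : ContDiff ℝ ∞ d) (hpos : ∀ τ, 0 < d τ) (ε : ℝ) {J : ℝ}
    (hJ : J ≠ 0) (τ θ : ℝ) (p : SymPoly) :
    HasDerivAt (fun s => ev d ε J τ s p) (ev d ε J τ θ (dAng p)) θ := by
  simpa [hasDerivWithinAt_univ] using hasDerivWithinAt_ev hd hpos ε (s := univ) (θ := id)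
    (hasDerivWithinAt_const θ univ J) (hasDerivWithinAt_const θ univ τ)
    (hasDerivWithinAt_id θ univ) hJ p

theorem contDiffOn_ev {d : ℝ → ℝ} (hd : ContDiff ℝ ∞ d) (hpos : ∀ τ, 0 < d τ) (ε θ : ℝ)
    (p : SymPoly) :
    ContDiffOn ℝ ∞ (fun q : ℝ × ℝ => ev d ε q.1 q.2 θ p) (Ioi 0 ×ˢ univ) := by
  induction p using induct with
  | hC c => simpa using contDiffOn_const
  | hadd p q hp hq => simpa only [map_add] using hp.add hq
  | hmul p q hp hq => simpa only [map_mul] using hp.mul hq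
  | hE => simpa using contDiffOn_const
  | hA => simpa using contDiffOn_fst
  | hAi =>
    simp only [ev_Ai]
    exact contDiffOn_fst.inv fun q hq => (mem_Ioi.1 hq.1).ne'
  | hTh => simpa using contDiffOn_const
  | hDi =>
    simp only [ev_Di]
    exact (hd.comp contDiff_snd).contDiffOn.inv fun q _ => (hpos q.2).ne'
  | hDn n =>
    have : ContDiff ℝ ∞ (iteratedDeriv n d) := by
      rw [iteratedDeriv_eq_iterate]
      exact hd.iterate_deriv n
    simp only [ev_Dn]
    exact (this.comp contDiff_snd).contDiffOn

/-- The value of a polynomial is jointly continuous in the slow time and the angle. -/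
theorem continuous_ev {d : ℝ → ℝ} (hd : ContDiff ℝ ∞ d) (hpos : ∀ τ, 0 < d τ) (ε J : ℝ)
    (p : SymPoly) : Continuous fun q : ℝ × ℝ => ev d ε J q.1 q.2 p := by
  induction p using induct with
  | hC c => simpa using continuous_const
  | hadd p q hp hq => simpa only [map_add] using hp.fun_add hq
  | hmul p q hp hq => simpa only [map_mul] using hp.fun_mul hq
  | hE => simpa using continuous_const
  | hA => simpa using continuous_const
  | hAi => simpa using continuous_const
  | hTh => simpa using continuous_snd
  | hDi =>
    simp only [ev_Di]
    exact (hd.continuous.comp continuous_fst).inv₀ fun q => (hpos q.1).ne'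
  | hDn n =>
    simp only [ev_Dn]
    exact (hd.continuous_iteratedDeriv n (by exact_mod_cast le_top)).comp continuous_fst

/-- A polynomial is bounded, uniformly for slow times in a set on which all derivatives of the
distance are bounded. -/
theorem exists_bound_ev {d : ℝ → ℝ} {c : ℝ} (hc : 0 < c) (hcd : ∀ τ, c ≤ d τ) {U : Set ℝ}
    (hU : ∀ n : ℕ, ∃ M : ℝ, ∀ τ ∈ U, |iteratedDeriv n d τ| ≤ M) {α β : ℝ} (hα : 0 < α)
    (p : SymPoly) :
    ∃ M : ℝ, 0 < M ∧ ∀ ε ∈ Icc (0 : ℝ) 1, ∀ J ∈ Icc α β, ∀ τ ∈ U, ∀ θ ∈ Icc (-π) π,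
      |ev d ε J τ θ p| ≤ M := by
  suffices h : ∃ M : ℝ, ∀ ε ∈ Icc (0 : ℝ) 1, ∀ J ∈ Icc α β, ∀ τ ∈ U, ∀ θ ∈ Icc (-π) π,
      |ev d ε J τ θ p| ≤ M by
    obtain ⟨M, hM⟩ := h
    exact ⟨max M 1, by positivity, fun ε hε J hJ τ hτ θ hθ =>
      (hM ε hε J hJ τ hτ θ hθ).trans (le_max_left _ _)⟩
  induction p using induct with
  | hC x => exact ⟨|x|, fun ε _ J _ τ _ θ _ => by simp⟩
  | hadd p q hp hq =>
    obtain ⟨M, hM⟩ := hp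
    obtain ⟨N, hN⟩ := hq
    refine ⟨M + N, fun ε hε J hJ τ hτ θ hθ => ?_⟩
    rw [map_add]
    exact (abs_add_le _ _).trans (add_le_add (hM ε hε J hJ τ hτ θ hθ) (hN ε hε J hJ τ hτ θ hθ))
  | hmul p q hp hq =>
    obtain ⟨M, hM⟩ := hp
    obtain ⟨N, hN⟩ := hq
    refine ⟨M * N, fun ε hε J hJ τ hτ θ hθ => ?_⟩
    rw [map_mul, abs_mul]
    exact mul_le_mul (hM ε hε J hJ τ hτ θ hθ) (hN ε hε J hJ τ hτ θ hθ) (abs_nonneg _)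
      ((abs_nonneg _).trans (hM ε hε J hJ τ hτ θ hθ))
  | hE => exact ⟨1, fun ε hε J _ τ _ θ _ => by simpa [abs_of_nonneg hε.1] using hε.2⟩
  | hA =>
    refine ⟨β, fun ε _ J hJ τ _ θ _ => ?_⟩
    simpa [abs_of_pos (hα.trans_le hJ.1)] using hJ.2
  | hAi =>
    refine ⟨α⁻¹, fun ε _ J hJ τ _ θ _ => ?_⟩
    simp only [ev_Ai, abs_inv, abs_of_pos (hα.trans_le hJ.1)]
    exact inv_anti₀ hα hJ.1
  | hTh => exact ⟨π, fun ε _ J _ τ _ θ hθ => by simpa using abs_le.2 hθ⟩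
  | hDi =>
    refine ⟨c⁻¹, fun ε _ J hJ τ _ θ _ => ?_⟩
    simp only [ev_Di, abs_inv, abs_of_pos (hc.trans_le (hcd τ))]
    exact inv_anti₀ hc (hcd τ)
  | hDn n =>
    obtain ⟨M, hM⟩ := hU n
    exact ⟨M, fun ε _ J _ τ hτ θ _ => by simpa using hM τ hτ⟩

/-- Equality of the values of two polynomials, for the distance `d`, at all points of positive action. -/
def Equiv (d : ℝ → ℝ) (p q : SymPoly) : Prop :=
  ∀ ε J τ θ, 0 < J → ev d ε J τ θ p = ev d ε J τ θ q

theorem Equiv.dAng {d : ℝ → ℝ} (hd : ContDiff ℝ ∞ d) (hpos : ∀ τ, 0 < d τ) {p q : SymPoly}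
    (h : Equiv d p q) : Equiv d (dAng p) (dAng q) := fun ε J τ θ hJ => by
  refine (hasDerivAt_ev_ang hd hpos ε hJ.ne' τ θ p).unique ?_
  simpa only [h ε J τ _ hJ] using hasDerivAt_ev_ang hd hpos ε hJ.ne' τ θ q

theorem Equiv.dAct {d : ℝ → ℝ} (hd : ContDiff ℝ ∞ d) (hpos : ∀ τ, 0 < d τ) {p q : SymPoly}
    (h : Equiv d p q) : Equiv d (dAct p) (dAct q) := fun ε J τ θ hJ => by
  refine (hasDerivAt_ev_act hd hpos ε hJ.ne' τ θ p).unique ?_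
  refine (hasDerivAt_ev_act hd hpos ε hJ.ne' τ θ q).congr_of_eventuallyEq ?_
  filter_upwards [lt_mem_nhds hJ] with j hj using h ε j τ θ hj

/-- The substitution of `0` for the small parameter. -/
noncomputable def setE : SymPoly →ₐ[ℝ] SymPoly :=
  aeval fun
    | Var.eps => 0
    | i => X i

/-- The substitution of a number for the angle. -/
noncomputable def setTh (c : ℝ) : SymPoly →ₐ[ℝ] SymPoly :=
  aeval fun
    | Var.ang => C c
    | i => X i

theorem ev_setE (d : ℝ → ℝ) (ε J τ θ : ℝ) (p : SymPoly) :
    ev d ε J τ θ (setE p) = ev d 0 J τ θ p := by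
  suffices (ev d ε J τ θ).comp setE = ev d 0 J τ θ from congrArg (fun f => f p) this
  refine MvPolynomial.algHom_ext fun i => ?_
  cases i <;> simp [setE, ev, env]

theorem ev_setTh (d : ℝ → ℝ) (ε J τ θ c : ℝ) (p : SymPoly) :
    ev d ε J τ θ (setTh c p) = ev d ε J τ c p := by
  suffices (ev d ε J τ θ).comp (setTh c) = ev d ε J τ c from congrArg (fun f => f p) this
  refine MvPolynomial.algHom_ext fun i => ?_
  cases i <;> simp [setTh, ev, env]

theorem dAng_setTh (c : ℝ) (p : SymPoly) : dAng (setTh c p) = 0 := by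
  induction p using MvPolynomial.induction_on with
  | C a => simp [dAng, setTh]
  | add p q hp hq => simp [hp, hq]
  | mul_X p i hp =>
    rw [map_mul, Derivation.leibniz, hp]
    cases i <;> simp [setTh, dAng]

/-- Every polynomial is the sum of its value at `ε = 0` and a multiple of `ε`. -/
theorem exists_eq_setE_add (p : SymPoly) : ∃ q, p = setE p + E * q := by
  induction p using MvPolynomial.induction_on with
  | C a => exact ⟨0, by simp [setE]⟩
  | add p q hp hq =>
    obtain ⟨p', hp⟩ := hp
    obtain ⟨q', hq⟩ := hq
    refine ⟨p' + q', ?_⟩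
    rw [map_add, mul_add]
    nth_rewrite 1 [hp]
    nth_rewrite 1 [hq]
    ring
  | mul_X p i hp =>
    obtain ⟨p', hp⟩ := hp
    by_cases hi : i = Var.eps
    · subst hi
      exact ⟨p, by simp [setE, E, mul_comm]⟩
    · have hX : setE (X i) = X i := by
        cases i <;> simp_all [setE]
      refine ⟨p' * X i, ?_⟩
      rw [map_mul, hX]
      nth_rewrite 1 [hp]
      ring

/-- Every polynomial has an antiderivative with respect to the angle. -/
theorem exists_dAng_eq (p : SymPoly) : ∃ q, dAng q = p := by
  induction p using MvPolynomial.induction_on' with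
  | monomial u a =>
    refine ⟨monomial (u + Finsupp.single Var.ang 1) (a / (u Var.ang + 1)), ?_⟩
    have : (u Var.ang : ℝ) + 1 ≠ 0 := by positivity
    simp [dAng, pderiv_monomial, this]
  | add p q hp hq =>
    obtain ⟨p', hp⟩ := hp
    obtain ⟨q', hq⟩ := hq
    exact ⟨p' + q', by rw [map_add, hp, hq]⟩

end SymPoly
end FermiUlam

namespace FermiUlam

/-! ### The sawtooth -/

theorem sawtooth_eq_iff {φ θ : ℝ} :
    sawtooth φ = θ ↔ θ ∈ Ico (-π) π ∧ ∃ n : ℤ, φ = θ + n * (2 * π) := by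
  have h := toIcoMod_eq_iff Real.two_pi_pos (a := -π) (b := φ) (c := θ)
  rw [show -π + 2 * π = π by ring] at h
  simpa [sawtooth, zsmul_eq_mul] using h

theorem sawtooth_mem (φ : ℝ) : sawtooth φ ∈ Ico (-π) π := (sawtooth_eq_iff.1 rfl).1

theorem sawtooth_mem_Icc (φ : ℝ) : sawtooth φ ∈ Icc (-π) π := Ico_subset_Icc_self (sawtooth_mem φ)

theorem sawtooth_of_mem {φ : ℝ} (h : φ ∈ Ico (-π) π) : sawtooth φ = φ :=
  sawtooth_eq_iff.2 ⟨h, 0, by simp⟩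

theorem sawtooth_periodic : Function.Periodic sawtooth (2 * π) :=
  fun φ => toIcoMod_add_right Real.two_pi_pos _ φ

theorem isOddPi_iff {φ : ℝ} : IsOddPi φ ↔ sawtooth φ = -π := by
  rw [sawtooth_eq_iff]
  constructor
  · rintro ⟨n, rfl⟩
    exact ⟨⟨le_rfl, by linarith [pi_pos]⟩, n + 1, by push_cast; ring⟩
  · rintro ⟨-, n, rfl⟩
    exact ⟨n - 1, by push_cast; ring⟩

theorem sawtooth_add {φ h : ℝ} (hh : sawtooth φ + h ∈ Ico (-π) π) :
    sawtooth (φ + h) = sawtooth φ + h := by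
  obtain ⟨-, n, hn⟩ := sawtooth_eq_iff.1 (rfl : sawtooth φ = sawtooth φ)
  exact sawtooth_eq_iff.2 ⟨hh, n, by linarith⟩

theorem sawtooth_eventuallyEq_right (φ₀ : ℝ) :
    ∀ᶠ φ in 𝓝[≥] φ₀, sawtooth φ = sawtooth φ₀ + (φ - φ₀) := by
  have h := sawtooth_mem φ₀
  have h1 : ∀ᶠ φ in 𝓝[≥] φ₀, φ < φ₀ + (π - sawtooth φ₀) :=
    (gt_mem_nhds (by linarith [h.2])).filter_mono nhdsWithin_le_nhds
  filter_upwards [h1, self_mem_nhdsWithin] with φ h2 h3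
  have h4 : φ₀ ≤ φ := h3
  have := sawtooth_add (φ := φ₀) (h := φ - φ₀) ⟨by linarith [h.1], by linarith⟩
  simpa using this

theorem sawtooth_eventuallyEq {φ₀ : ℝ} (h0 : ¬ IsOddPi φ₀) :
    ∀ᶠ φ in 𝓝 φ₀, sawtooth φ = sawtooth φ₀ + (φ - φ₀) := by
  have h := sawtooth_mem φ₀
  have h' : -π < sawtooth φ₀ := lt_of_le_of_ne h.1 fun h1 => h0 (isOddPi_iff.2 h1.symm)
  filter_upwards [gt_mem_nhds (show φ₀ < φ₀ + (π - sawtooth φ₀) by linarith [h.2]),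
    lt_mem_nhds (show φ₀ - (sawtooth φ₀ + π) < φ₀ by linarith)] with φ h2 h3
  have := sawtooth_add (φ := φ₀) (h := φ - φ₀) ⟨by linarith, by linarith⟩
  simpa using this

/-- The limit of the sawtooth from the left at its discontinuities is `π`. -/
theorem sawtooth_eventuallyEq_left {φ₀ : ℝ} (h0 : IsOddPi φ₀) :
    ∀ᶠ φ in 𝓝[<] φ₀, sawtooth φ = π + (φ - φ₀) := by
  obtain ⟨n, rfl⟩ := h0
  have h1 : ∀ᶠ φ in 𝓝[<] ((2 * n + 1) * π), (2 * n + 1) * π - 2 * π < φ :=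
    (lt_mem_nhds (by linarith [pi_pos])).filter_mono nhdsWithin_le_nhds
  filter_upwards [h1, self_mem_nhdsWithin] with φ h2 h3
  have h4 : φ < (2 * n + 1) * π := h3
  exact sawtooth_eq_iff.2 ⟨⟨by linarith, by linarith⟩, n, by ring⟩

/-- A function of the sawtooth whose values at `π` and `-π` agree is continuous. -/
theorem continuous_comp_sawtooth {g : ℝ × ℝ → ℝ} (hg : Continuous g)
    (hp : ∀ τ, g (τ, π) = g (τ, -π)) : Continuous fun q : ℝ × ℝ => g (q.1, sawtooth q.2) := by
  refine continuous_iff_continuousAt.2 fun ⟨τ₀, φ₀⟩ => ?_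
  have key : ∀ c : ℝ, g (τ₀, c) = g (τ₀, sawtooth φ₀) →
      Tendsto (fun q : ℝ × ℝ => g (q.1, c + (q.2 - φ₀))) (𝓝 (τ₀, φ₀))
        (𝓝 (g (τ₀, sawtooth φ₀))) := fun c hc => by
    have : Continuous fun q : ℝ × ℝ => g (q.1, c + (q.2 - φ₀)) := by fun_prop
    simpa [hc] using this.tendsto (τ₀, φ₀)
  refine tendsto_def.2 fun s hs => ?_
  by_cases h0 : IsOddPi φ₀
  · have e := isOddPi_iff.1 h0
    have h1 := key _ rfl hs
    have h2 := key π (by rw [e, hp]) hs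
    have h3 : ∀ᶠ φ in 𝓝 φ₀, sawtooth φ = sawtooth φ₀ + (φ - φ₀) ∨ sawtooth φ = π + (φ - φ₀) := by
      rw [← nhdsLT_sup_nhdsGE, eventually_sup]
      exact ⟨(sawtooth_eventuallyEq_left h0).mono fun _ => Or.inr,
        (sawtooth_eventuallyEq_right φ₀).mono fun _ => Or.inl⟩
    filter_upwards [h1, h2, (continuous_snd.tendsto (τ₀, φ₀)).eventually h3] with q a b c
    rcases c with c | c
    · simpa only [mem_preimage, c] using a
    · simpa only [mem_preimage, c] using b
  · filter_upwards [key _ rfl hs, (continuous_snd.tendsto (τ₀, φ₀)).eventually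
      (sawtooth_eventuallyEq h0)] with q a c
    simpa only [mem_preimage, c] using a

theorem hasDerivAt_sawtooth {φ : ℝ} (h : ¬ IsOddPi φ) : HasDerivAt sawtooth 1 φ := by
  refine HasDerivAt.congr_of_eventuallyEq ?_ (sawtooth_eventuallyEq h)
  simpa using ((hasDerivAt_id φ).sub_const φ).const_add (sawtooth φ)

/-- The sawtooth is differentiable from the right along increasing functions. -/
theorem hasDerivWithinAt_sawtooth_comp {φ : ℝ → ℝ} {φ' t : ℝ}
    (h : HasDerivWithinAt φ φ' (Ici t) t) (hφ : 0 < φ') :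
    HasDerivWithinAt (fun s => sawtooth (φ s)) φ' (Ici t) t := by
  have h1 : HasDerivWithinAt (fun s => sawtooth (φ t) + (φ s - φ t)) φ' (Ici t) t :=
    (h.sub_const _).const_add _
  refine h1.congr_of_eventuallyEq ?_ (by simp)
  have h2 : ∀ᶠ s in 𝓝[≥] t, φ t ≤ φ s := by
    have h3 : ∀ᶠ s in 𝓝[>] t, φ t ≤ φ s := by
      have h4 := ((hasDerivWithinAt_iff_tendsto_slope' (lt_irrefl t)).1 h.Ioi_of_Ici).eventually
        (lt_mem_nhds hφ)
      filter_upwards [h4, self_mem_nhdsWithin] with s hs hs'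
      have hts : 0 < s - t := sub_pos.2 hs'
      rw [slope_def_field, div_pos_iff_of_pos_right hts] at hs
      linarith
    rw [← Ioi_insert, nhdsWithin_insert, eventually_sup]
    exact ⟨by simp, h3⟩
  have h5 : Tendsto φ (𝓝[≥] t) (𝓝[≥] (φ t)) :=
    tendsto_nhdsWithin_of_tendsto_nhds_of_eventually_within _ h.continuousWithinAt h2
  exact h5.eventually (sawtooth_eventuallyEq_right (φ t))

theorem hasDerivWithinAt_sawtooth (φ : ℝ) : HasDerivWithinAt sawtooth 1 (Ici φ) φ :=
  hasDerivWithinAt_sawtooth_comp (hasDerivWithinAt_id φ _) one_pos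

/-- Between consecutive odd multiples of `π` the sawtooth is a translation. -/
theorem sawtooth_sub_of_no_odd {p q : ℝ} (h : ∀ x ∈ uIcc p q, ¬ IsOddPi x) :
    sawtooth q - sawtooth p = q - p := by
  wlog hpq : p ≤ q generalizing p q
  · have := this (p := q) (q := p) (by rwa [uIcc_comm]) (le_of_not_ge hpq)
    linarith
  rw [uIcc_of_le hpq] at h
  have hp := sawtooth_mem p
  rcases lt_or_ge (sawtooth p + (q - p)) π with h1 | h1
  · have := sawtooth_add (φ := p) (h := q - p) ⟨by linarith [hp.1], h1⟩
    rw [add_sub_cancel] at this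
    linarith
  · obtain ⟨-, n, hn⟩ := sawtooth_eq_iff.1 (rfl : sawtooth p = sawtooth p)
    refine absurd ⟨n, ?_⟩ (h (p + (π - sawtooth p)) ⟨by linarith [hp.2], by linarith⟩)
    linarith

/-- A function of the sawtooth whose values at `π` and `-π` agree is Lipschitz if its derivative
is bounded. -/
theorem abs_comp_sawtooth_sub_le {g g' : ℝ → ℝ} {C : ℝ} (hg : ∀ θ, HasDerivAt g (g' θ) θ)
    (hp : g π = g (-π)) (hC : ∀ θ ∈ Icc (-π) π, |g' θ| ≤ C) (p q : ℝ) :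
    |g (sawtooth q) - g (sawtooth p)| ≤ C * |q - p| := by
  wlog hpq : p ≤ q generalizing p q
  · rw [abs_sub_comm, abs_sub_comm q]
    exact this q p (le_of_not_ge hpq)
  have hgc : Continuous g := continuous_iff_continuousAt.2 fun θ => (hg θ).continuousAt
  have hc : Continuous fun φ => g (sawtooth φ) := by
    have := continuous_comp_sawtooth (g := fun q => g q.2) (by fun_prop) fun _ => hp
    exact this.comp (by fun_prop : Continuous fun φ : ℝ => ((0 : ℝ), φ))
  rw [abs_of_nonneg (sub_nonneg.2 hpq)]
  refine norm_image_sub_le_of_norm_deriv_right_le_segment (f := fun φ => g (sawtooth φ))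
    (f' := fun φ => g' (sawtooth φ)) hc.continuousOn (fun x _ => ?_)
    (fun x _ => hC _ (sawtooth_mem_Icc x)) q ⟨hpq, le_rfl⟩
  exact ((hg (sawtooth x)).comp_hasDerivWithinAt x (hasDerivWithinAt_sawtooth x)).congr_deriv
    (mul_one _)

theorem integral_comp_sawtooth (f : ℝ → ℝ) :
    ∫ φ in (0 : ℝ)..2 * π, f (sawtooth φ) = ∫ θ in (-π)..π, f θ := by
  have hp : Function.Periodic (fun φ => f (sawtooth φ)) (2 * π) := sawtooth_periodic.comp f
  have h := hp.intervalIntegral_add_eq 0 (-π)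
  rw [zero_add, show -π + 2 * π = π by ring] at h
  rw [h]
  refine intervalIntegral.integral_congr_ae ?_
  filter_upwards [MeasureTheory.Measure.ae_ne MeasureTheory.volume π] with φ h1 h2
  rw [uIoc_of_le (by linarith [pi_pos])] at h2
  rw [sawtooth_of_mem ⟨h2.1.le, lt_of_le_of_ne h2.2 h1⟩]

end FermiUlam

namespace FermiUlam

namespace SymPoly
open MvPolynomial

/-! ### The formal perturbation procedure -/

/-- The Hamiltonian with the polynomial `I` in place of the action. -/
noncomputable def hamP (I : SymPoly) : SymPoly :=
  C (π ^ 2 / 2) * I ^ 2 * Di ^ 2 - E * I * Dn 1 * Di * Th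

/-- The polynomial of the generating function `S` of order `r`. -/
noncomputable def genP (s : ℕ → SymPoly) (r : ℕ) : SymPoly :=
  ∑ i ∈ Finset.Icc 1 (r - 1), E ^ (i - 1) * s i

/-- The polynomial of the old action `J + ε ∂S/∂φ`. -/
noncomputable def actP (s : ℕ → SymPoly) (r : ℕ) : SymPoly := A + E * dAng (genP s r)

/-- The polynomial of the truncated new Hamiltonian. -/
noncomputable def kamP (κ : ℕ → SymPoly) (r : ℕ) : SymPoly := ∑ i ∈ Finset.range r, E ^ i * κ i

/-- The remainder of the normal form of order `r`: the transformed Hamiltonian minus the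
truncated one. -/
noncomputable def remP (s κ : ℕ → SymPoly) (r : ℕ) : SymPoly :=
  hamP (actP s r) + E ^ 2 * dSlow (genP s r) - kamP κ r

/-- The part `ε d d' θ / π ^ 2` of the action that jumps at an impact with the moving wall. -/
noncomputable def jumpP : SymPoly := C (1 / π ^ 2) * E * Dn 0 * Dn 1 * Th

/-- Polynomials `s 1, …, s (R - 1)` and `κ 0, …, κ (R - 1)` that realize the perturbation procedure
of all orders `r ≤ R`. From the second order on, the old action is the sum of `jumpP` and of a
function that takes equal values at `θ = π` and `θ = -π`. -/
structure IsProcedure (d : ℝ → ℝ) (R : ℕ) (s κ : ℕ → SymPoly) : Prop where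
  setE_s : ∀ i, 1 ≤ i → i < R → setE (s i) = s i
  periodic_s : ∀ i, 1 ≤ i → i < R → ∀ ε J τ, 0 < J → ev d ε J τ π (s i) = ev d ε J τ (-π) (s i)
  mean_s : ∀ i, 1 ≤ i → i < R → ∀ J τ, 0 < J → ∫ θ in (-π)..π, ev d 0 J τ θ (s i) = 0
  setE_κ : ∀ i < R, setE (κ i) = κ i
  dAng_κ : ∀ i < R, dAng (κ i) = 0
  zero_κ : κ 0 = C (π ^ 2 / 2) * A ^ 2 * Di ^ 2
  rem : ∀ r, 1 ≤ r → r ≤ R → ∃ ρ, Equiv d (remP s κ r) (E ^ r * ρ)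
  periodic_actP : ∀ r, 2 ≤ r → r ≤ R → ∀ ε J τ, 0 < J →
    ev d ε J τ π (actP s r - jumpP) = ev d ε J τ (-π) (actP s r - jumpP)

theorem genP_succ (s : ℕ → SymPoly) {r : ℕ} (hr : 1 ≤ r) :
    genP s (r + 1) = genP s r + E ^ (r - 1) * s r := by
  obtain ⟨m, rfl⟩ := Nat.exists_eq_add_of_le' hr
  simp [genP, Finset.sum_Icc_succ_top]

theorem genP_congr {s s' : ℕ → SymPoly} {r : ℕ} (h : ∀ i < r, s i = s' i) :
    genP s r = genP s' r :=
  Finset.sum_congr rfl fun i hi => by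
    rw [Finset.mem_Icc] at hi
    rw [h i (by omega)]

theorem kamP_congr {κ κ' : ℕ → SymPoly} {r : ℕ} (h : ∀ i < r, κ i = κ' i) :
    kamP κ r = kamP κ' r :=
  Finset.sum_congr rfl fun i hi => by rw [h i (Finset.mem_range.1 hi)]

theorem dAng_kamP {d : ℝ → ℝ} {R : ℕ} {s κ : ℕ → SymPoly} (h : IsProcedure d R s κ) {r : ℕ}
    (hr : r ≤ R) : dAng (kamP κ r) = 0 := by
  rw [kamP, map_sum]
  refine Finset.sum_eq_zero fun i hi => ?_
  rw [Finset.mem_range] at hi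
  simp [Derivation.leibniz, Derivation.leibniz_pow, h.dAng_κ i (by omega)]

/-- The value of a polynomial without the angle does not depend on the angle. -/
theorem ev_eq_of_dAng_eq_zero {d : ℝ → ℝ} (hd : ContDiff ℝ ∞ d) (hpos : ∀ τ, 0 < d τ) {p : SymPoly}
    (h : dAng p = 0) (ε : ℝ) {J : ℝ} (hJ : 0 < J) (τ θ θ' : ℝ) :
    ev d ε J τ θ p = ev d ε J τ θ' p := by
  have hder := fun x => hasDerivAt_ev_ang hd hpos ε hJ.ne' τ x p
  refine is_const_of_deriv_eq_zero (f := fun x => ev d ε J τ x p)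
    (fun x => (hder x).differentiableAt) (fun x => ?_) θ θ'
  rw [(hder x).deriv, h, map_zero]

theorem continuous_ev_eps (d : ℝ → ℝ) (J τ θ : ℝ) (p : SymPoly) :
    Continuous fun ε => ev d ε J τ θ p := by
  induction p using induct with
  | hadd p q hp hq => simpa only [map_add] using hp.fun_add hq
  | hmul p q hp hq => simpa only [map_mul] using hp.fun_mul hq
  | hE => simpa using continuous_id'
  | _ => simpa using continuous_const

theorem setE_setTh (c : ℝ) (p : SymPoly) : setE (setTh c p) = setTh c (setE p) := by
  suffices setE.comp (setTh c) = (setTh c).comp setE from congrArg (fun f => f p) this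
  refine MvPolynomial.algHom_ext fun i => ?_
  cases i <;> simp [setE, setTh]

theorem setE_setE (p : SymPoly) : setE (setE p) = setE p := by
  suffices setE.comp setE = setE from congrArg (fun f => f p) this
  refine MvPolynomial.algHom_ext fun i => ?_
  cases i <;> simp [setE]

theorem dAng_setE (p : SymPoly) : dAng (setE p) = setE (dAng p) := by
  induction p using induct with
  | hadd p q hp hq => simp only [map_add, hp, hq]
  | hmul p q hp hq => simp only [map_mul, Derivation.leibniz, map_add, hp, hq, smul_eq_mul]
  | hE => simp [show setE E = 0 by simp [setE, E]]
  | hA => simp [show setE A = A by simp [setE, A]]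
  | hAi => simp [show setE Ai = Ai by simp [setE, Ai]]
  | hTh => simp [show setE Th = Th by simp [setE, Th]]
  | hDi => simp [show setE Di = Di by simp [setE, Di]]
  | hDn n => simp [show setE (Dn n) = Dn n by simp [setE, Dn]]
  | hC c => simp [setE]

/-- The mean value in the angle of the derivative of `q`. -/
noncomputable def meanP (q : SymPoly) : SymPoly := C (1 / (2 * π)) * (setTh π q - setTh (-π) q)

theorem ev_meanP (d : ℝ → ℝ) (ε J τ θ : ℝ) (q : SymPoly) :
    2 * π * ev d ε J τ θ (meanP q) = ev d ε J τ π q - ev d ε J τ (-π) q := by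
  have := pi_pos
  simp only [meanP, map_mul, ev_C, map_sub, ev_setTh]
  field_simp

theorem dAng_meanP (q : SymPoly) : dAng (meanP q) = 0 := by
  simp [meanP, Derivation.leibniz, dAng_setTh]

theorem setE_meanP {q : SymPoly} (h : setE q = q) : setE (meanP q) = meanP q := by
  simp only [meanP, map_mul, map_sub, setE_setTh, h]
  simp [setE]

theorem exists_dAng_eq_of_setE {p : SymPoly} (h : setE p = p) : ∃ q, dAng q = p ∧ setE q = q := by
  obtain ⟨q, hq⟩ := exists_dAng_eq p
  exact ⟨setE q, by rw [dAng_setE, hq, h], setE_setE q⟩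

/-- The polynomial `meanP q` is the mean value of `dAng q`: their difference has zero average. -/
theorem integral_ev_sub_meanP {d : ℝ → ℝ} (hd : ContDiff ℝ ∞ d) (hpos : ∀ τ, 0 < d τ) {J : ℝ}
    (hJ : 0 < J) (τ : ℝ) (q : SymPoly) :
    ∫ θ in (-π)..π, ev d 0 J τ θ (dAng q - meanP q) = 0 := by
  have hder : ∀ θ, HasDerivAt (fun θ => ev d 0 J τ θ (q - meanP q * Th))
      (ev d 0 J τ θ (dAng q - meanP q)) θ := fun θ => by
    have h1 : dAng (q - meanP q * Th) = dAng q - meanP q := by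
      simp [Derivation.leibniz, dAng_meanP]
    have h2 := hasDerivAt_ev_ang hd hpos 0 hJ.ne' τ θ (q - meanP q * Th)
    rwa [h1] at h2
  have hcont : Continuous fun θ => ev d 0 J τ θ (dAng q - meanP q) :=
    (continuous_ev hd hpos 0 J (dAng q - meanP q)).comp (Continuous.prodMk_right τ)
  rw [intervalIntegral.integral_eq_sub_of_hasDerivAt (fun θ _ => hder θ)
    (hcont.intervalIntegrable _ _)]
  have h4 := ev_meanP d 0 J τ π q
  have h5 := ev_eq_of_dAng_eq_zero hd hpos (dAng_meanP q) 0 hJ τ (-π) π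
  simp only [map_sub, map_mul, ev_Th, h5]
  linear_combination -h4

theorem periodic_genP {d : ℝ → ℝ} {R : ℕ} {s κ : ℕ → SymPoly} (h : IsProcedure d R s κ) {r : ℕ}
    (hr : r ≤ R) (ε : ℝ) {J : ℝ} (τ : ℝ) (hJ : 0 < J) :
    ev d ε J τ π (genP s r) = ev d ε J τ (-π) (genP s r) := by
  simp only [genP, map_sum, map_mul, map_pow, ev_E]
  refine Finset.sum_congr rfl fun i hi => ?_
  rw [Finset.mem_Icc] at hi
  rw [h.periodic_s i hi.1 (by omega) ε J τ hJ]

/-- From the second order on, the remainder of the normal form takes equal values at `θ = π` and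
`θ = -π`: in terms of `I - jumpP` the Hamiltonian is an even function of the angle. -/
theorem periodic_remP {d : ℝ → ℝ} (hd : ContDiff ℝ ∞ d) (hpos : ∀ τ, 0 < d τ) {R : ℕ}
    {s κ : ℕ → SymPoly} (h : IsProcedure d R s κ) {r : ℕ} (h2 : 2 ≤ r)
    (hr : r ≤ R) (ε : ℝ) {J : ℝ} (τ : ℝ) (hJ : 0 < J) :
    ev d ε J τ π (remP s κ r) = ev d ε J τ (-π) (remP s κ r) := by
  have h1 : ev d ε J τ π (dSlow (genP s r)) = ev d ε J τ (-π) (dSlow (genP s r)) := by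
    refine (hasDerivAt_ev_slow hd hpos ε hJ.ne' τ π _).unique ?_
    simpa only [periodic_genP h hr ε _ hJ] using hasDerivAt_ev_slow hd hpos ε hJ.ne' τ (-π) _
  have h3 := ev_eq_of_dAng_eq_zero hd hpos (dAng_kamP h hr) ε hJ τ π (-π)
  have h4 := h.periodic_actP r h2 hr ε J τ hJ
  have h5 : ∀ θ, ev d ε J τ θ (hamP (actP s r)) =
      π ^ 2 / 2 * (ev d ε J τ θ (actP s r - jumpP)) ^ 2 * ((d τ)⁻¹) ^ 2
        - ε ^ 2 * iteratedDeriv 1 d τ ^ 2 * θ ^ 2 / (2 * π ^ 2) := fun θ => by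
    have h6 := (hpos τ).ne'
    have h7 := pi_pos.ne'
    simp only [hamP, jumpP, map_sub, map_mul, map_pow, ev_C, ev_E, ev_Dn, ev_Th, ev_Di,
      iteratedDeriv_zero]
    field_simp
    ring
  simp only [remP, map_sub, map_add, map_mul, map_pow, ev_E, h1, h3, h5, h4]
  ring

/-- The procedure of order two, with `S₁ = d d' (θ ^ 2 - π ^ 2 / 3) / (2 π ^ 2)` and `𝓗₁ = 0`. -/
theorem exists_isProcedure_two {d : ℝ → ℝ} (hpos : ∀ τ, 0 < d τ) :
    ∃ s κ, IsProcedure d 2 s κ := by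
  have hdAng : dAng (C (1 / (2 * π ^ 2)) * Dn 0 * Dn 1 * (Th ^ 2 - C (π ^ 2 / 3))) =
      C (1 / π ^ 2) * Dn 0 * Dn 1 * Th := by
    have : (C (1 / π ^ 2) : SymPoly) = C (1 / (2 * π ^ 2)) * 2 := by
      rw [show (2 : SymPoly) = C 2 from rfl, ← C_mul]
      congr 1
      field_simp
    rw [this]
    simp only [Derivation.leibniz, Derivation.leibniz_pow, map_sub, dAng_C, dAng_Dn, dAng_Th,
      smul_eq_mul, nsmul_eq_mul]
    push_cast
    ring
  set s1 : SymPoly := C (1 / (2 * π ^ 2)) * Dn 0 * Dn 1 * (Th ^ 2 - C (π ^ 2 / 3)) with hs1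
  set κ : ℕ → SymPoly := fun i => if i = 0 then C (π ^ 2 / 2) * A ^ 2 * Di ^ 2 else 0 with hκ
  have hev : ∀ ε J τ θ, ev d ε J τ θ s1 =
      1 / (2 * π ^ 2) * d τ * iteratedDeriv 1 d τ * (θ ^ 2 - π ^ 2 / 3) := fun ε J τ θ => by
    simp [hs1]
  refine ⟨fun _ => s1, κ, ⟨fun i _ _ => ?_, fun i _ _ ε J τ _ => ?_, fun i _ _ J τ _ => ?_,
    fun i _ => ?_, fun i _ => ?_, rfl, fun r h1 h2 => ?_, fun r h1 h2 ε J τ _ => ?_⟩⟩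
  · simp [hs1, setE, Dn, Th]
  · simp [hev]
  · simp only [hev]
    rw [intervalIntegral.integral_const_mul, intervalIntegral.integral_sub (by simp) (by simp)]
    simp
    right
    ring
  · rcases eq_or_ne i 0 with rfl | h
    · simp [hκ, setE, A, Di]
    · simp [hκ, h]
  · rcases eq_or_ne i 0 with rfl | h
    · simp [hκ, Derivation.leibniz, Derivation.leibniz_pow]
    · simp [hκ, h]
  · obtain rfl | rfl : r = 1 ∨ r = 2 := by omega
    · refine ⟨-(A * Dn 1 * Di * Th), fun ε J τ θ _ => ?_⟩
      simp [remP, hamP, actP, genP, kamP, hκ]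
      ring
    · refine ⟨dSlow s1 - C (1 / (2 * π ^ 2)) * Dn 1 ^ 2 * Th ^ 2, fun ε J τ θ _ => ?_⟩
      have h6 := (hpos τ).ne'
      have h7 := pi_pos.ne'
      simp [remP, hamP, actP, genP, kamP, hκ, hdAng]
      field_simp
      ring
  · obtain rfl : r = 2 := by omega
    simp [actP, genP, hdAng, jumpP]
    ring

/-- One step of the procedure: the mean value of the remainder is added to the new Hamiltonian,
and its oscillating part is removed by the next term of the generating function. -/
theorem IsProcedure.exists_succ {d : ℝ → ℝ} (hd : ContDiff ℝ ∞ d) (hpos : ∀ τ, 0 < d τ) {R : ℕ}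
    (hR : 2 ≤ R) {s κ : ℕ → SymPoly} (h : IsProcedure d R s κ) :
    ∃ s κ, IsProcedure d (R + 1) s κ := by
  obtain ⟨ρ, hρ⟩ := h.rem R (by omega) le_rfl
  obtain ⟨ρ₁, hρ₁⟩ := exists_eq_setE_add ρ
  obtain ⟨q, hq, hqE⟩ := exists_dAng_eq_of_setE (setE_setE ρ)
  -- the homological equation `π ^ 2 J / d ^ 2 * ∂S/∂θ = mean - ρ` is divided by its coefficient
  obtain ⟨B, hB⟩ : ∃ p : SymPoly, p = -(C (1 / π ^ 2) * Dn 0 ^ 2 * Ai) := ⟨_, rfl⟩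
  have hBE : setE B = B := by simp [hB, setE, Dn, Ai]
  have hBang : dAng B = 0 := by simp [hB, Derivation.leibniz, Derivation.leibniz_pow]
  obtain ⟨S₀, hS₀⟩ : ∃ p : SymPoly, p = B * (q - meanP q * Th) := ⟨_, rfl⟩
  have hThE : setE Th = Th := by simp [setE, Th]
  have hS₀E : setE S₀ = S₀ := by
    simp only [hS₀, map_mul, map_sub, hBE, hqE, setE_meanP hqE, hThE]
  obtain ⟨q₂, hq₂, hq₂E⟩ := exists_dAng_eq_of_setE hS₀E
  -- the antiderivative of zero mean
  obtain ⟨sR, hsR⟩ : ∃ p : SymPoly, p = S₀ - meanP q₂ := ⟨_, rfl⟩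
  have hsRang : dAng sR = B * (setE ρ - meanP q) := by
    simp [hsR, hS₀, dAng_meanP, Derivation.leibniz, hBang, hq]
  obtain ⟨s', hs'⟩ : ∃ p : ℕ → SymPoly,
      p = fun i => if i = R then sR else s i := ⟨_, rfl⟩
  obtain ⟨κ', hκ'⟩ : ∃ p : ℕ → SymPoly,
      p = fun i => if i = R then meanP q else κ i := ⟨_, rfl⟩
  have es : ∀ i < R, s' i = s i := fun i hi => by simp [hs', hi.ne]
  have eκ : ∀ i < R, κ' i = κ i := fun i hi => by simp [hκ', hi.ne]
  have esR : s' R = sR := by simp [hs']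
  have eκR : κ' R = meanP q := by simp [hκ']
  have egen : ∀ r ≤ R, genP s' r = genP s r := fun r hr =>
    genP_congr fun i hi => es i (by omega)
  have eact : ∀ r ≤ R, actP s' r = actP s r := fun r hr => by rw [actP, actP, egen r hr]
  have ekam : ∀ r ≤ R, kamP κ' r = kamP κ r := fun r hr =>
    kamP_congr fun i hi => eκ i (by omega)
  have egenR : genP s' (R + 1) = genP s R + E ^ (R - 1) * sR := by
    rw [genP_succ _ (by omega), egen R le_rfl, esR]
  have hEpow : E * E ^ (R - 1) = E ^ R := by
    rw [← pow_succ', Nat.sub_add_cancel (by omega)]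
  have eactR : actP s' (R + 1) = actP s R + E ^ R * dAng sR := by
    simp only [actP, egenR, map_add, Derivation.leibniz, Derivation.leibniz_pow, dAng_E,
      smul_eq_mul, ← hEpow]
    ring
  have ekamR : kamP κ' (R + 1) = kamP κ R + E ^ R * meanP q := by
    rw [kamP, Finset.sum_range_succ, ← kamP, ekam R le_rfl, eκR]
  have hmeanang : ∀ q ε J τ θ θ', ev d ε J τ θ (meanP q) = ev d ε J τ θ' (meanP q) :=
    fun q ε J τ θ θ' => by simp only [meanP, map_mul, ev_C, map_sub, ev_setTh]
  have hBev : ∀ ε J τ θ, ev d ε J τ θ B = -(1 / π ^ 2 * d τ ^ 2 * J⁻¹) := fun ε J τ θ => by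
    simp [hB]
  refine ⟨s', κ', ⟨fun i h1 h2 => ?_, fun i h1 h2 ε J τ hJ => ?_, fun i h1 h2 J τ hJ => ?_,
    fun i h2 => ?_, fun i h2 => ?_, ?_, fun r h1 h2 => ?_, fun r h1 h2 ε J τ hJ => ?_⟩⟩
  · rcases Nat.lt_succ_iff_lt_or_eq.1 h2 with h3 | rfl
    · rw [es i h3, h.setE_s i h1 h3]
    · rw [esR, hsR, map_sub, hS₀E, setE_meanP hq₂E]
  · rcases Nat.lt_succ_iff_lt_or_eq.1 h2 with h3 | rfl
    · rw [es i h3, h.periodic_s i h1 h3 ε J τ hJ]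
    · have h4 := ev_meanP d ε J τ π q
      have h5 := hmeanang q ε J τ π (-π)
      rw [esR, hsR, hS₀]
      simp only [map_sub, map_mul, hBev, ev_Th, hmeanang q₂ ε J τ π (-π), ← h5]
      linear_combination (1 / π ^ 2 * d τ ^ 2 * J⁻¹) * h4
  · rcases Nat.lt_succ_iff_lt_or_eq.1 h2 with h3 | rfl
    · rw [es i h3, h.mean_s i h1 h3 J τ hJ]
    · rw [esR, hsR, ← hq₂]
      exact integral_ev_sub_meanP hd hpos hJ τ q₂
  · rcases Nat.lt_succ_iff_lt_or_eq.1 h2 with h3 | rfl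
    · rw [eκ i h3, h.setE_κ i h3]
    · rw [eκR, setE_meanP hqE]
  · rcases Nat.lt_succ_iff_lt_or_eq.1 h2 with h3 | rfl
    · rw [eκ i h3, h.dAng_κ i h3]
    · rw [eκR, dAng_meanP]
  · rw [eκ 0 (by omega), h.zero_κ]
  · obtain h3 | rfl : r ≤ R ∨ r = R + 1 := by omega
    · obtain ⟨ρ', hρ'⟩ := h.rem r h1 h3
      exact ⟨ρ', by simpa only [remP, eact r h3, egen r h3, ekam r h3] using hρ'⟩
    · refine ⟨ρ₁ + dAng sR * (C (π ^ 2 / 2) * Di ^ 2 *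
        (2 * dAng (genP s R) + E ^ (R - 1) * dAng sR) - Dn 1 * Di * Th) + dSlow sR,
        fun ε J τ θ hJ => ?_⟩
      have e1 : remP s' κ' (R + 1) = remP s κ R + E ^ R * (dAng sR * (C (π ^ 2 / 2) * Di ^ 2 *
          (2 * actP s R + E ^ R * dAng sR) - E * Dn 1 * Di * Th) + E * dSlow sR - meanP q) := by
        simp only [remP, hamP, eactR, egenR, ekamR, map_add, Derivation.leibniz,
          Derivation.leibniz_pow, dSlow_E, smul_eq_mul]
        rw [← hEpow]
        ring
      have e2 := hρ ε J τ θ hJ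
      have e3 := congrArg (ev d ε J τ θ) hρ₁
      have e4 := congrArg (ev d ε J τ θ) hsRang
      have e5 := congrArg (ev d ε J τ θ) hEpow
      rw [e1]
      simp only [map_add, map_mul, map_sub, map_pow, ev_E, hBev, ev_C, actP, ev_A, map_ofNat,
        ev_Di, ev_Dn, ev_Th] at e2 e3 e4 e5 ⊢
      rw [e2, e3, pow_succ ε R]
      have e6 : ev d ε J τ θ (setE ρ) - ev d ε J τ θ (meanP q)
          = -(π ^ 2 * J * ((d τ)⁻¹) ^ 2 * ev d ε J τ θ (dAng sR)) := by
        rw [e4]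
        have h6 := (hpos τ).ne'
        have h7 := pi_pos.ne'
        field_simp
      rw [← e5]
      linear_combination (ε * ε ^ (R - 1)) * e6
  · obtain h3 | rfl : r ≤ R ∨ r = R + 1 := by omega
    · rw [eact r h3]
      exact h.periodic_actP r h1 h3 ε J τ hJ
    · have e1 := h.periodic_actP R hR le_rfl ε J τ hJ
      have e2 : ev d 0 J τ π ρ = ev d 0 J τ (-π) ρ := by
        -- the remainder determines `ρ` for `ε ≠ 0` only
        have hcl : Dense {ε : ℝ | ε ≠ 0} := dense_compl_singleton 0
        refine congrFun (Continuous.ext_on hcl (continuous_ev_eps d J τ π ρ)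
          (continuous_ev_eps d J τ (-π) ρ) fun ε hε => ?_) 0
        have e3 := periodic_remP hd hpos h hR le_rfl ε τ hJ
        rw [hρ ε J τ π hJ, hρ ε J τ (-π) hJ] at e3
        simpa [show ε ≠ 0 from hε] using e3
      rw [eactR]
      simp only [map_sub, map_add, map_mul, map_pow, ev_E, hsRang, hBev, ev_setE, e2,
        hmeanang q ε J τ π (-π)] at e1 ⊢
      linear_combination e1

theorem exists_isProcedure {d : ℝ → ℝ} (hd : ContDiff ℝ ∞ d) (hpos : ∀ τ, 0 < d τ) {R : ℕ}
    (hR : 2 ≤ R) : ∃ s κ, IsProcedure d R s κ := by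
  induction R, hR using Nat.le_induction with
  | base => exact exists_isProcedure_two hpos
  | succ R hR ih =>
    obtain ⟨s, κ, h⟩ := ih
    exact h.exists_succ hd hpos hR

end SymPoly
end FermiUlam

namespace FermiUlam
open SymPoly

/-! ### The procedure realizes the change of variables -/

/-- The terms of the generating function obtained from the polynomials `s i`. -/
noncomputable def procS (d : ℝ → ℝ) (s : ℕ → SymPoly) (i : ℕ) (J φ τ : ℝ) : ℝ :=
  ev d 0 J τ (sawtooth φ) (s i)

/-- The terms of the new Hamiltonian obtained from the polynomials `κ i`. -/
noncomputable def procK (d : ℝ → ℝ) (κ : ℕ → SymPoly) (i : ℕ) (J τ : ℝ) : ℝ :=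
  ev d 0 J τ 0 (κ i)

theorem ev_eq_of_setE {p : SymPoly} (h : setE p = p) (d : ℝ → ℝ) (ε J τ θ : ℝ) :
    ev d ε J τ θ p = ev d 0 J τ θ p := by
  rw [← ev_setE d ε, h]

section realize
variable {d : ℝ → ℝ} {R : ℕ} {s κ : ℕ → SymPoly} {r : ℕ} {J : ℝ}

theorem genS_procS (h : IsProcedure d R s κ) (hr : r ≤ R) (ε J φ τ : ℝ) :
    genS (procS d s) r ε J φ τ = ev d ε J τ (sawtooth φ) (genP s r) := by
  simp only [genS, procS, genP, map_sum, map_mul, map_pow, ev_E]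
  refine Finset.sum_congr rfl fun i hi => ?_
  rw [Finset.mem_Icc] at hi
  rw [ev_eq_of_setE (h.setE_s i hi.1 (by omega)) d ε]

theorem sumH_procK (hd : ContDiff ℝ ∞ d) (hpos : ∀ τ, 0 < d τ) (h : IsProcedure d R s κ)
    (hr : r ≤ R) (hJ : 0 < J) (ε τ θ : ℝ) :
    sumH (procK d κ) r ε J τ = ev d ε J τ θ (kamP κ r) := by
  simp only [sumH, procK, kamP, map_sum, map_mul, map_pow, ev_E]
  refine Finset.sum_congr rfl fun i hi => ?_
  rw [Finset.mem_range] at hi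
  rw [ev_eq_of_setE (h.setE_κ i (by omega)) d ε,
    ev_eq_of_dAng_eq_zero hd hpos (h.dAng_κ i (by omega)) 0 hJ τ 0 θ]

theorem hasDerivAt_ev_comp_sawtooth (hd : ContDiff ℝ ∞ d) (hpos : ∀ τ, 0 < d τ) (ε : ℝ)
    (hJ : 0 < J) (τ : ℝ) {φ : ℝ} (hφ : ¬ IsOddPi φ) (p : SymPoly) :
    HasDerivAt (fun x => ev d ε J τ (sawtooth x) p) (ev d ε J τ (sawtooth φ) (dAng p)) φ :=
  ((hasDerivAt_ev_ang hd hpos ε hJ.ne' τ (sawtooth φ) p).comp φ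
    (hasDerivAt_sawtooth hφ)).congr_deriv (mul_one _)

theorem oldAction_procS (hd : ContDiff ℝ ∞ d) (hpos : ∀ τ, 0 < d τ) (h : IsProcedure d R s κ)
    (hr : r ≤ R) (hJ : 0 < J) (ε τ : ℝ) {φ : ℝ} (hφ : ¬ IsOddPi φ) :
    oldAction (procS d s) r ε J φ τ = ev d ε J τ (sawtooth φ) (actP s r) := by
  simp only [oldAction, genS_procS h hr,
    (hasDerivAt_ev_comp_sawtooth hd hpos ε hJ τ hφ _).deriv, actP, map_add, map_mul, ev_A, ev_E]

theorem newAngle_procS (hd : ContDiff ℝ ∞ d) (hpos : ∀ τ, 0 < d τ) (h : IsProcedure d R s κ)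
    (hr : r ≤ R) (hJ : 0 < J) (ε φ τ : ℝ) :
    newAngle (procS d s) r ε J φ τ = φ + ε * ev d ε J τ (sawtooth φ) (dAct (genP s r)) := by
  simp only [newAngle, genS_procS h hr, (hasDerivAt_ev_act hd hpos ε hJ.ne' τ _ _).deriv]

theorem deriv_sumH_procK (hd : ContDiff ℝ ∞ d) (hpos : ∀ τ, 0 < d τ) (h : IsProcedure d R s κ)
    (hr : r ≤ R) (hJ : 0 < J) (ε τ θ : ℝ) :
    deriv (fun j => sumH (procK d κ) r ε j τ) J = ev d ε J τ θ (dAct (kamP κ r)) := by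
  rw [← (hasDerivAt_ev_act hd hpos ε hJ.ne' τ θ (kamP κ r)).deriv]
  refine EventuallyEq.deriv_eq ?_
  filter_upwards [lt_mem_nhds hJ] with j hj using sumH_procK hd hpos h hr hj ε τ θ

theorem isAdiabaticChange_proc (hd : ContDiff ℝ ∞ d) (hpos : ∀ τ, 0 < d τ)
    (h : IsProcedure d R s κ) (h1 : 1 ≤ r) (hr : r ≤ R) :
    IsAdiabaticChange d r (procS d s) (procK d κ) where
  smooth_S i _ φ := contDiffOn_ev hd hpos 0 (sawtooth φ) (s i)
  continuous_S i hi J hJ τ := by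
    rw [Finset.mem_Icc] at hi
    have h3 := continuous_comp_sawtooth (g := fun q => ev d 0 J τ q.2 (s i))
      ((continuous_ev hd hpos 0 J (s i)).comp
        (by fun_prop : Continuous fun q : ℝ × ℝ => (τ, q.2)))
      (fun _ => h.periodic_s i hi.1 (by omega) 0 J τ hJ)
    exact h3.comp (Continuous.prodMk_right (0 : ℝ))
  differentiable_S i _ J hJ τ φ hφ :=
    (hasDerivAt_ev_comp_sawtooth hd hpos 0 hJ τ hφ (s i)).differentiableAt
  periodic_S i _ J _ τ := sawtooth_periodic.comp fun θ => ev d 0 J τ θ (s i)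
  mean_S i hi J hJ τ := by
    rw [Finset.mem_Icc] at hi
    exact (integral_comp_sawtooth fun θ => ev d 0 J τ θ (s i)).trans
      (h.mean_s i hi.1 (by omega) J τ hJ)
  smooth_K i _ := contDiffOn_ev hd hpos 0 0 (κ i)
  zero_K J _ τ := by
    simp only [procK, h.zero_κ, map_mul, map_pow, ev_C, ev_A, ev_Di]
    rw [inv_pow, ← div_eq_mul_inv]
    have := (hpos τ).ne'
    field_simp
  normal_form J hJ τ φ hφ := by
    obtain ⟨ρ, hρ⟩ := h.rem r h1 hr
    have h3 : ∀ ε, newHamiltonian d (procS d s) r ε J φ τ - sumH (procK d κ) r ε J τ =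
        ε ^ r * ev d ε J τ (sawtooth φ) ρ := fun ε => by
      have h4 := hρ ε J τ (sawtooth φ) hJ
      rw [sumH_procK hd hpos h hr hJ ε τ (sawtooth φ)]
      simp only [newHamiltonian, hamiltonian, oldAction_procS hd hpos h hr hJ ε τ hφ,
        genS_procS h hr, (hasDerivAt_ev_slow hd hpos ε hJ.ne' τ _ _).deriv]
      simp only [remP, hamP, map_add, map_sub, map_mul, map_pow, ev_C, ev_E, ev_Di, ev_Dn,
        ev_Th, iteratedDeriv_one] at h4
      rw [← h4]
      have := (hpos τ).ne'
      field_simp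
    simp only [h3]
    have h5 : (fun ε => ev d ε J τ (sawtooth φ) ρ) =O[𝓝[>] 0] fun _ => (1 : ℝ) :=
      ((continuous_ev_eps d J τ (sawtooth φ) ρ).tendsto 0).mono_left nhdsWithin_le_nhds
        |>.isBigO_one ℝ
    simpa using (isBigO_refl (fun ε : ℝ => ε ^ r) _).mul h5

end realize

/-! ### Uniqueness of the procedure -/

/-- A polynomial in `ε` whose coefficients of order less than `n` vanish is divisible
by `ε ^ n`. -/
theorem sum_pow_eq_of_zero {c : ℕ → ℝ} {m n r : ℕ} (hmn : m ≤ n) (hc : ∀ i, m ≤ i → i < n → c i = 0)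
    (ε : ℝ) : ∑ i ∈ Finset.Ico m r, ε ^ i * c i = ε ^ n * ∑ i ∈ Finset.Ico n r, ε ^ (i - n) * c i := by
  rw [Finset.mul_sum, ← Finset.sum_subset (Finset.Ico_subset_Ico_left hmn)]
  · refine Finset.sum_congr rfl fun i hi => ?_
    rw [Finset.mem_Ico] at hi
    rw [← mul_assoc, ← pow_add, Nat.add_sub_cancel' hi.1]
  · intro i hi hi'
    rw [Finset.mem_Ico] at hi hi'
    rw [hc i hi.1 (by omega), mul_zero]

theorem sum_pow_zero {c : ℕ → ℝ} {n r : ℕ} (hn : n < r) :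
    ∑ i ∈ Finset.Ico n r, (0 : ℝ) ^ (i - n) * c i = c n := by
  rw [Finset.sum_eq_single n]
  · simp
  · intro i hi hne
    rw [Finset.mem_Ico] at hi
    rw [zero_pow (by omega), zero_mul]
  · intro h
    simp [hn] at h

/-- The leading coefficient of a function that is small of order `r` vanishes if its order is less
than `r`. -/
theorem eq_zero_of_isBigO_pow {Ψ : ℝ → ℝ} (hΨ : Continuous Ψ) {n r : ℕ} (hn : n < r)
    (h : (fun ε => ε ^ n * Ψ ε) =O[𝓝[>] 0] fun ε => ε ^ r) : Ψ 0 = 0 := by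
  obtain ⟨C, hC⟩ := h.bound
  have h1 : Tendsto Ψ (𝓝[>] 0) (𝓝 (Ψ 0)) := (hΨ.tendsto 0).mono_left nhdsWithin_le_nhds
  refine tendsto_nhds_unique h1 (squeeze_zero_norm' (a := fun ε => C * ε ^ (r - n)) ?_ ?_)
  · filter_upwards [hC, self_mem_nhdsWithin] with ε hε hε'
    have hp : 0 < ε ^ n := pow_pos hε' n
    have hq : ε ^ r = ε ^ n * ε ^ (r - n) := by rw [← pow_add, Nat.add_sub_cancel' hn.le]
    rw [norm_mul, hq, norm_mul, Real.norm_of_nonneg hp.le,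
      Real.norm_of_nonneg (pow_pos (mem_Ioi.1 hε') (r - n)).le] at hε
    exact le_of_mul_le_mul_left (by linarith) hp
  · have : Continuous fun ε : ℝ => C * ε ^ (r - n) := by fun_prop
    have h2 := (this.tendsto 0).mono_left (nhdsWithin_le_nhds (s := Ioi 0))
    simpa [show r - n ≠ 0 by omega] using h2

theorem countable_isOddPi : {φ : ℝ | IsOddPi φ}.Countable := by
  have : {φ : ℝ | IsOddPi φ} = range fun n : ℤ => (2 * n + 1) * π := by
    ext φ
    simp [IsOddPi, eq_comm]
  rw [this]
  exact countable_range _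

/-- A continuous periodic function of zero mean whose derivative is constant away from the odd
multiples of `π` vanishes. -/
theorem eq_zero_of_deriv_const {g : ℝ → ℝ} {c : ℝ} (hg : Continuous g)
    (hper : Function.Periodic g (2 * π)) (hmean : ∫ φ in (0 : ℝ)..2 * π, g φ = 0)
    (hder : ∀ φ, ¬ IsOddPi φ → HasDerivAt g c φ) : c = 0 ∧ ∀ φ, g φ = 0 := by
  have key : ∀ a b, g b - g a = c * (b - a) := fun a b => by
    rw [← MeasureTheory.integral_eq_of_hasDerivAt_off_countable g (fun _ => c) countable_isOddPi
      hg.continuousOn (fun x hx => hder x hx.2) (by simp)]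
    simp [mul_comm]
  have hc : c = 0 := by
    have h1 := key 0 (2 * π)
    have h2 := hper 0
    rw [zero_add] at h2
    rw [h2, sub_self, sub_zero] at h1
    rcases mul_eq_zero.1 h1.symm with h | h
    · exact h
    · linarith [pi_pos]
  refine ⟨hc, fun φ => ?_⟩
  have h3 : ∀ x, g x = g φ := fun x => by
    have := key φ x
    rw [hc, zero_mul] at this
    linarith
  simp only [h3, intervalIntegral.integral_const, smul_eq_mul, sub_zero] at hmean
  rcases mul_eq_zero.1 hmean with h | h
  · linarith [pi_pos]
  · exact h

section uniqueness
variable {d : ℝ → ℝ} {r : ℕ} {S S' : ℕ → ℝ → ℝ → ℝ → ℝ} {K K' : ℕ → ℝ → ℝ → ℝ}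

theorem IsAdiabaticChange.mul_deriv_genS (h : IsAdiabaticChange d r S K) {J : ℝ}
    (hJ : 0 < J) (τ : ℝ) {φ : ℝ} (hφ : ¬ IsOddPi φ) (ε : ℝ) :
    ε * deriv (fun p => genS S r ε J p τ) φ =
      ∑ i ∈ Finset.Ico 1 r, ε ^ i * deriv (fun p => S i J p τ) φ := by
  have hI : Finset.Icc 1 (r - 1) = Finset.Ico 1 r := by
    ext i
    simp only [Finset.mem_Icc, Finset.mem_Ico]
    omega
  simp only [genS]
  rw [deriv_fun_sum fun i hi => (h.differentiable_S i hi J hJ τ φ hφ).const_mul _,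
    Finset.mul_sum, hI]
  refine Finset.sum_congr rfl fun i hi => ?_
  rw [← hI] at hi
  rw [deriv_const_mul _ (h.differentiable_S i hi J hJ τ φ hφ), ← mul_assoc, ← pow_succ',
    Nat.sub_add_cancel (Finset.mem_Icc.1 hi).1]

theorem IsAdiabaticChange.differentiableAt_slow (h : IsAdiabaticChange d r S K) {J : ℝ}
    (hJ : 0 < J) (τ φ : ℝ) {i : ℕ} (hi : i ∈ Finset.Icc 1 (r - 1)) :
    DifferentiableAt ℝ (fun s => S i J φ s) τ := by
  have h1 := (h.smooth_S i hi φ).contDiffAt (x := (J, τ))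
    (prod_mem_nhds (Ioi_mem_nhds hJ) univ_mem)
  exact (h1.differentiableAt (by simp)).comp τ
    (f := fun s => (J, s)) (by fun_prop : DifferentiableAt ℝ (fun s : ℝ => (J, s)) τ)

theorem IsAdiabaticChange.mul_deriv_genS_slow (h : IsAdiabaticChange d r S K) {J : ℝ}
    (hJ : 0 < J) (τ φ ε : ℝ) :
    ε * deriv (fun s => genS S r ε J φ s) τ =
      ∑ i ∈ Finset.Ico 1 r, ε ^ i * deriv (fun s => S i J φ s) τ := by
  have hI : Finset.Icc 1 (r - 1) = Finset.Ico 1 r := by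
    ext i
    simp only [Finset.mem_Icc, Finset.mem_Ico]
    omega
  simp only [genS]
  rw [deriv_fun_sum fun i hi => (h.differentiableAt_slow hJ τ φ hi).const_mul _,
    Finset.mul_sum, hI]
  refine Finset.sum_congr rfl fun i hi => ?_
  rw [← hI] at hi
  rw [deriv_const_mul _ (h.differentiableAt_slow hJ τ φ hi), ← mul_assoc, ← pow_succ',
    Nat.sub_add_cancel (Finset.mem_Icc.1 hi).1]

/-- Comparison of the coefficients of order `n` in two normal forms that agree in all lower
orders. -/
theorem IsAdiabaticChange.coeff_eq (hpos : ∀ τ, 0 < d τ) (h : IsAdiabaticChange d r S K)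
    (h' : IsAdiabaticChange d r S' K') {n : ℕ} (h1 : 1 ≤ n) (hn : n < r)
    (hS : ∀ i, 1 ≤ i → i < n → ∀ J > 0, ∀ φ τ, S i J φ τ = S' i J φ τ)
    (hK : ∀ i < n, ∀ J > 0, ∀ τ, K i J τ = K' i J τ) {J : ℝ} (hJ : 0 < J) (τ : ℝ) {φ : ℝ}
    (hφ : ¬ IsOddPi φ) :
    deriv (fun p => S n J p τ) φ - deriv (fun p => S' n J p τ) φ =
      (K n J τ - K' n J τ) * (d τ ^ 2 / (π ^ 2 * J)) := by
  set D : ℕ → ℝ := fun i => deriv (fun p => S i J p τ) φ - deriv (fun p => S' i J p τ) φ with hD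
  set T : ℕ → ℝ := fun i => deriv (fun s => S i J φ s) τ - deriv (fun s => S' i J φ s) τ with hT
  set k : ℕ → ℝ := fun i => K i J τ - K' i J τ with hk
  have hD0 : ∀ i, 1 ≤ i → i < n → D i = 0 := fun i hi hi' => by
    simp only [hD, hS i hi hi' J hJ, sub_self]
  have hT0 : ∀ i, 1 ≤ i → i < n → T i = 0 := fun i hi hi' => by
    simp only [hT, hS i hi hi' J hJ, sub_self]
  have hk0 : ∀ i, 0 ≤ i → i < n → k i = 0 := fun i _ hi' => by
    simp only [hk, hK i hi' J hJ, sub_self]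
  set δ : (ℕ → ℝ) → ℝ → ℝ := fun c ε => ∑ i ∈ Finset.Ico n r, ε ^ (i - n) * c i with hδ
  set I : (ℕ → ℝ → ℝ → ℝ → ℝ) → ℝ → ℝ := fun S ε =>
    J + ∑ i ∈ Finset.Ico 1 r, ε ^ i * deriv (fun p => S i J p τ) φ with hI
  have hII : ∀ ε, I S ε - I S' ε = ε ^ n * δ D ε := fun ε => by
    have := sum_pow_eq_of_zero (r := r) h1 hD0 ε
    refine Eq.trans ?_ this
    simp only [hI, hD, mul_sub, Finset.sum_sub_distrib]
    ring
  -- the difference of the two normal forms is `ε ^ n * Ψ`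
  set Ψ : ℝ → ℝ := fun ε => δ D ε * (π ^ 2 * (I S ε + I S' ε) / (2 * d τ ^ 2) -
    ε * deriv d τ / d τ * sawtooth φ) + ε * δ T ε - δ k ε with hΨ
  have hΨc : Continuous Ψ := by fun_prop
  have hdiff : ∀ ε, (newHamiltonian d S r ε J φ τ - sumH K r ε J τ) -
      (newHamiltonian d S' r ε J φ τ - sumH K' r ε J τ) = ε ^ n * Ψ ε := fun ε => by
    have e1 : sumH K r ε J τ - sumH K' r ε J τ = ε ^ n * δ k ε := by
      have := sum_pow_eq_of_zero (r := r) (Nat.zero_le n) hk0 ε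
      refine Eq.trans ?_ this
      simp only [sumH, hk, mul_sub, Finset.sum_sub_distrib, Finset.range_eq_Ico]
    have e2 : ε ^ 2 * deriv (fun s => genS S r ε J φ s) τ -
        ε ^ 2 * deriv (fun s => genS S' r ε J φ s) τ = ε * (ε ^ n * δ T ε) := by
      have := sum_pow_eq_of_zero (r := r) h1 hT0 ε
      rw [sq, mul_assoc, mul_assoc, h.mul_deriv_genS_slow hJ, h'.mul_deriv_genS_slow hJ,
        ← mul_sub]
      refine congrArg (ε * ·) (Eq.trans ?_ this)
      simp only [hT, mul_sub, Finset.sum_sub_distrib]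
    have e3 := hII ε
    simp only [newHamiltonian, hamiltonian, oldAction, h.mul_deriv_genS hJ τ hφ,
      h'.mul_deriv_genS hJ τ hφ, hΨ]
    change π ^ 2 * (I S ε) ^ 2 / (2 * d τ ^ 2) - I S ε * (ε * deriv d τ) / d τ * sawtooth φ + _ - _
      - (π ^ 2 * (I S' ε) ^ 2 / (2 * d τ ^ 2) - I S' ε * (ε * deriv d τ) / d τ * sawtooth φ +
        _ - _) = _
    linear_combination (π ^ 2 * (I S ε + I S' ε) / (2 * d τ ^ 2) -
      ε * deriv d τ / d τ * sawtooth φ) * e3 + e2 - e1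
  have hO : (fun ε => ε ^ n * Ψ ε) =O[𝓝[>] 0] fun ε => ε ^ r :=
    ((h.normal_form J hJ τ φ hφ).sub (h'.normal_form J hJ τ φ hφ)).congr_left hdiff
  have h0 := eq_zero_of_isBigO_pow hΨc hn hO
  have hI0 : ∀ S, I S 0 = J := fun S => by
    have : ∑ i ∈ Finset.Ico 1 r, (0 : ℝ) ^ i * deriv (fun p => S i J p τ) φ = 0 :=
      Finset.sum_eq_zero fun i hi => by
        rw [zero_pow (by have := (Finset.mem_Ico.1 hi).1; omega), zero_mul]
    simp [hI, this]
  simp only [hΨ, hδ, sum_pow_zero hn, hI0] at h0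
  change D n = k n * _
  have := (hpos τ).ne'
  have := pi_pos.ne'
  have := hJ.ne'
  field_simp
  field_simp at h0
  linarith

/-- The perturbation procedure determines the generating function and the new Hamiltonian. -/
theorem IsAdiabaticChange.unique (hpos : ∀ τ, 0 < d τ) (h : IsAdiabaticChange d r S K)
    (h' : IsAdiabaticChange d r S' K') (n : ℕ) (hn : n < r) :
    (1 ≤ n → ∀ J > 0, ∀ φ τ, S n J φ τ = S' n J φ τ) ∧
      ∀ J > 0, ∀ τ, K n J τ = K' n J τ := by
  induction n using Nat.strong_induction_on with
  | _ n ih =>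
    rcases Nat.eq_zero_or_pos n with rfl | h1
    · exact ⟨by simp, fun J hJ τ => by rw [h.zero_K J hJ, h'.zero_K J hJ]⟩
    have key : ∀ J > 0, ∀ τ, (K n J τ - K' n J τ) * (d τ ^ 2 / (π ^ 2 * J)) = 0 ∧
        ∀ φ, S n J φ τ - S' n J φ τ = 0 := fun J hJ τ => by
      have hi : n ∈ Finset.Icc 1 (r - 1) := Finset.mem_Icc.2 ⟨h1, by omega⟩
      have c1 := h.continuous_S n hi J hJ τ
      have c2 := h'.continuous_S n hi J hJ τ
      refine eq_zero_of_deriv_const (g := fun φ => S n J φ τ - S' n J φ τ) (by fun_prop)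
        (fun φ => ?_) ?_ fun φ hφ => ?_
      · exact congrArg₂ (· - ·) (h.periodic_S n hi J hJ τ φ) (h'.periodic_S n hi J hJ τ φ)
      · rw [intervalIntegral.integral_sub (c1.intervalIntegrable _ _) (c2.intervalIntegrable _ _),
          h.mean_S n hi J hJ τ, h'.mean_S n hi J hJ τ, sub_zero]
      · rw [← h.coeff_eq hpos h' h1 hn (fun i a b => (ih i b (by omega)).1 a)
          (fun i b => (ih i b (by omega)).2) hJ τ hφ]
        exact (h.differentiable_S n hi J hJ τ φ hφ).hasDerivAt.fun_sub
          (h'.differentiable_S n hi J hJ τ φ hφ).hasDerivAt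
    refine ⟨fun _ J hJ φ τ => sub_eq_zero.1 ((key J hJ τ).2 φ), fun J hJ τ => ?_⟩
    have h2 : d τ ^ 2 / (π ^ 2 * J) ≠ 0 := by
      have := hpos τ
      have := pi_pos
      positivity
    exact sub_eq_zero.1 ((mul_eq_zero.1 (key J hJ τ).1).resolve_right h2)

theorem genS_congr (hS : ∀ n < r, 1 ≤ n → ∀ J > 0, ∀ φ τ, S n J φ τ = S' n J φ τ) {J : ℝ}
    (hJ : 0 < J) (ε φ τ : ℝ) : genS S r ε J φ τ = genS S' r ε J φ τ :=
  Finset.sum_congr rfl fun i hi => by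
    rw [Finset.mem_Icc] at hi
    rw [hS i (by omega) hi.1 J hJ]

theorem oldAction_congr (hS : ∀ n < r, 1 ≤ n → ∀ J > 0, ∀ φ τ, S n J φ τ = S' n J φ τ) {J : ℝ}
    (hJ : 0 < J) (ε φ τ : ℝ) : oldAction S r ε J φ τ = oldAction S' r ε J φ τ := by
  simp only [oldAction, genS_congr hS hJ]

theorem newAngle_congr (hS : ∀ n < r, 1 ≤ n → ∀ J > 0, ∀ φ τ, S n J φ τ = S' n J φ τ) {J : ℝ}
    (hJ : 0 < J) (ε φ τ : ℝ) : newAngle S r ε J φ τ = newAngle S' r ε J φ τ := by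
  have : (fun j => genS S r ε j φ τ) =ᶠ[𝓝 J] fun j => genS S' r ε j φ τ := by
    filter_upwards [lt_mem_nhds hJ] with j hj using genS_congr hS hj ε φ τ
  simp only [newAngle, this.deriv_eq]

theorem deriv_sumH_congr (hK : ∀ n < r, ∀ J > 0, ∀ τ, K n J τ = K' n J τ) {J : ℝ}
    (hJ : 0 < J) (ε τ : ℝ) :
    deriv (fun j => sumH K r ε j τ) J = deriv (fun j => sumH K' r ε j τ) J := by
  refine EventuallyEq.deriv_eq ?_
  filter_upwards [lt_mem_nhds hJ] with j hj
  exact Finset.sum_congr rfl fun i hi => by rw [hK i (Finset.mem_range.1 hi) j hj]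

end uniqueness

end FermiUlam

namespace FermiUlam
open SymPoly

/-! ### Adiabatic invariance for the lifted motion -/

/-- The motion in terms of the continuous phase `φ` and of the regularized action `P`, which is the
action without its part `ε d d' θ / π ^ 2` that jumps at impacts. Both functions are continuous and
have a derivative from the right everywhere. -/
structure IsLift (d : ℝ → ℝ) (ε T : ℝ) (φ P : ℝ → ℝ) : Prop where
  continuousOn_φ : ContinuousOn φ (Icc 0 T)
  continuousOn_P : ContinuousOn P (Icc 0 T)
  pos : ∀ t ∈ Icc 0 T, 0 < P t
  deriv_φ : ∀ t ∈ Ico 0 T, HasDerivWithinAt φ (π ^ 2 * P t / d (ε * t) ^ 2) (Ici t) t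
  deriv_P : ∀ t ∈ Ico 0 T, HasDerivWithinAt P
    (-(ε ^ 2 * d (ε * t) * iteratedDeriv 2 d (ε * t) / π ^ 2 * sawtooth (φ t))) (Ici t) t

/-- The action of a lifted motion, continuous from the right at impacts. -/
noncomputable def liftAction (d : ℝ → ℝ) (ε : ℝ) (φ P : ℝ → ℝ) (t : ℝ) : ℝ :=
  P t + ε * d (ε * t) * deriv d (ε * t) / π ^ 2 * sawtooth (φ t)

/-- A solution of a differential inequality of Riccati type that starts at `0` grows at most
linearly as long as the quadratic term is dominated. -/
theorem abs_le_mul_of_abs_deriv_right_le {u u' : ℝ → ℝ} {T η M N K : ℝ} (hη : 0 ≤ η) (hM : 0 ≤ M)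
    (hN : 0 ≤ N) (hK : 0 ≤ K) (hu : ContinuousOn u (Icc 0 T))
    (hu' : ∀ t ∈ Ico 0 T, HasDerivWithinAt u (u' t) (Ici t) t) (h0 : u 0 = 0)
    (hb : ∀ t ∈ Ico 0 T, |u' t| ≤ M * η * (1 + |u t|) + N * |u t| ^ 2)
    (hq : M * η * (1 + K * η * T) + N * (K * η * T) ^ 2 < K * η) :
    ∀ t ∈ Icc 0 T, |u t| ≤ K * η * t := by
  intro t ht
  refine image_norm_le_of_norm_deriv_right_lt_deriv_boundary (B := fun t => K * η * t)
    (B' := fun _ => K * η) hu hu' (by simp [h0])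
    (fun x => by simpa using (hasDerivAt_id x).const_mul (K * η)) (fun x hx he => ?_) ht
  rw [Real.norm_eq_abs] at he ⊢
  have h1 : |u x| ≤ K * η * T := by
    rw [he]
    exact mul_le_mul_of_nonneg_left hx.2.le (by positivity)
  have h2 : |u x| ^ 2 ≤ (K * η * T) ^ 2 := pow_le_pow_left₀ (abs_nonneg _) h1 2
  calc |u' x| ≤ M * η * (1 + |u x|) + N * |u x| ^ 2 := hb x hx
    _ ≤ M * η * (1 + K * η * T) + N * (K * η * T) ^ 2 := by gcongr
    _ < K * η := hq

section lift
variable {d : ℝ → ℝ} {ε T : ℝ} {φ P : ℝ → ℝ}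

/-- The chain rule along a lifted motion. It holds from the right also at impacts, because the phase
increases and the sawtooth is continuous from the right. -/
theorem IsLift.hasDerivWithinAt_ev (hd : ContDiff ℝ ∞ d) (hpos : ∀ τ, 0 < d τ)
    (h : IsLift d ε T φ P) {J : ℝ} (hJ : 0 < J) (p : SymPoly) {t : ℝ} (ht : t ∈ Ico 0 T) :
    HasDerivWithinAt (fun t => ev d ε J (ε * t) (sawtooth (φ t)) p)
      (ε * ev d ε J (ε * t) (sawtooth (φ t)) (dSlow p) +
        π ^ 2 * P t / d (ε * t) ^ 2 * ev d ε J (ε * t) (sawtooth (φ t)) (dAng p)) (Ici t) t := by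
  have h1 : 0 < π ^ 2 * P t / d (ε * t) ^ 2 := by
    have := hpos (ε * t)
    have := h.pos t (Ico_subset_Icc_self ht)
    have := pi_pos
    positivity
  have h2 : HasDerivWithinAt (fun t => ε * t) ε (Ici t) t := by
    simpa using (hasDerivWithinAt_id t (Ici t)).const_mul ε
  refine (SymPoly.hasDerivWithinAt_ev hd hpos ε (hasDerivWithinAt_const t (Ici t) J) h2
    (hasDerivWithinAt_sawtooth_comp (h.deriv_φ t ht) h1) hJ.ne' p).congr_deriv ?_
  ring

/-- A polynomial that takes equal values at `θ = π` and `θ = -π` is continuous at impacts. -/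
theorem IsLift.continuousOn_ev (hd : ContDiff ℝ ∞ d) (hpos : ∀ τ, 0 < d τ)
    (h : IsLift d ε T φ P) {J : ℝ} {p : SymPoly}
    (hp : ∀ τ, ev d ε J τ π p = ev d ε J τ (-π) p) :
    ContinuousOn (fun t => ev d ε J (ε * t) (sawtooth (φ t)) p) (Icc 0 T) := by
  have h1 := continuous_comp_sawtooth (continuous_ev hd hpos ε J p) hp
  have h2 : ContinuousOn (fun t => (ε * t, φ t)) (Icc 0 T) :=
    (continuousOn_const.mul continuousOn_id).prodMk h.continuousOn_φ
  exact h1.comp_continuousOn h2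

/-- The property of taking equal values at `θ = π` and `θ = -π` passes to the derivative with
respect to the action. -/
theorem periodic_dAct (hd : ContDiff ℝ ∞ d) (hpos : ∀ τ, 0 < d τ) {p : SymPoly}
    {J : ℝ} (hJ : 0 < J) {τ : ℝ} (hp : ∀ J > 0, ev d ε J τ π p = ev d ε J τ (-π) p) :
    ev d ε J τ π (dAct p) = ev d ε J τ (-π) (dAct p) := by
  refine (hasDerivAt_ev_act hd hpos ε hJ.ne' τ π p).unique ?_
  refine (hasDerivAt_ev_act hd hpos ε hJ.ne' τ (-π) p).congr_of_eventuallyEq ?_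
  filter_upwards [lt_mem_nhds hJ] with j hj using hp j hj

theorem dAct_jumpP : dAct jumpP = 0 := by
  simp [jumpP, Derivation.leibniz]

theorem ev_jumpP (J τ θ : ℝ) : ev d ε J τ θ jumpP = ε * d τ * deriv d τ / π ^ 2 * θ := by
  simp only [jumpP, map_mul, ev_C, ev_E, ev_Dn, ev_Th, iteratedDeriv_zero, iteratedDeriv_one]
  ring

/-- The evolution of the distance `u` of the motion from a level of the new action: the terms linear
in `u` with a coefficient of order less than `R` cancel, since the level curves of the new action
are nearly invariant and `u` measures the new action. -/
theorem IsLift.exists_hasDerivWithinAt (hd : ContDiff ℝ ∞ d) (hpos : ∀ τ, 0 < d τ)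
    (h : IsLift d ε T φ P) {R : ℕ} {s κ : ℕ → SymPoly} (hs : IsProcedure d R s κ) {ρ : SymPoly}
    (hρ : Equiv d (remP s κ R) (E ^ R * ρ)) {J : ℝ} (hJ : 0 < J) {t : ℝ} (ht : t ∈ Ico 0 T)
    (hne : ev d ε J (ε * t) (sawtooth (φ t)) (dAct (actP s R)) ≠ 0) :
    HasDerivWithinAt (fun t => (P t - ev d ε J (ε * t) (sawtooth (φ t)) (actP s R - jumpP)) /
        ev d ε J (ε * t) (sawtooth (φ t)) (dAct (actP s R)))
      (-(ε ^ R * ev d ε J (ε * t) (sawtooth (φ t)) (dAng ρ)) /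
          ev d ε J (ε * t) (sawtooth (φ t)) (dAct (actP s R))
        - (P t - ev d ε J (ε * t) (sawtooth (φ t)) (actP s R - jumpP)) /
            ev d ε J (ε * t) (sawtooth (φ t)) (dAct (actP s R)) *
          (ε ^ R * ev d ε J (ε * t) (sawtooth (φ t)) (dAct (dAng ρ))) /
            ev d ε J (ε * t) (sawtooth (φ t)) (dAct (actP s R))
        - π ^ 2 / d (ε * t) ^ 2 * ev d ε J (ε * t) (sawtooth (φ t)) (dAct (dAng (actP s R))) *
          ((P t - ev d ε J (ε * t) (sawtooth (φ t)) (actP s R - jumpP)) /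
            ev d ε J (ε * t) (sawtooth (φ t)) (dAct (actP s R))) ^ 2) (Ici t) t := by
  have hF := (h.deriv_P t ht).fun_sub (h.hasDerivWithinAt_ev hd hpos hJ (actP s R - jumpP) ht)
  have hv := h.hasDerivWithinAt_ev hd hpos hJ (dAct (actP s R)) ht
  refine (hF.fun_div hv hne).congr_deriv ?_
  clear hF hv
  generalize ε * t = τ at *
  generalize sawtooth (φ t) = θ at *
  have i1 := (hρ.dAng hd hpos) ε J τ θ hJ
  have i2 := ((hρ.dAng hd hpos).dAct hd hpos) ε J τ θ hJ
  have e1 : dSlow (actP s R) = E * dAng (dSlow (genP s R)) := by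
    simp [actP, Derivation.leibniz, dSlow_dAng]
  have e2 : dSlow (dAct (actP s R)) = E * dAct (dAng (dSlow (genP s R))) := by
    rw [← dAct_dSlow, e1]
    simp [Derivation.leibniz]
  have e3 : dSlow jumpP = MvPolynomial.C (1 / π ^ 2) * E * Th * (Dn 1 ^ 2 + Dn 0 * Dn 2) := by
    simp only [jumpP, Derivation.leibniz, dSlow_C, dSlow_E, dSlow_Dn, dSlow_Th, smul_eq_mul,
      mul_zero, add_zero]
    ring
  have e4 : dAng jumpP = MvPolynomial.C (1 / π ^ 2) * E * Dn 0 * Dn 1 := by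
    simp [jumpP, Derivation.leibniz]
  have i1' : dAng (remP s κ R) = MvPolynomial.C (π ^ 2) * actP s R * dAng (actP s R) * Di ^ 2
      - E * Dn 1 * Di * (dAng (actP s R) * Th + actP s R) + E ^ 2 * dAng (dSlow (genP s R)) := by
    have : (MvPolynomial.C (π ^ 2) : SymPoly) = 2 * MvPolynomial.C (π ^ 2 / 2) := by
      rw [show (2 : SymPoly) = MvPolynomial.C 2 from rfl, ← MvPolynomial.C_mul]
      congr 1
      ring
    rw [remP, map_sub, dAng_kamP hs le_rfl, hamP, this]
    simp only [map_sub, map_add, Derivation.leibniz, Derivation.leibniz_pow, dAng_C, dAng_E,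
      dAng_Di, dAng_Dn, dAng_Th, smul_eq_mul, nsmul_eq_mul, mul_zero, add_zero, zero_add]
    push_cast
    ring
  have i2' : dAct (dAng (remP s κ R)) = MvPolynomial.C (π ^ 2) *
        (dAct (actP s R) * dAng (actP s R) + actP s R * dAct (dAng (actP s R))) * Di ^ 2
      - E * Dn 1 * Di * (dAct (dAng (actP s R)) * Th + dAct (actP s R))
      + E ^ 2 * dAct (dAng (dSlow (genP s R))) := by
    rw [i1']
    simp only [map_sub, map_add, Derivation.leibniz, Derivation.leibniz_pow, dAct_C, dAct_E,
      dAct_Di, dAct_Dn, dAct_Th, smul_eq_mul, nsmul_eq_mul, mul_zero, add_zero, zero_add]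
    ring
  have i3' : dAng (E ^ R * ρ) = E ^ R * dAng ρ := by
    simp [Derivation.leibniz, Derivation.leibniz_pow]
  have i4' : dAct (E ^ R * dAng ρ) = E ^ R * dAct (dAng ρ) := by
    simp [Derivation.leibniz, Derivation.leibniz_pow]
  rw [i3'] at i1
  rw [i3', i4', i2'] at i2
  rw [i1'] at i1
  rw [map_sub dSlow, map_sub dAng, e1, e2, e3, e4, ← dAct_dAng]
  simp only [map_sub, map_mul, map_add, map_pow, ev_C, ev_E, ev_Dn, ev_Di, ev_Th, ev_jumpP,
    iteratedDeriv_zero, iteratedDeriv_one] at i1 i2 ⊢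
  have h6 := (hpos τ).ne'
  have h7 := pi_pos.ne'
  generalize ev d ε J τ θ (dAct (actP s R)) = v at *
  generalize ev d ε J τ θ (actP s R) = g at *
  generalize ev d ε J τ θ (dAng (actP s R)) = gθ at *
  generalize ev d ε J τ θ (dAct (dAng (actP s R))) = gJθ at *
  generalize ev d ε J τ θ (dAng (dSlow (genP s R))) = b at *
  generalize ev d ε J τ θ (dAct (dAng (dSlow (genP s R)))) = bJ at *
  generalize P t = Q at *
  rw [← i1, ← i2]
  field_simp
  ring

end lift
end FermiUlam

namespace FermiUlam
open SymPoly

/-! ### Conservation of the new action -/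

/-- A common bound for finitely many polynomials. -/
theorem exists_bound_ev_list {d : ℝ → ℝ} {c : ℝ} (hc : 0 < c) (hcd : ∀ τ, c ≤ d τ) {U : Set ℝ}
    (hU : ∀ n : ℕ, ∃ M : ℝ, ∀ τ ∈ U, |iteratedDeriv n d τ| ≤ M) {α : ℝ} (hα : 0 < α) (β : ℝ)
    (l : List SymPoly) :
    ∃ M : ℝ, 0 < M ∧ ∀ p ∈ l, ∀ ε ∈ Icc (0 : ℝ) 1, ∀ J ∈ Icc α β, ∀ τ ∈ U, ∀ θ ∈ Icc (-π) π,
      |ev d ε J τ θ p| ≤ M := by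
  induction l with
  | nil => exact ⟨1, one_pos, by simp⟩
  | cons q l ih =>
    obtain ⟨M, hM, h1⟩ := ih
    obtain ⟨N, hN, h2⟩ := exists_bound_ev hc hcd hU hα (β := β) q
    refine ⟨M + N, by positivity, fun p hp ε hε J hJ τ hτ θ hθ => ?_⟩
    rcases List.mem_cons.1 hp with rfl | hp
    · exact (h2 ε hε J hJ τ hτ θ hθ).trans (by linarith)
    · exact (h1 p hp ε hε J hJ τ hτ θ hθ).trans (by linarith)

/-- The identity plus a small Lipschitz function is expanding up to a factor `1 / 2`. -/
theorem abs_sub_le_two_mul {h : ℝ → ℝ} {ε M x y : ℝ} (hε : 0 ≤ ε) (hM : ε * M ≤ 1 / 2)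
    (hl : |h x - h y| ≤ M * |x - y|) : |x - y| ≤ 2 * |x + ε * h x - (y + ε * h y)| := by
  have h1 : |x - y| ≤ |x + ε * h x - (y + ε * h y)| + |ε * (h x - h y)| := by
    have := abs_sub (x + ε * h x - (y + ε * h y)) (ε * (h x - h y))
    rwa [show x + ε * h x - (y + ε * h y) - ε * (h x - h y) = x - y by ring] at this
  have h2 : |ε * (h x - h y)| ≤ 1 / 2 * |x - y| := by
    rw [abs_mul, abs_of_nonneg hε]
    calc ε * |h x - h y| ≤ ε * (M * |x - y|) := by gcongr
      _ = ε * M * |x - y| := by ring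
      _ ≤ _ := by gcongr
  linarith

section lift
variable {d : ℝ → ℝ} {c : ℝ} {U : Set ℝ} {R : ℕ} {s κ : ℕ → SymPoly}

theorem abs_ev_act_sub_le (hd : ContDiff ℝ ∞ d) (hpos : ∀ τ, 0 < d τ) {α β M ε τ θ : ℝ}
    (hα : 0 < α) {p : SymPoly} (hM : ∀ J ∈ Icc α β, |ev d ε J τ θ (dAct p)| ≤ M) {x y : ℝ}
    (hx : x ∈ Icc α β) (hy : y ∈ Icc α β) :
    |ev d ε x τ θ p - ev d ε y τ θ p| ≤ M * |x - y| :=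
  Convex.norm_image_sub_le_of_norm_hasDerivWithin_le
    (fun _ hJ => (hasDerivAt_ev_act hd hpos ε (hα.trans_le hJ.1).ne' τ θ p).hasDerivWithinAt)
    hM (convex_Icc α β) hy hx

theorem liftAction_sub (ε J : ℝ) (φ P : ℝ → ℝ) (t : ℝ) (p : SymPoly) :
    liftAction d ε φ P t - ev d ε J (ε * t) (sawtooth (φ t)) p =
      P t - ev d ε J (ε * t) (sawtooth (φ t)) (p - jumpP) := by
  rw [map_sub, ev_jumpP, liftAction]
  ring

/-- Conservation of the new action of order `R` over times of order `ε ^ (-k)`,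
provided that `R` exceeds `2 * k`. The quotient `F / v`, where `F` is the deviation of the old action
from the level curve `J` and `v` is the derivative of the old action with respect to `J`, obeys a
Riccati inequality with an inhomogeneity of order `ε ^ R`. It grows to `ε ^ (R - k)` at most, and
`2 * k < R` makes its square smaller than the inhomogeneity. -/
theorem exists_bound_liftAction_high (hd : ContDiff ℝ ∞ d) (hc : 0 < c) (hcd : ∀ τ, c ≤ d τ)
    (hU : ∀ n : ℕ, ∃ M : ℝ, ∀ τ ∈ U, |iteratedDeriv n d τ| ≤ M) (hs : IsProcedure d R s κ)
    (hR : 2 ≤ R) {k : ℕ} (hk : 2 * k < R) {α L : ℝ} (hα : 0 < α) (β : ℝ) (hL : 0 < L) :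
    ∃ C > 0, ∃ ε₀ > 0, ∀ ε T : ℝ, 0 < ε → ε < ε₀ → T ≤ L / ε ^ k → (∀ t ∈ Icc 0 T, ε * t ∈ U) →
      ∀ φ P, IsLift d ε T φ P → ∀ J ∈ Icc α β,
      liftAction d ε φ P 0 = ev d ε J 0 (sawtooth (φ 0)) (actP s R) → ∀ t ∈ Icc 0 T,
      |liftAction d ε φ P t - ev d ε J (ε * t) (sawtooth (φ t)) (actP s R)| ≤ C * ε ^ (R - k) := by
  have hpos : ∀ τ, 0 < d τ := fun τ => hc.trans_le (hcd τ)
  obtain ⟨ρ, hρ⟩ := hs.rem R (by omega) le_rfl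
  obtain ⟨M, hM, hMb⟩ := exists_bound_ev_list hc hcd hU hα β
    [dAng ρ, dAct (dAng ρ), dAct (dAng (actP s R)), dAct (dAng (genP s R))]
  set K : ℝ := 2 * M + 1 with hK
  set N : ℝ := π ^ 2 / c ^ 2 * M with hN
  have hpi := pi_pos
  have hNpos : 0 < N := by positivity
  set W : ℝ := 2 * M * K * L + N * K ^ 2 * L ^ 2 with hW
  have hWpos : 0 < W := by positivity
  refine ⟨2 * K * L, by positivity, min 1 (min (1 / (2 * M)) (1 / W)), by positivity,
    fun ε T hε hε' hT hτ φ P h J hJ h0 t ht => ?_⟩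
  obtain ⟨hε1, hε2⟩ := lt_min_iff.1 hε'
  obtain ⟨hεM, hεW⟩ := lt_min_iff.1 hε2
  rw [lt_div_iff₀ (by positivity)] at hεM hεW
  have hεI : ε ∈ Icc (0 : ℝ) 1 := ⟨hε.le, hε1.le⟩
  have hJ0 : 0 < J := hα.trans_le hJ.1
  have hT0 : 0 ≤ T := ht.1.trans ht.2
  have hb : ∀ p ∈ [dAng ρ, dAct (dAng ρ), dAct (dAng (actP s R)), dAct (dAng (genP s R))],
      ∀ t ∈ Icc 0 T, |ev d ε J (ε * t) (sawtooth (φ t)) p| ≤ M := fun p hp t ht =>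
    hMb p hp ε hεI J hJ (ε * t) (hτ t ht) _ (sawtooth_mem_Icc _)
  set v : ℝ → ℝ := fun t => ev d ε J (ε * t) (sawtooth (φ t)) (dAct (actP s R)) with hv
  set F : ℝ → ℝ := fun t => P t - ev d ε J (ε * t) (sawtooth (φ t)) (actP s R - jumpP) with hF
  have hvb : ∀ t ∈ Icc 0 T, |v t - 1| ≤ 1 / 2 := fun t ht => by
    have h1 : v t = 1 + ε * ev d ε J (ε * t) (sawtooth (φ t)) (dAct (dAng (genP s R))) := by
      simp [hv, actP, Derivation.leibniz]
    rw [h1, add_sub_cancel_left, abs_mul, abs_of_pos hε]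
    have := mul_le_mul_of_nonneg_left (hb (dAct (dAng (genP s R))) (by simp) t ht) hε.le
    linarith
  have hv2 : ∀ t ∈ Icc 0 T, 1 / 2 ≤ v t ∧ v t ≤ 2 := fun t ht => by
    have := abs_le.1 (hvb t ht)
    constructor <;> linarith
  have hper : ∀ τ, ∀ J > 0, ev d ε J τ π (actP s R - jumpP) = ev d ε J τ (-π) (actP s R - jumpP) :=
    fun τ J hJ => hs.periodic_actP R hR le_rfl ε J τ hJ
  have hFc : ContinuousOn F (Icc 0 T) :=
    h.continuousOn_P.sub (h.continuousOn_ev hd hpos fun τ => hper τ J hJ0)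
  have hvc : ContinuousOn v (Icc 0 T) := by
    have h2 : dAct (actP s R) = dAct (actP s R - jumpP) := by rw [map_sub, dAct_jumpP, sub_zero]
    simp only [hv, h2]
    exact h.continuousOn_ev hd hpos fun τ => periodic_dAct hd hpos hJ0 (hper τ)
  have hηT : ε ^ R * T ≤ L * ε ^ (R - k) := by
    rw [le_div_iff₀ (by positivity)] at hT
    have : ε ^ R = ε ^ (R - k) * ε ^ k := by rw [← pow_add, Nat.sub_add_cancel (by omega)]
    rw [this]
    nlinarith [pow_pos hε (R - k)]
  have hηT0 : 0 ≤ ε ^ R * T := by positivity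
  have hpow1 : ε ^ (R - k) ≤ ε := pow_le_of_le_one hε.le hε1.le (by omega)
  have hpow2 : ε ^ (R - k) * ε ^ (R - k) ≤ ε ^ R * ε := by
    rw [← pow_add, ← pow_succ]
    exact pow_le_pow_of_le_one hε.le hε1.le (by omega)
  have key := abs_le_mul_of_abs_deriv_right_le (u := fun t => F t / v t) (T := T) (η := ε ^ R)
    (M := 2 * M) (N := N) (K := K) (by positivity) (by positivity) hNpos.le (by positivity)
    (hFc.div hvc fun t ht => (by linarith [(hv2 t ht).1] : (0 : ℝ) < v t).ne')
    (fun t ht => h.exists_hasDerivWithinAt hd hpos hs hρ hJ0 ht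
      (by linarith [(hv2 t (Ico_subset_Icc_self ht)).1] : (0 : ℝ) < v t).ne') ?_ ?_ ?_ t ht
  · rw [liftAction_sub]
    have hv3 := hv2 t ht
    have hvp : 0 < v t := by linarith
    change |F t| ≤ _
    have e : F t = F t / v t * v t := by field_simp
    rw [e, abs_mul, abs_of_pos hvp]
    have h4 : K * ε ^ R * t ≤ K * (L * ε ^ (R - k)) := by
      rw [mul_assoc]
      refine mul_le_mul_of_nonneg_left (le_trans ?_ hηT) (by positivity)
      exact mul_le_mul_of_nonneg_left ht.2 (by positivity)
    calc |F t / v t| * v t ≤ K * (L * ε ^ (R - k)) * 2 :=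
          mul_le_mul (key.trans h4) hv3.2 hvp.le (by positivity)
      _ = _ := by ring
  · have h5 : F 0 = 0 := by
      have := liftAction_sub (d := d) ε J φ P 0 (actP s R)
      rw [mul_zero, h0, sub_self] at this
      change P 0 - ev d ε J (ε * 0) (sawtooth (φ 0)) (actP s R - jumpP) = 0
      rw [mul_zero, ← this]
    simp [h5]
  · intro t ht
    have htI := Ico_subset_Icc_self ht
    have hv3 := hv2 t htI
    have hvp : 0 < v t := by linarith
    have hvi : (v t)⁻¹ ≤ 2 := by
      rw [inv_le_comm₀ hvp two_pos]
      linarith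
    have hvi0 : 0 < (v t)⁻¹ := inv_pos.2 hvp
    have b1 := hb (dAng ρ) (by simp) t htI
    have b2 := hb (dAct (dAng ρ)) (by simp) t htI
    have b3 := hb (dAct (dAng (actP s R))) (by simp) t htI
    have hη : 0 < ε ^ R := by positivity
    have b4 : π ^ 2 / d (ε * t) ^ 2 ≤ π ^ 2 / c ^ 2 := by
      have := hcd (ε * t)
      gcongr
    have b5 : 0 < π ^ 2 / d (ε * t) ^ 2 := by
      have := hpos (ε * t)
      positivity
    refine (abs_sub _ _).trans (add_le_add ((abs_sub _ _).trans ?_) ?_)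
    · have c1 : |-(ε ^ R * ev d ε J (ε * t) (sawtooth (φ t)) (dAng ρ)) / v t| ≤
          2 * M * ε ^ R := by
        rw [div_eq_mul_inv, abs_mul, abs_neg, abs_mul, abs_of_pos hη, abs_of_pos hvi0]
        calc _ ≤ ε ^ R * M * 2 := by gcongr
          _ = _ := by ring
      have c2 : |F t / v t * (ε ^ R * ev d ε J (ε * t) (sawtooth (φ t)) (dAct (dAng ρ))) / v t| ≤
          2 * M * ε ^ R * |F t / v t| := by
        rw [div_eq_mul_inv, abs_mul, abs_mul, abs_mul, abs_of_pos hη, abs_of_pos hvi0]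
        calc _ ≤ |F t / v t| * (ε ^ R * M) * 2 := by gcongr
          _ = _ := by ring
      change |_ / v t| + |F t / v t * _ / v t| ≤ _
      linarith
    · rw [abs_mul, abs_mul, abs_of_pos b5, abs_pow]
      change _ * |F t / v t| ^ 2 ≤ _
      gcongr
      exact mul_le_mul b4 b3 (abs_nonneg _) (by positivity)
  · have hη : 0 < ε ^ R := by positivity
    have q1 : K * ε ^ R * T ≤ K * L * ε := by
      calc K * ε ^ R * T = K * (ε ^ R * T) := by ring
        _ ≤ K * (L * ε) := by
          refine mul_le_mul_of_nonneg_left (hηT.trans ?_) (by positivity)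
          gcongr
        _ = _ := by ring
    have q2 : (K * ε ^ R * T) ^ 2 ≤ K ^ 2 * L ^ 2 * (ε ^ R * ε) := by
      calc (K * ε ^ R * T) ^ 2 = K ^ 2 * (ε ^ R * T) ^ 2 := by ring
        _ ≤ K ^ 2 * (L * ε ^ (R - k)) ^ 2 := by gcongr
        _ = K ^ 2 * L ^ 2 * (ε ^ (R - k) * ε ^ (R - k)) := by ring
        _ ≤ _ := by gcongr
    calc 2 * M * ε ^ R * (1 + K * ε ^ R * T) + N * (K * ε ^ R * T) ^ 2
        ≤ 2 * M * ε ^ R * (1 + K * L * ε) + N * (K ^ 2 * L ^ 2 * (ε ^ R * ε)) := by gcongr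
      _ = (2 * M + ε * W) * ε ^ R := by rw [hW]; ring
      _ < K * ε ^ R := by
        gcongr
        linarith

/-- The old actions of the orders `r` and `R` differ by terms of order `ε ^ r`. -/
theorem exists_actP_eq_add (s : ℕ → SymPoly) {r R : ℕ} (hr : 1 ≤ r) (hrR : r ≤ R) :
    ∃ p, actP s R = actP s r + E ^ r * p := by
  induction R, hrR using Nat.le_induction with
  | base => exact ⟨0, by simp⟩
  | succ R hR ih =>
    obtain ⟨p, hp⟩ := ih
    refine ⟨p + E ^ (R - r) * dAng (s R), ?_⟩
    have h1 : E * E ^ (R - 1) = E ^ R := by rw [← pow_succ', Nat.sub_add_cancel (by omega)]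
    have h2 : E ^ r * E ^ (R - r) = E ^ R := by rw [← pow_add, Nat.add_sub_cancel' hR]
    have h3 : actP s (R + 1) = actP s R + E ^ R * dAng (s R) := by
      simp only [actP, genP_succ s (show 1 ≤ R by omega), map_add, Derivation.leibniz,
        Derivation.leibniz_pow, dAng_E, smul_eq_mul, smul_zero, add_zero, ← h1, mul_zero]
      ring
    rw [h3, hp, mul_add, ← mul_assoc, h2, add_assoc]

theorem ev_actP_eq (ε J τ θ : ℝ) (s : ℕ → SymPoly) (r : ℕ) :
    ev d ε J τ θ (actP s r) = J + ε * ev d ε J τ θ (dAng (genP s r)) := by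
  simp [actP]

/-- Solvability of the equation for the initial value of the new action. -/
theorem exists_action_eq (hd : ContDiff ℝ ∞ d) (hc : 0 < c) (hcd : ∀ τ, c ≤ d τ)
    (hU : ∀ n : ℕ, ∃ M : ℝ, ∀ τ ∈ U, |iteratedDeriv n d τ| ≤ M) (h0 : (0 : ℝ) ∈ U) (r : ℕ)
    (s : ℕ → SymPoly) {a b : ℝ} (ha : 0 < a) (hab : a ≤ b) :
    ∃ ε₀ > 0, ∀ ε : ℝ, 0 < ε → ε < ε₀ → ∀ θ ∈ Icc (-π) π, ∀ I ∈ Icc a b,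
      ∃! J, J ∈ Icc (a / 2) (2 * b) ∧ I = ev d ε J 0 θ (actP s r) := by
  have hpos : ∀ τ, 0 < d τ := fun τ => hc.trans_le (hcd τ)
  have ha2 : 0 < a / 2 := by positivity
  obtain ⟨M, hM, hMb⟩ := exists_bound_ev_list hc hcd hU ha2 (2 * b)
    [dAng (genP s r), dAct (dAng (genP s r))]
  refine ⟨min 1 (min (1 / (2 * M)) (a / (2 * M))), by positivity, fun ε hε hε' θ hθ I hI => ?_⟩
  obtain ⟨hε1, hε2⟩ := lt_min_iff.1 hε'
  obtain ⟨hεM, hεa⟩ := lt_min_iff.1 hε2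
  rw [lt_div_iff₀ (by positivity)] at hεM hεa
  have hεI : ε ∈ Icc (0 : ℝ) 1 := ⟨hε.le, hε1.le⟩
  have hb1 : ∀ J ∈ Icc (a / 2) (2 * b), |ε * ev d ε J 0 θ (dAng (genP s r))| ≤ a / 2 :=
    fun J hJ => by
      rw [abs_mul, abs_of_pos hε]
      have := mul_le_mul_of_nonneg_left (hMb _ (by simp) ε hεI J hJ 0 h0 θ hθ :
        |ev d ε J 0 θ (dAng (genP s r))| ≤ M) hε.le
      linarith
  have hlip : ∀ x ∈ Icc (a / 2) (2 * b), ∀ y ∈ Icc (a / 2) (2 * b),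
      |x - y| ≤ 2 * |ev d ε x 0 θ (actP s r) - ev d ε y 0 θ (actP s r)| := fun x hx y hy => by
    rw [ev_actP_eq, ev_actP_eq]
    exact abs_sub_le_two_mul (h := fun J => ev d ε J 0 θ (dAng (genP s r))) hε.le
      (by linarith) (abs_ev_act_sub_le hd hpos ha2
        (fun J hJ => hMb _ (by simp) ε hεI J hJ 0 h0 θ hθ) hx hy)
  have hle : a / 2 ≤ 2 * b := by linarith
  have hcont : ContinuousOn (fun J => ev d ε J 0 θ (actP s r)) (Icc (a / 2) (2 * b)) :=
    fun J hJ => (hasDerivAt_ev_act hd hpos ε (ha2.trans_le hJ.1).ne' 0 θ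
      _).continuousAt.continuousWithinAt
  obtain ⟨J, hJ, hJI⟩ := intermediate_value_Icc hle hcont (show I ∈ _ by
    have h1 := abs_le.1 (hb1 (a / 2) ⟨le_rfl, hle⟩)
    have h2 := abs_le.1 (hb1 (2 * b) ⟨hle, le_rfl⟩)
    refine ⟨?_, ?_⟩ <;> rw [ev_actP_eq]
    · linarith [hI.1]
    · linarith [hI.2])
  refine ⟨J, ⟨hJ, hJI.symm⟩, fun J' ⟨hJ', hJI'⟩ => ?_⟩
  have := hlip J' hJ' J hJ
  rw [← hJI', show ev d ε J 0 θ (actP s r) = I from hJI, sub_self, abs_zero, mul_zero] at this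
  exact sub_eq_zero.1 (abs_nonpos_iff.1 this)

/-- Conservation of the new action of order `r`. A procedure of higher order is conserved with
the required accuracy, and the new actions of the two orders differ by `O(ε ^ r)`. -/
theorem exists_bound_liftAction (hd : ContDiff ℝ ∞ d) (hc : 0 < c) (hcd : ∀ τ, c ≤ d τ)
    (hU : ∀ n : ℕ, ∃ M : ℝ, ∀ τ ∈ U, |iteratedDeriv n d τ| ≤ M) (h0 : (0 : ℝ) ∈ U) {r k : ℕ}
    (hr : 1 ≤ r) (hs : IsProcedure d (r + 2 * k + 1) s κ) {a b L : ℝ} (ha : 0 < a) (hab : a ≤ b)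
    (hL : 0 < L) :
    ∃ C > 0, ∃ ε₀ > 0, ∀ ε T : ℝ, 0 < ε → ε < ε₀ → T ≤ L / ε ^ k → (∀ t ∈ Icc 0 T, ε * t ∈ U) →
      ∀ φ P, IsLift d ε T φ P → liftAction d ε φ P 0 ∈ Icc a b → ∀ J ∈ Icc (a / 2) (2 * b),
      liftAction d ε φ P 0 = ev d ε J 0 (sawtooth (φ 0)) (actP s r) → ∀ t ∈ Icc 0 T,
      |liftAction d ε φ P t - ev d ε J (ε * t) (sawtooth (φ t)) (actP s r)| ≤ C * ε ^ r := by
  have hpos : ∀ τ, 0 < d τ := fun τ => hc.trans_le (hcd τ)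
  have ha2 : 0 < a / 2 := by positivity
  obtain ⟨C, hC, ε₁, hε₁, hhigh⟩ := exists_bound_liftAction_high hd hc hcd hU hs (by omega)
    (show 2 * k < r + 2 * k + 1 by omega) ha2 (2 * b) hL
  obtain ⟨ε₂, hε₂, hJex⟩ := exists_action_eq hd hc hcd hU h0 (r + 2 * k + 1) s ha hab
  obtain ⟨p, hp⟩ := exists_actP_eq_add s hr (show r ≤ r + 2 * k + 1 by omega)
  obtain ⟨M, hM, hMb⟩ := exists_bound_ev_list hc hcd hU ha2 (2 * b)
    [p, dAct (dAng (genP s r)), dAct (actP s r)]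
  refine ⟨C + M + M * (2 * M), by positivity, min (min ε₁ ε₂) (min 1 (1 / (2 * M))),
    by positivity, fun ε T hε hε' hT hτ φ P h hI J hJ hJI t ht => ?_⟩
  obtain ⟨hε12, hε34⟩ := lt_min_iff.1 hε'
  obtain ⟨hε1, hε2⟩ := lt_min_iff.1 hε12
  obtain ⟨hε3, hεM⟩ := lt_min_iff.1 hε34
  rw [lt_div_iff₀ (by positivity)] at hεM
  have hεI : ε ∈ Icc (0 : ℝ) 1 := ⟨hε.le, hε3.le⟩
  obtain ⟨J', ⟨hJ', hJI'⟩, -⟩ := hJex ε hε hε2 (sawtooth (φ 0)) (sawtooth_mem_Icc _) _ hI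
  have h1 := hhigh ε T hε hε1 hT hτ φ P h J' hJ' hJI' t ht
  have hηr : 0 < ε ^ r := by positivity
  have htail : ∀ τ ∈ U, ∀ θ ∈ Icc (-π) π, |ev d ε J' τ θ (actP s (r + 2 * k + 1)) -
      ev d ε J' τ θ (actP s r)| ≤ M * ε ^ r := fun τ hτ θ hθ => by
    rw [hp, map_add, add_sub_cancel_left, map_mul, map_pow, ev_E, abs_mul, abs_of_pos hηr, mul_comm]
    exact mul_le_mul_of_nonneg_right (hMb p (by simp) ε hεI J' hJ' τ hτ θ hθ) hηr.le
  have h2 := htail (ε * t) (hτ t ht) _ (sawtooth_mem_Icc (φ t))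
  have h3 : |J' - J| ≤ 2 * (M * ε ^ r) := by
    refine (abs_sub_le_two_mul (h := fun J => ev d ε J 0 (sawtooth (φ 0)) (dAng (genP s r))) hε.le
      (M := M) (by linarith) (abs_ev_act_sub_le hd hpos ha2
        (fun J hJ => hMb _ (by simp) ε hεI J hJ 0 h0 _ (sawtooth_mem_Icc _)) hJ' hJ)).trans ?_
    have h4 := htail 0 h0 _ (sawtooth_mem_Icc (φ 0))
    rw [← hJI', hJI, abs_sub_comm, ev_actP_eq, ev_actP_eq] at h4
    linarith
  have h5 : |ev d ε J' (ε * t) (sawtooth (φ t)) (actP s r) -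
      ev d ε J (ε * t) (sawtooth (φ t)) (actP s r)| ≤ M * |J' - J| :=
    abs_ev_act_sub_le hd hpos ha2 (fun J hJ => hMb _ (by simp) ε hεI J hJ _ (hτ t ht) _
      (sawtooth_mem_Icc _)) hJ' hJ
  have h6 : ε ^ (r + 2 * k + 1 - k) ≤ ε ^ r :=
    pow_le_pow_of_le_one hε.le hε3.le (by omega)
  calc _ ≤ |liftAction d ε φ P t - ev d ε J' (ε * t) (sawtooth (φ t)) (actP s (r + 2 * k + 1))| +
        |ev d ε J' (ε * t) (sawtooth (φ t)) (actP s (r + 2 * k + 1)) -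
          ev d ε J (ε * t) (sawtooth (φ t)) (actP s r)| := abs_sub_le _ _ _
    _ ≤ C * ε ^ (r + 2 * k + 1 - k) + (M * ε ^ r + M * |J' - J|) :=
      add_le_add h1 ((abs_sub_le _ _ _).trans (add_le_add h2 h5))
    _ ≤ C * ε ^ r + (M * ε ^ r + M * (2 * (M * ε ^ r))) := by gcongr
    _ = _ := by ring

/-- The action and the regularized action are preserved to accuracy `O(ε)`: the case `r = 1`, in
which the new action is the old one. -/
theorem exists_bound_regularized (hd : ContDiff ℝ ∞ d) (hc : 0 < c) (hcd : ∀ τ, c ≤ d τ)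
    (hU : ∀ n : ℕ, ∃ M : ℝ, ∀ τ ∈ U, |iteratedDeriv n d τ| ≤ M) (h0 : (0 : ℝ) ∈ U) (k : ℕ)
    {a b L : ℝ} (ha : 0 < a) (hab : a ≤ b) (hL : 0 < L) :
    ∃ C > 0, ∃ ε₀ > 0, ∀ ε T : ℝ, 0 < ε → ε < ε₀ → T ≤ L / ε ^ k → (∀ t ∈ Icc 0 T, ε * t ∈ U) →
      ∀ φ P, IsLift d ε T φ P → liftAction d ε φ P 0 ∈ Icc a b → ∀ t ∈ Icc 0 T,
      |liftAction d ε φ P t - liftAction d ε φ P 0| ≤ C * ε ∧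
        |P t - liftAction d ε φ P 0| ≤ C * ε := by
  have hpos : ∀ τ, 0 < d τ := fun τ => hc.trans_le (hcd τ)
  obtain ⟨s, κ, hs⟩ := exists_isProcedure hd hpos (show 2 ≤ 1 + 2 * k + 1 by omega)
  obtain ⟨C, hC, ε₁, hε₁, hb⟩ := exists_bound_liftAction hd hc hcd hU h0 le_rfl hs ha hab hL
  obtain ⟨M, hM, hMb⟩ := exists_bound_ev hc hcd hU ha (β := b)
    (MvPolynomial.C (1 / π ^ 2) * Dn 0 * Dn 1 * Th)
  refine ⟨C + M, by positivity, min ε₁ 1, by positivity,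
    fun ε T hε hε' hT hτ φ P h hI t ht => ?_⟩
  obtain ⟨hε1, hε2⟩ := lt_min_iff.1 hε'
  have hJ : liftAction d ε φ P 0 ∈ Icc (a / 2) (2 * b) := by
    constructor <;> linarith [hI.1, hI.2]
  have hact : ∀ J τ θ, ev d ε J τ θ (actP s 1) = J := fun J τ θ => by simp [actP, genP]
  have h1 := hb ε T hε hε1 hT hτ φ P h hI _ hJ (hact _ _ _).symm t ht
  rw [hact, pow_one] at h1
  have h2 : |liftAction d ε φ P t - P t| ≤ M * ε := by
    have h3 := hMb ε ⟨hε.le, hε2.le⟩ _ hI _ (hτ t ht) _ (sawtooth_mem_Icc (φ t))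
    simp only [map_mul, ev_C, ev_Dn, ev_Th, iteratedDeriv_zero, iteratedDeriv_one] at h3
    have h4 : liftAction d ε φ P t - P t =
        ε * (1 / π ^ 2 * d (ε * t) * deriv d (ε * t) * sawtooth (φ t)) := by
      rw [liftAction]
      ring
    rw [h4, abs_mul, abs_of_pos hε, mul_comm]
    exact mul_le_mul_of_nonneg_right h3 hε.le
  refine ⟨h1.trans (by nlinarith), ?_⟩
  have := abs_sub_le (P t) (liftAction d ε φ P t) (liftAction d ε φ P 0)
  rw [abs_sub_comm (P t) (liftAction d ε φ P t)] at this
  linarith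

end lift
end FermiUlam

namespace FermiUlam
open SymPoly

/-! ### The phase of the lifted motion -/

section lift
variable {d : ℝ → ℝ} {c : ℝ} {U : Set ℝ} {R : ℕ} {s κ : ℕ → SymPoly}

/-- The evolution of the new angle, with the new action frozen at `J`. -/
theorem IsLift.hasDerivWithinAt_newAngle (hd : ContDiff ℝ ∞ d) (hpos : ∀ τ, 0 < d τ) {ε T : ℝ}
    {φ P : ℝ → ℝ} (h : IsLift d ε T φ P) (hs : IsProcedure d R s κ) {r : ℕ} (hr : r ≤ R)
    {ρ : SymPoly} (hρ : Equiv d (remP s κ r) (E ^ r * ρ)) {J : ℝ} (hJ : 0 < J) {t : ℝ}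
    (ht : t ∈ Ico 0 T) :
    HasDerivWithinAt (fun t => φ t + ε * ev d ε J (ε * t) (sawtooth (φ t)) (dAct (genP s r)))
      (ev d ε J (ε * t) 0 (dAct (kamP κ r)) +
        (ε ^ r * ev d ε J (ε * t) (sawtooth (φ t)) (dAct ρ) + π ^ 2 / d (ε * t) ^ 2 *
          (liftAction d ε φ P t - ev d ε J (ε * t) (sawtooth (φ t)) (actP s r)) *
          ev d ε J (ε * t) (sawtooth (φ t)) (dAct (actP s r)))) (Ici t) t := by
  refine ((h.deriv_φ t ht).fun_add ((h.hasDerivWithinAt_ev hd hpos hJ (dAct (genP s r))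
    ht).const_mul ε)).congr_deriv ?_
  simp only [liftAction]
  generalize ε * t = τ at *
  generalize sawtooth (φ t) = θ at *
  have i1 := (hρ.dAct hd hpos) ε J τ θ hJ
  have e0 : ev d ε J τ 0 (dAct (kamP κ r)) = ev d ε J τ θ (dAct (kamP κ r)) := by
    refine ev_eq_of_dAng_eq_zero hd hpos ?_ ε hJ τ 0 θ
    rw [← dAct_dAng, dAng_kamP hs hr, map_zero]
  have e1 : dAng (dAct (genP s r)) = dAct (dAng (genP s r)) := (dAct_dAng _).symm
  have e2 : dSlow (dAct (genP s r)) = dAct (dSlow (genP s r)) := (dAct_dSlow _).symm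
  have e3 : dAct (actP s r) = 1 + E * dAct (dAng (genP s r)) := by
    simp [actP, Derivation.leibniz]
  have i1' : dAct (remP s κ r) = MvPolynomial.C (π ^ 2) * actP s r * dAct (actP s r) * Di ^ 2
      - E * Dn 1 * Di * dAct (actP s r) * Th + E ^ 2 * dAct (dSlow (genP s r))
      - dAct (kamP κ r) := by
    have : (MvPolynomial.C (π ^ 2) : SymPoly) = 2 * MvPolynomial.C (π ^ 2 / 2) := by
      rw [show (2 : SymPoly) = MvPolynomial.C 2 from rfl, ← MvPolynomial.C_mul]
      congr 1
      ring
    rw [remP, map_sub, hamP, this]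
    simp only [map_sub, map_add, Derivation.leibniz, Derivation.leibniz_pow, dAct_C, dAct_E,
      dAct_Di, dAct_Dn, dAct_Th, smul_eq_mul, nsmul_eq_mul, mul_zero, add_zero, zero_add]
    push_cast
    ring
  have i3' : dAct (E ^ r * ρ) = E ^ r * dAct ρ := by
    simp [Derivation.leibniz, Derivation.leibniz_pow]
  rw [i1', i3'] at i1
  rw [e0, e1, e2]
  have e3' := congrArg (ev d ε J τ θ) e3
  simp only [map_sub, map_mul, map_add, map_pow, map_one, ev_C, ev_E, ev_Dn, ev_Di, ev_Th,
    iteratedDeriv_one] at i1 e3'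
  have h6 := (hpos τ).ne'
  have h7 := pi_pos.ne'
  generalize ev d ε J τ θ (dAct (actP s r)) = v at *
  generalize ev d ε J τ θ (actP s r) = g at *
  generalize ev d ε J τ θ (dAct (kamP κ r)) = κJ at *
  generalize ev d ε J τ θ (dAct (dSlow (genP s r))) = b at *
  generalize P t = Q at *
  rw [← i1, e3']
  field_simp
  ring

/-- The new angle moves as the truncated new Hamiltonian prescribes, up to `O(ε ^ r)` per unit of
time. -/
theorem exists_bound_newAngle (hd : ContDiff ℝ ∞ d) (hc : 0 < c) (hcd : ∀ τ, c ≤ d τ)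
    (hU : ∀ n : ℕ, ∃ M : ℝ, ∀ τ ∈ U, |iteratedDeriv n d τ| ≤ M) (hs : IsProcedure d R s κ) {r : ℕ}
    (h1 : 1 ≤ r) (hr : r ≤ R) {α : ℝ} (hα : 0 < α) (β : ℝ) {C₁ : ℝ} (hC₁ : 0 < C₁) :
    ∃ C > 0, ∀ ε T : ℝ, 0 < ε → ε < 1 → (∀ t ∈ Icc 0 T, ε * t ∈ U) →
      ∀ φ P, IsLift d ε T φ P → ∀ J ∈ Icc α β,
      (∀ t ∈ Icc 0 T,
        |liftAction d ε φ P t - ev d ε J (ε * t) (sawtooth (φ t)) (actP s r)| ≤ C₁ * ε ^ r) →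
      ∀ ψ : ℝ → ℝ, ψ 0 = φ 0 + ε * ev d ε J 0 (sawtooth (φ 0)) (dAct (genP s r)) →
      (∀ t ∈ Icc 0 T,
        HasDerivWithinAt ψ (ev d ε J (ε * t) 0 (dAct (kamP κ r))) (Icc 0 T) t) →
      ∀ t ∈ Icc 0 T,
        |φ t + ε * ev d ε J (ε * t) (sawtooth (φ t)) (dAct (genP s r)) - ψ t| ≤ C * ε ^ r * t := by
  have hpos : ∀ τ, 0 < d τ := fun τ => hc.trans_le (hcd τ)
  obtain ⟨ρ, hρ⟩ := hs.rem r h1 hr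
  obtain ⟨M, hM, hMb⟩ := exists_bound_ev_list hc hcd hU hα β [dAct ρ, dAct (actP s r)]
  have hpi := pi_pos
  refine ⟨M + π ^ 2 / c ^ 2 * C₁ * M, by positivity,
    fun ε T hε hε1 hτ φ P h J hJ hact ψ hψ0 hψ t ht => ?_⟩
  have hJ0 : 0 < J := hα.trans_le hJ.1
  have hεI : ε ∈ Icc (0 : ℝ) 1 := ⟨hε.le, hε1.le⟩
  have hψc : ContinuousOn ψ (Icc 0 T) := fun t ht => (hψ t ht).continuousWithinAt
  have hper : ∀ τ, ∀ J > 0, ev d ε J τ π (genP s r) = ev d ε J τ (-π) (genP s r) :=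
    fun τ J hJ => periodic_genP hs hr ε τ hJ
  have hc1 := h.continuousOn_ev hd hpos (p := dAct (genP s r))
    fun τ => periodic_dAct hd hpos hJ0 (hper τ)
  have key := norm_image_sub_le_of_norm_deriv_right_le_segment
    (f := fun t => φ t + ε * ev d ε J (ε * t) (sawtooth (φ t)) (dAct (genP s r)) - ψ t)
    (a := 0) (b := T) (C := (M + π ^ 2 / c ^ 2 * C₁ * M) * ε ^ r)
    ((h.continuousOn_φ.add (hc1.const_smul ε)).sub hψc)
    (fun t ht => (h.hasDerivWithinAt_newAngle hd hpos hs hr hρ hJ0 ht).fun_sub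
      ((hψ t (Ico_subset_Icc_self ht)).mono_of_mem_nhdsWithin (Icc_mem_nhdsGE_of_mem ht)))
    (fun t ht => ?_) t ht
  · simpa [hψ0] using key
  · have htI := Ico_subset_Icc_self ht
    have b1 := hMb (dAct ρ) (by simp) ε hεI J hJ _ (hτ t htI) _ (sawtooth_mem_Icc (φ t))
    have b2 := hMb (dAct (actP s r)) (by simp) ε hεI J hJ _ (hτ t htI) _ (sawtooth_mem_Icc (φ t))
    have hη : 0 < ε ^ r := by positivity
    have b4 : π ^ 2 / d (ε * t) ^ 2 ≤ π ^ 2 / c ^ 2 := by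
      have := hcd (ε * t)
      gcongr
    have b5 : 0 < π ^ 2 / d (ε * t) ^ 2 := by
      have := hpos (ε * t)
      positivity
    rw [add_sub_cancel_left, Real.norm_eq_abs]
    refine (abs_add_le _ _).trans ?_
    rw [abs_mul, abs_mul, abs_mul, abs_of_pos hη, abs_of_pos b5]
    have h2 : π ^ 2 / d (ε * t) ^ 2 *
        |liftAction d ε φ P t - ev d ε J (ε * t) (sawtooth (φ t)) (actP s r)| ≤
        π ^ 2 / c ^ 2 * (C₁ * ε ^ r) :=
      mul_le_mul b4 (hact t htI) (abs_nonneg _) (by positivity)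
    calc _ ≤ ε ^ r * M + π ^ 2 / c ^ 2 * (C₁ * ε ^ r) * M :=
          add_le_add (by gcongr) (mul_le_mul h2 b2 (abs_nonneg _) (by positivity))
      _ = _ := by ring

/-- For small `ε` the passage from the old angle to the new one is a homeomorphism of the line whose
inverse is Lipschitz. -/
theorem exists_newAngle_inverse (hd : ContDiff ℝ ∞ d) (hc : 0 < c) (hcd : ∀ τ, c ≤ d τ)
    (hU : ∀ n : ℕ, ∃ M : ℝ, ∀ τ ∈ U, |iteratedDeriv n d τ| ≤ M) (hs : IsProcedure d R s κ) {r : ℕ}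
    (hr : r ≤ R) {α : ℝ} (hα : 0 < α) (β : ℝ) :
    ∃ ε₀ > 0, ∀ ε : ℝ, 0 < ε → ε < ε₀ → ∀ J ∈ Icc α β, ∀ τ ∈ U,
      (∀ p q : ℝ, |p - q| ≤ 2 * |p + ε * ev d ε J τ (sawtooth p) (dAct (genP s r)) -
        (q + ε * ev d ε J τ (sawtooth q) (dAct (genP s r)))|) ∧
      ∀ y : ℝ, ∃! p : ℝ, p + ε * ev d ε J τ (sawtooth p) (dAct (genP s r)) = y := by
  have hpos : ∀ τ, 0 < d τ := fun τ => hc.trans_le (hcd τ)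
  obtain ⟨M, hM, hMb⟩ := exists_bound_ev_list hc hcd hU hα β
    [dAct (genP s r), dAng (dAct (genP s r))]
  refine ⟨min 1 (1 / (2 * M)), by positivity, fun ε hε hε' J hJ τ hτ => ?_⟩
  obtain ⟨hε1, hεM⟩ := lt_min_iff.1 hε'
  rw [lt_div_iff₀ (by positivity)] at hεM
  have hεI : ε ∈ Icc (0 : ℝ) 1 := ⟨hε.le, hε1.le⟩
  have hJ0 : 0 < J := hα.trans_le hJ.1
  have hlip : ∀ p q : ℝ, |p - q| ≤ 2 * |p + ε * ev d ε J τ (sawtooth p) (dAct (genP s r)) -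
      (q + ε * ev d ε J τ (sawtooth q) (dAct (genP s r)))| := fun p q =>
    abs_sub_le_two_mul (h := fun p => ev d ε J τ (sawtooth p) (dAct (genP s r))) (M := M) hε.le
      (by linarith) (abs_comp_sawtooth_sub_le (g := fun θ => ev d ε J τ θ (dAct (genP s r)))
        (fun θ => hasDerivAt_ev_ang hd hpos ε hJ0.ne' τ θ _)
        (periodic_dAct hd hpos hJ0 fun J hJ => periodic_genP hs hr ε τ hJ)
        (fun θ hθ => hMb _ (by simp) ε hεI J hJ τ hτ θ hθ) q p)
  have hcont : Continuous fun p => p + ε * ev d ε J τ (sawtooth p) (dAct (genP s r)) := by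
    have h1 := continuous_comp_sawtooth (continuous_ev hd hpos ε J (dAct (genP s r)))
      fun τ => periodic_dAct hd hpos hJ0 fun J hJ => periodic_genP hs hr ε τ hJ
    exact continuous_id.add ((h1.comp (Continuous.prodMk_right τ)).const_smul ε)
  have hb : ∀ p, |ε * ev d ε J τ (sawtooth p) (dAct (genP s r))| ≤ 1 := fun p => by
    rw [abs_mul, abs_of_pos hε]
    have := mul_le_mul_of_nonneg_left (hMb (dAct (genP s r)) (by simp) ε hεI J hJ τ hτ _
      (sawtooth_mem_Icc p)) hε.le
    linarith
  refine ⟨hlip, fun y => ?_⟩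
  obtain ⟨p, hp⟩ := mem_range_of_exists_le_of_exists_ge hcont (c := y)
    ⟨y - 1, by linarith [(abs_le.1 (hb (y - 1))).2]⟩
    ⟨y + 1, by linarith [(abs_le.1 (hb (y + 1))).1]⟩
  refine ⟨p, hp, fun q hq => ?_⟩
  have := hlip q p
  rw [show p + ε * ev d ε J τ (sawtooth p) (dAct (genP s r)) = y from hp, hq, sub_self, abs_zero,
    mul_zero] at this
  exact sub_eq_zero.1 (abs_nonpos_iff.1 this)

/-- The description of a lifted motion by the perturbation procedure. -/
theorem exists_bound_lift (hd : ContDiff ℝ ∞ d) (hc : 0 < c) (hcd : ∀ τ, c ≤ d τ)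
    (hU : ∀ n : ℕ, ∃ M : ℝ, ∀ τ ∈ U, |iteratedDeriv n d τ| ≤ M) (h0 : (0 : ℝ) ∈ U) {r k : ℕ}
    (hr : 1 ≤ r) (hs : IsProcedure d (r + 2 * k + 1) s κ) {a b L : ℝ} (ha : 0 < a) (hab : a ≤ b)
    (hL : 0 < L) :
    ∃ C > 0, ∃ ε₀ > 0, ∀ ε T : ℝ, 0 < ε → ε < ε₀ → T ≤ L / ε ^ k → (∀ t ∈ Icc 0 T, ε * t ∈ U) →
      ∀ φ P, IsLift d ε T φ P → liftAction d ε φ P 0 ∈ Icc a b →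
      (∃! J, J ∈ Icc (a / 2) (2 * b) ∧
        liftAction d ε φ P 0 = ev d ε J 0 (sawtooth (φ 0)) (actP s r)) ∧
      ∀ J ∈ Icc (a / 2) (2 * b),
      liftAction d ε φ P 0 = ev d ε J 0 (sawtooth (φ 0)) (actP s r) →
      ∀ ψ : ℝ → ℝ, ψ 0 = φ 0 + ε * ev d ε J 0 (sawtooth (φ 0)) (dAct (genP s r)) →
      (∀ t ∈ Icc 0 T,
        HasDerivWithinAt ψ (ev d ε J (ε * t) 0 (dAct (kamP κ r))) (Icc 0 T) t) →
      ∀ t ∈ Icc 0 T,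
        |liftAction d ε φ P t - ev d ε J (ε * t) (sawtooth (φ t)) (actP s r)| ≤ C * ε ^ r ∧
        (∃! p, p + ε * ev d ε J (ε * t) (sawtooth p) (dAct (genP s r)) = ψ t) ∧
        ∀ p, p + ε * ev d ε J (ε * t) (sawtooth p) (dAct (genP s r)) = ψ t →
          |φ t - p| ≤ C * ε ^ ((r : ℤ) - (k : ℤ)) ∧
          ((∀ q ∈ uIcc (φ t) p, ¬ IsOddPi q) →
            |liftAction d ε φ P t - ev d ε J (ε * t) (sawtooth p) (actP s r)| ≤
              C * (ε ^ r + ε ^ ((r : ℤ) - (k : ℤ) + 1))) := by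
  have hpos : ∀ τ, 0 < d τ := fun τ => hc.trans_le (hcd τ)
  have ha2 : 0 < a / 2 := by positivity
  have hrR : r ≤ r + 2 * k + 1 := by omega
  obtain ⟨ε₁, hε₁, hJex⟩ := exists_action_eq hd hc hcd hU h0 r s ha hab
  obtain ⟨C₁, hC₁, ε₂, hε₂, hact⟩ := exists_bound_liftAction hd hc hcd hU h0 hr hs ha hab hL
  obtain ⟨C₂, hC₂, hang⟩ := exists_bound_newAngle hd hc hcd hU hs hr hrR ha2 (2 * b) hC₁
  obtain ⟨ε₃, hε₃, hinv⟩ := exists_newAngle_inverse hd hc hcd hU hs hrR ha2 (2 * b)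
  obtain ⟨M, hM, hMb⟩ := exists_bound_ev hc hcd hU ha2 (β := 2 * b) (dAng (dAng (genP s r)))
  refine ⟨C₁ + 2 * C₂ * L + M * (2 * C₂ * L), by positivity, min (min ε₁ ε₂) (min ε₃ 1),
    by positivity, fun ε T hε hε' hT hτ φ P h hI => ?_⟩
  obtain ⟨hε12, hε34⟩ := lt_min_iff.1 hε'
  obtain ⟨hε1, hε2⟩ := lt_min_iff.1 hε12
  obtain ⟨hε3, hε4⟩ := lt_min_iff.1 hε34
  refine ⟨hJex ε hε hε1 _ (sawtooth_mem_Icc _) _ hI, fun J hJ hJI ψ hψ0 hψ t ht => ?_⟩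
  have hb1 := hact ε T hε hε2 hT hτ φ P h hI J hJ hJI
  have hb2 := hang ε T hε hε4 hτ φ P h J hJ hb1 ψ hψ0 hψ t ht
  obtain ⟨hlip, hex⟩ := hinv ε hε hε3 J hJ (ε * t) (hτ t ht)
  have hηr : 0 < ε ^ r := by positivity
  have hz : 0 < ε ^ ((r : ℤ) - (k : ℤ)) := zpow_pos hε _
  have hzt : ε ^ r * t ≤ L * ε ^ ((r : ℤ) - (k : ℤ)) := by
    rw [zpow_sub₀ hε.ne', zpow_natCast, zpow_natCast]
    calc ε ^ r * t ≤ ε ^ r * (L / ε ^ k) :=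
          mul_le_mul_of_nonneg_left (ht.2.trans hT) hηr.le
      _ = _ := by ring
  refine ⟨(hb1 t ht).trans ?_, hex (ψ t), fun p hp => ?_⟩
  · refine mul_le_mul_of_nonneg_right ?_ hηr.le
    have : 0 < 2 * C₂ * L + M * (2 * C₂ * L) := by positivity
    linarith
  · have h1 : |φ t - p| ≤ 2 * C₂ * L * ε ^ ((r : ℤ) - (k : ℤ)) := by
      have h2 := hlip (φ t) p
      rw [hp] at h2
      calc |φ t - p| ≤ 2 * (C₂ * ε ^ r * t) := h2.trans (by linarith)
        _ = 2 * C₂ * (ε ^ r * t) := by ring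
        _ ≤ 2 * C₂ * (L * ε ^ ((r : ℤ) - (k : ℤ))) := by gcongr
        _ = _ := by ring
    refine ⟨h1.trans (mul_le_mul_of_nonneg_right ?_ hz.le), fun hodd => ?_⟩
    · have : 0 < C₁ + M * (2 * C₂ * L) := by positivity
      linarith
    · have h3 : |ev d ε J (ε * t) (sawtooth (φ t)) (dAng (genP s r)) -
          ev d ε J (ε * t) (sawtooth p) (dAng (genP s r))| ≤ M * |φ t - p| := by
        have h4 : |ev d ε J (ε * t) (sawtooth (φ t)) (dAng (genP s r)) -
            ev d ε J (ε * t) (sawtooth p) (dAng (genP s r))| ≤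
            M * |sawtooth (φ t) - sawtooth p| :=
          Convex.norm_image_sub_le_of_norm_hasDerivWithin_le
            (fun θ _ => (hasDerivAt_ev_ang hd hpos ε (ha2.trans_le hJ.1).ne' (ε * t) θ
              _).hasDerivWithinAt)
            (fun θ hθ => hMb ε ⟨hε.le, hε4.le⟩ J hJ _ (hτ t ht) θ hθ) (convex_Icc (-π) π)
            (sawtooth_mem_Icc _) (sawtooth_mem_Icc _)
        rwa [abs_sub_comm (sawtooth _), sawtooth_sub_of_no_odd hodd, abs_sub_comm p] at h4
      have h5 : |ev d ε J (ε * t) (sawtooth (φ t)) (actP s r) -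
          ev d ε J (ε * t) (sawtooth p) (actP s r)| ≤
          M * (2 * C₂ * L) * ε ^ ((r : ℤ) - (k : ℤ) + 1) := by
        rw [ev_actP_eq, ev_actP_eq, add_sub_add_left_eq_sub, ← mul_sub, abs_mul, abs_of_pos hε,
          zpow_add_one₀ hε.ne']
        calc _ ≤ ε * (M * (2 * C₂ * L * ε ^ ((r : ℤ) - (k : ℤ)))) := by
              gcongr
              exact h3.trans (by gcongr)
          _ = _ := by ring
      have hz1 : 0 < ε ^ ((r : ℤ) - (k : ℤ) + 1) := zpow_pos hε _
      have h6 := (abs_sub_le _ _ _).trans (add_le_add (hb1 t ht) h5)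
      refine h6.trans ?_
      have e1 : 0 ≤ (2 * C₂ * L + M * (2 * C₂ * L)) * ε ^ r := by positivity
      have e2 : 0 ≤ (C₁ + 2 * C₂ * L) * ε ^ ((r : ℤ) - (k : ℤ) + 1) := by positivity
      linarith

end lift
end FermiUlam

namespace FermiUlam

/-! ### The lift of a motion -/

/-- A motion with its velocity from the right `w`, which is meaningful at impacts as well. The
velocity from the left at the moment `t` is `w t`, `-w t` or `2 ε d' - w t` according to the
position of the particle. -/
structure IsRightMotion (d : ℝ → ℝ) (ε T : ℝ) (x w : ℝ → ℝ) : Prop where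
  confined : ∀ t ∈ Icc 0 T, 0 ≤ x t ∧ x t ≤ d (ε * t)
  right : ∀ t ∈ Ico 0 T, ∀ᶠ s in 𝓝[>] t, x s = x t + w t * (s - t) ∧ w s = w t
  left : ∀ t ∈ Ioc 0 T, ∃ u, (∀ᶠ s in 𝓝[<] t, x s = x t + u * (s - t) ∧ w s = u) ∧
    (IsBetween d ε x t → u = w t) ∧ (x t = 0 → u = -w t) ∧
    (x t = d (ε * t) → u = 2 * (ε * deriv d (ε * t)) - w t)

theorem IsRightMotion.mono {d : ℝ → ℝ} {ε T T' : ℝ} {x w : ℝ → ℝ} (h : IsRightMotion d ε T x w)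
    (hT : T' ≤ T) : IsRightMotion d ε T' x w where
  confined t ht := h.confined t ⟨ht.1, ht.2.trans hT⟩
  right t ht := h.right t ⟨ht.1, ht.2.trans_le hT⟩
  left t ht := h.left t ⟨ht.1, ht.2.trans hT⟩

/-- The prescribed velocity is arbitrary at impacts; it is replaced by the right derivative of the
position. -/
theorem IsMotion.exists_isRightMotion {d : ℝ → ℝ} (hpos : ∀ τ, 0 < d τ) {ε T : ℝ} {x v : ℝ → ℝ}
    (h : IsMotion d ε T x v) :
    ∃ w, IsRightMotion d ε T x w ∧ ∀ t ∈ Icc 0 T, IsBetween d ε x t → w t = v t := by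
  have h1 : ∀ t, ∃ w, t ∈ Icc 0 T → ∃ u, (∀ᶠ s in 𝓝[Icc 0 T ∩ Iio t] t, x s = x t + u * (s - t)) ∧
      (∀ᶠ s in 𝓝[Icc 0 T ∩ Ioi t] t, x s = x t + w * (s - t)) ∧
      (IsBetween d ε x t → u = w ∧ w = v t) ∧ (x t = 0 → u = -w) ∧
      (x t = d (ε * t) → u = 2 * (ε * deriv d (ε * t)) - w) := fun t => by
    by_cases ht : t ∈ Icc 0 T
    swap
    · exact ⟨0, fun h => absurd h ht⟩
    have hd := hpos (ε * t)
    rcases (h.confined t ht).1.eq_or_lt with h0 | h0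
    · obtain ⟨u, hl, hr⟩ := h.fixed_wall t ht h0.symm
      refine ⟨-u, fun _ => ⟨u, hl.mono fun _ => And.left, hr.mono fun _ => And.left,
        fun hb => ?_, fun _ => (neg_neg u).symm, fun hb => ?_⟩⟩
      · exact absurd h0 hb.1.ne
      · exact absurd (h0.trans hb) hd.ne
    rcases (h.confined t ht).2.eq_or_lt with h2 | h2
    · obtain ⟨u, hl, hr⟩ := h.moving_wall t ht h2
      refine ⟨2 * (ε * deriv d (ε * t)) - u, fun _ => ⟨u, hl.mono fun _ => And.left,
        hr.mono fun _ => And.left, fun hb => ?_, fun hb => ?_, fun _ => by ring⟩⟩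
      · exact absurd h2 hb.2.ne
      · exact absurd hb h0.ne'
    · have hf := (h.free t ht h0 h2).mono fun _ => And.left
      refine ⟨v t, fun _ => ⟨v t, hf.filter_mono (nhdsWithin_mono _ inter_subset_left),
        hf.filter_mono (nhdsWithin_mono _ inter_subset_left), fun _ => ⟨rfl, rfl⟩,
        fun hb => absurd hb h0.ne', fun hb => absurd hb h2.ne⟩⟩
  choose w hw using h1
  have hr : ∀ t ∈ Ico 0 T, ∀ᶠ s in 𝓝[>] t, x s = x t + w t * (s - t) := fun t ht => by
    obtain ⟨u, -, h2, -⟩ := hw t (Ico_subset_Icc_self ht)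
    refine h2.filter_mono (nhdsWithin_le_of_mem (inter_mem ?_ self_mem_nhdsWithin))
    exact mem_of_superset (Ioc_mem_nhdsGT ht.2) fun s hs => ⟨ht.1.trans hs.1.le, hs.2⟩
  have hslope : ∀ s ∈ Ico 0 T, ∀ b y u, s < b → (∀ s' ∈ Ico s b, x s' = y + u * s') → w s = u :=
    fun s hs b y u hb hx => by
      obtain ⟨s', h3, h4⟩ := ((hr s hs).and (Ioo_mem_nhdsGT hb)).exists
      rw [hx s' ⟨h4.1.le, h4.2⟩, hx s ⟨le_rfl, hb⟩] at h3
      have h5 : (w s - u) * (s' - s) = 0 := by linarith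
      rcases mul_eq_zero.1 h5 with h6 | h6
      · linarith
      · linarith [h4.1]
  refine ⟨w, ⟨h.confined, fun t ht => ?_, fun t ht => ?_⟩, fun t ht hb => ?_⟩
  · obtain ⟨b, hb, hsub⟩ := mem_nhdsGT_iff_exists_Ioo_subset.1 ((hr t ht).and (Iio_mem_nhds ht.2
      |> mem_nhdsWithin_of_mem_nhds))
    filter_upwards [Ioo_mem_nhdsGT hb] with s hs
    refine ⟨(hsub hs).1, hslope s ⟨ht.1.trans hs.1.le, (hsub hs).2⟩ b (x t - w t * t) (w t) hs.2
      fun s' hs' => ?_⟩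
    rw [(hsub ⟨hs.1.trans_le hs'.1, hs'.2⟩).1]
    ring
  · obtain ⟨u, hl, -, h3, h4, h5⟩ := hw t (Ioc_subset_Icc_self ht)
    refine ⟨u, ?_, fun hb => (h3 hb).1, h4, h5⟩
    have hl' : ∀ᶠ s in 𝓝[<] t, x s = x t + u * (s - t) := by
      refine hl.filter_mono (nhdsWithin_le_of_mem (inter_mem ?_ self_mem_nhdsWithin))
      exact mem_of_superset (Ico_mem_nhdsLT ht.1) fun s hs => ⟨hs.1, hs.2.le.trans ht.2⟩
    obtain ⟨b, hb, hsub⟩ := mem_nhdsLT_iff_exists_Ioo_subset.1 (hl'.and (Ioi_mem_nhds ht.1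
      |> mem_nhdsWithin_of_mem_nhds))
    filter_upwards [Ioo_mem_nhdsLT hb] with s hs
    refine ⟨(hsub hs).1, hslope s ⟨(hsub hs).2.le, hs.2.trans_le ht.2⟩ t (x t - u * t) u hs.2
      fun s' hs' => ?_⟩
    rw [(hsub ⟨hs.1.trans_le hs'.1, hs'.2⟩).1]
    ring
  · obtain ⟨u, -, -, h3, -⟩ := hw t ht
    exact (h3 hb).2

theorem continuousOn_Icc_of_oneSided {X : Type*} [TopologicalSpace X] {f : ℝ → X} {a b : ℝ}
    (hl : ∀ t ∈ Ioc a b, Tendsto f (𝓝[<] t) (𝓝 (f t)))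
    (hr : ∀ t ∈ Ico a b, Tendsto f (𝓝[>] t) (𝓝 (f t))) : ContinuousOn f (Icc a b) := by
  intro t ht
  have h1 : Tendsto f (𝓝[Icc a b ∩ Iio t] t) (𝓝 (f t)) := by
    rcases ht.1.eq_or_lt with h | h
    · have : Icc a b ∩ Iio t = ∅ := by
        ext s
        simp only [mem_inter_iff, mem_Icc, mem_Iio, mem_empty_iff_false, iff_false]
        rintro ⟨h2, h3⟩
        linarith
      simp [this]
    · exact (hl t ⟨h, ht.2⟩).mono_left (nhdsWithin_mono _ inter_subset_right)
  have h2 : Tendsto f (𝓝[Icc a b ∩ Ioi t] t) (𝓝 (f t)) := by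
    rcases ht.2.eq_or_lt with h | h
    · have : Icc a b ∩ Ioi t = ∅ := by
        ext s
        simp only [mem_inter_iff, mem_Icc, mem_Ioi, mem_empty_iff_false, iff_false]
        rintro ⟨h2, h3⟩
        linarith
      simp [this]
    · exact (hr t ⟨ht.1, h⟩).mono_left (nhdsWithin_mono _ inter_subset_right)
  have h3 : Tendsto f (𝓝[{t}] t) (𝓝 (f t)) := by
    rw [nhdsWithin_singleton]
    exact tendsto_pure_nhds f t
  have h4 : Icc a b ⊆ (Icc a b ∩ Iio t) ∪ (Icc a b ∩ Ioi t) ∪ {t} := fun s hs => by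
    rcases lt_trichotomy s t with h | h | h
    · exact Or.inl (Or.inl ⟨hs, h⟩)
    · exact Or.inr h
    · exact Or.inl (Or.inr ⟨hs, h⟩)
  refine Tendsto.mono_left ?_ (nhdsWithin_mono t h4)
  rw [nhdsWithin_union, nhdsWithin_union]
  exact (h1.sup h2).sup h3

/-- The canonical momentum conjugate to `x / d`. It changes its sign at every impact. -/
noncomputable def momentum (d : ℝ → ℝ) (ε : ℝ) (x w : ℝ → ℝ) (t : ℝ) : ℝ :=
  d (ε * t) * w t - ε * deriv d (ε * t) * x t

/-- The regularized action `|momentum| / π`. -/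
noncomputable def regAction (d : ℝ → ℝ) (ε : ℝ) (x w : ℝ → ℝ) (t : ℝ) : ℝ :=
  |momentum d ε x w t| / π

/-- The direction of the motion: `1` to the right and `-1` to the left. -/
noncomputable def direction (w : ℝ → ℝ) (t : ℝ) : ℝ := if 0 < w t then 1 else -1

/-- The phase modulo `2 π`, as a point of the unit circle. -/
noncomputable def circlePhase (d : ℝ → ℝ) (ε : ℝ) (x w : ℝ → ℝ) (t : ℝ) : ℂ :=
  Complex.exp ((direction w t * (π * (x t / d (ε * t))) : ℝ) * Complex.I)

section rightMotion
variable {d : ℝ → ℝ} {ε T : ℝ} {x w : ℝ → ℝ}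

theorem IsRightMotion.tendsto_left (h : IsRightMotion d ε T x w) {t : ℝ} (ht : t ∈ Ioc 0 T) :
    Tendsto x (𝓝[<] t) (𝓝 (x t)) := by
  obtain ⟨u, hu, -⟩ := h.left t ht
  have : Continuous fun s => x t + u * (s - t) := by fun_prop
  have h2 := (this.tendsto t).mono_left (nhdsWithin_le_nhds (s := Iio t))
  simp only [sub_self, mul_zero, add_zero] at h2
  exact h2.congr' (hu.mono fun s hs => hs.1.symm)

theorem IsRightMotion.tendsto_right (h : IsRightMotion d ε T x w) {t : ℝ} (ht : t ∈ Ico 0 T) :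
    Tendsto x (𝓝[>] t) (𝓝 (x t)) := by
  have : Continuous fun s => x t + w t * (s - t) := by fun_prop
  have h2 := (this.tendsto t).mono_left (nhdsWithin_le_nhds (s := Ioi t))
  simp only [sub_self, mul_zero, add_zero] at h2
  exact h2.congr' ((h.right t ht).mono fun s hs => hs.1.symm)

/-- The position relative to the walls, at impacts and between them. -/
theorem IsRightMotion.cases (h : IsRightMotion d ε T x w) {t : ℝ} (ht : t ∈ Icc 0 T) :
    IsBetween d ε x t ∨ x t = 0 ∨ x t = d (ε * t) := by
  rcases (h.confined t ht).1.eq_or_lt with h0 | h0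
  · exact Or.inr (Or.inl h0.symm)
  rcases (h.confined t ht).2.eq_or_lt with h2 | h2
  · exact Or.inr (Or.inr h2)
  · exact Or.inl ⟨h0, h2⟩

theorem IsRightMotion.abs_left_momentum (h : IsRightMotion d ε T x w) {t u : ℝ} (ht : t ∈ Icc 0 T)
    (hu : (IsBetween d ε x t → u = w t) ∧ (x t = 0 → u = -w t) ∧
      (x t = d (ε * t) → u = 2 * (ε * deriv d (ε * t)) - w t)) :
    |d (ε * t) * u - ε * deriv d (ε * t) * x t| = |momentum d ε x w t| := by
  rcases h.cases ht with hb | hb | hb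
  · rw [hu.1 hb, momentum]
  · rw [hu.2.1 hb, momentum, hb, ← abs_neg]
    congr 1
    ring
  · rw [hu.2.2 hb, momentum, hb, ← abs_neg]
    congr 1
    ring

/-- The regularized action is continuous also at impacts, since the momentum only changes its sign
there. -/
theorem IsRightMotion.continuousOn_regAction (hd : ContDiff ℝ ∞ d) (h : IsRightMotion d ε T x w) :
    ContinuousOn (regAction d ε x w) (Icc 0 T) := by
  have hdc := hd.continuous
  have hdc' : Continuous (deriv d) := hd.continuous_deriv (by simp)
  have hcont : ∀ y u t, Continuous fun s =>
      |d (ε * s) * u - ε * deriv d (ε * s) * (y + u * (s - t))| / π := fun y u t => by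
    fun_prop
  refine continuousOn_Icc_of_oneSided (fun t ht => ?_) fun t ht => ?_
  · obtain ⟨u, hu, hu2⟩ := h.left t ht
    have h1 := ((hcont (x t) u t).tendsto t).mono_left (nhdsWithin_le_nhds (s := Iio t))
    simp only [sub_self, mul_zero, add_zero] at h1
    rw [h.abs_left_momentum (Ioc_subset_Icc_self ht) hu2] at h1
    refine h1.congr' (hu.mono fun s hs => ?_)
    rw [regAction, momentum, hs.1, hs.2]
  · have h1 := ((hcont (x t) (w t) t).tendsto t).mono_left (nhdsWithin_le_nhds (s := Ioi t))
    simp only [sub_self, mul_zero, add_zero] at h1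
    refine h1.congr' ((h.right t ht).mono fun s hs => ?_)
    rw [regAction, momentum, hs.1, hs.2]

/-- The motion is fast: the momentum dominates the difference between `d w` and the momentum. -/
def IsFast (d : ℝ → ℝ) (ε T : ℝ) (x w : ℝ → ℝ) : Prop :=
  ∀ t ∈ Icc 0 T, |ε * deriv d (ε * t) * x t| < |momentum d ε x w t|

/-- For a fast motion the momentum has the sign of the velocity. -/
theorem abs_momentum_of_pos (hpos : ∀ τ, 0 < d τ) {t : ℝ}
    (hf : |ε * deriv d (ε * t) * x t| < |momentum d ε x w t|) (hw : 0 < w t) :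
    |momentum d ε x w t| = momentum d ε x w t := by
  refine abs_of_nonneg (not_lt.1 fun hn => ?_)
  rw [abs_of_neg hn] at hf
  have h1 := neg_abs_le (ε * deriv d (ε * t) * x t)
  have h2 := le_abs_self (ε * deriv d (ε * t) * x t)
  have h3 := mul_pos (hpos (ε * t)) hw
  simp only [momentum] at hf hn
  linarith

theorem abs_momentum_of_nonpos (hpos : ∀ τ, 0 < d τ) {t : ℝ}
    (hf : |ε * deriv d (ε * t) * x t| < |momentum d ε x w t|) (hw : w t ≤ 0) :
    |momentum d ε x w t| = -momentum d ε x w t ∧ w t < 0 := by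
  have h1 := neg_abs_le (ε * deriv d (ε * t) * x t)
  have h2 := le_abs_self (ε * deriv d (ε * t) * x t)
  have h3 := mul_nonneg (hpos (ε * t)).le (neg_nonneg.2 hw)
  have h4 : momentum d ε x w t ≤ 0 := by
    refine not_lt.1 fun hn => ?_
    rw [abs_of_pos hn] at hf
    simp only [momentum] at hf hn
    linarith
  refine ⟨abs_of_nonpos h4, lt_of_le_of_ne hw fun h0 => ?_⟩
  rw [momentum, h0, mul_zero, zero_sub, abs_neg] at hf
  exact lt_irrefl _ hf

theorem direction_mul_momentum (hpos : ∀ τ, 0 < d τ) {t : ℝ}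
    (hf : |ε * deriv d (ε * t) * x t| < |momentum d ε x w t|) :
    direction w t * momentum d ε x w t = |momentum d ε x w t| ∧
      direction w t * w t = |w t| := by
  rcases lt_or_ge 0 (w t) with h | h
  · rw [abs_momentum_of_pos hpos hf h, abs_of_pos h]
    simp [direction, h]
  · rw [(abs_momentum_of_nonpos hpos hf h).1, abs_of_nonpos h]
    simp [direction, h.not_gt]

/-- A fast particle leaves the fixed wall with a positive velocity. -/
theorem IsRightMotion.pos_of_fixed (hpos : ∀ τ, 0 < d τ) (h : IsRightMotion d ε T x w)
    (hf : IsFast d ε T x w) {t : ℝ} (ht : t ∈ Ioc 0 T) (h0 : x t = 0) : 0 < w t := by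
  obtain ⟨u, hu, -, hu2, -⟩ := h.left t ht
  obtain ⟨s, hs, hs2⟩ := (hu.and (Ioo_mem_nhdsLT ht.1)).exists
  have h1 := (h.confined s ⟨hs2.1.le, hs2.2.le.trans ht.2⟩).1
  rw [hs.1, h0, hu2 h0] at h1
  by_contra hn
  have h2 := (abs_momentum_of_nonpos hpos (hf t (Ioc_subset_Icc_self ht)) (not_lt.1 hn)).2
  nlinarith [hs2.2]

theorem hasDerivAt_dist (hd : ContDiff ℝ ∞ d) (ε t : ℝ) :
    HasDerivAt (fun s => d (ε * s)) (ε * deriv d (ε * t)) t := by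
  have h1 : HasDerivAt (fun s => ε * s) ε t := by simpa using (hasDerivAt_id t).const_mul ε
  have h2 := ((hd.differentiable (by simp)) (ε * t)).hasDerivAt
  exact (h2.comp t h1).congr_deriv (mul_comm _ _)

/-- A fast particle leaves the moving wall to the left. -/
theorem IsRightMotion.neg_of_moving (hd : ContDiff ℝ ∞ d) (hpos : ∀ τ, 0 < d τ)
    (h : IsRightMotion d ε T x w) (hf : IsFast d ε T x w) {t : ℝ} (ht : t ∈ Ioc 0 T)
    (h0 : x t = d (ε * t)) : w t < 0 := by
  obtain ⟨u, hu, -, -, hu2⟩ := h.left t ht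
  have h1 := (hasDerivWithinAt_iff_tendsto_slope' (notMem_Iio.2 le_rfl)).1
    ((hasDerivAt_dist hd ε t).hasDerivWithinAt (s := Iio t))
  -- before the impact the particle cannot be behind the wall
  have h2 : ε * deriv d (ε * t) ≤ u := by
    refine le_of_tendsto h1 ?_
    filter_upwards [hu, Ioo_mem_nhdsLT ht.1] with s hs hs2
    have h3 := (h.confined s ⟨hs2.1.le, hs2.2.le.trans ht.2⟩).2
    rw [hs.1, h0] at h3
    rw [slope_def_field, div_le_iff_of_neg (by linarith [hs2.2])]
    linarith
  by_contra hn
  have hft := hf t (Ioc_subset_Icc_self ht)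
  rw [hu2 h0] at h2
  rcases (not_lt.1 hn).eq_or_lt with h4 | h4
  · exact hn (abs_momentum_of_nonpos hpos hft h4.symm.le).2
  · have h5 := abs_momentum_of_pos hpos hft h4
    have h6 := (abs_nonneg _).trans_lt hft
    rw [h5, momentum, h0] at h6
    have := hpos (ε * t)
    nlinarith

/-- The representative of the phase in `[-π, π)`. -/
theorem IsRightMotion.direction_mul_mem (hd : ContDiff ℝ ∞ d) (hpos : ∀ τ, 0 < d τ)
    (h : IsRightMotion d ε T x w) (hf : IsFast d ε T x w) (h0 : IsBetween d ε x 0) {t : ℝ}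
    (ht : t ∈ Icc 0 T) : direction w t * (π * (x t / d (ε * t))) ∈ Ico (-π) π := by
  have hdp := hpos (ε * t)
  have hpi := pi_pos
  have h1 : 0 ≤ x t / d (ε * t) := div_nonneg (h.confined t ht).1 hdp.le
  have h2 : x t / d (ε * t) ≤ 1 := (div_le_one hdp).2 (h.confined t ht).2
  by_cases hw : 0 < w t
  · simp only [direction, hw, if_true, one_mul]
    refine ⟨by nlinarith, ?_⟩
    have h3 : x t / d (ε * t) < 1 := by
      rw [div_lt_one hdp]
      refine lt_of_le_of_ne (h.confined t ht).2 fun h4 => ?_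
      rcases ht.1.eq_or_lt with h5 | h5
      · rw [← h5] at h4
        exact h0.2.ne h4
      · exact (h.neg_of_moving hd hpos hf ⟨h5, ht.2⟩ h4).not_gt hw
    nlinarith
  · simp only [direction, hw, if_false]
    constructor <;> nlinarith

theorem hasDerivAt_deriv_dist (hd : ContDiff ℝ ∞ d) (ε t : ℝ) :
    HasDerivAt (fun s => deriv d (ε * s)) (ε * iteratedDeriv 2 d (ε * t)) t := by
  have h1 : HasDerivAt (fun s => ε * s) ε t := by simpa using (hasDerivAt_id t).const_mul ε
  have h2 : HasDerivAt (deriv d) (iteratedDeriv 2 d (ε * t)) (ε * t) := by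
    rw [iteratedDeriv_succ, iteratedDeriv_one]
    have h3 := hd.differentiable_iteratedDeriv 1 (by exact_mod_cast WithTop.coe_lt_top _)
    rw [iteratedDeriv_one] at h3
    exact (h3 (ε * t)).hasDerivAt
  exact (h2.comp t h1).congr_deriv (mul_comm _ _)

theorem IsRightMotion.hasDerivWithinAt_pos (h : IsRightMotion d ε T x w) {t : ℝ}
    (ht : t ∈ Ico 0 T) : HasDerivWithinAt x (w t) (Ici t) t := by
  have h1 : HasDerivWithinAt (fun s => x t + w t * (s - t)) (w t) (Ici t) t := by
    simpa using (((hasDerivWithinAt_id t (Ici t)).sub_const t).const_mul (w t)).const_add (x t)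
  refine h1.congr_of_eventuallyEq ?_ (by simp)
  rw [EventuallyEq, ← Ioi_insert, nhdsWithin_insert, eventually_sup]
  exact ⟨by simp, (h.right t ht).mono fun s hs => hs.1⟩

theorem IsRightMotion.eventually_eq_right (h : IsRightMotion d ε T x w) {t : ℝ}
    (ht : t ∈ Ico 0 T) : ∀ᶠ s in 𝓝[≥] t, w s = w t := by
  rw [← Ioi_insert, nhdsWithin_insert, eventually_sup]
  exact ⟨by simp, (h.right t ht).mono fun s hs => hs.2⟩

/-- The equation of the phase. -/
theorem IsRightMotion.hasDerivWithinAt_angle (hd : ContDiff ℝ ∞ d) (hpos : ∀ τ, 0 < d τ)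
    (h : IsRightMotion d ε T x w) (hf : IsFast d ε T x w) {t : ℝ} (ht : t ∈ Ico 0 T) :
    HasDerivWithinAt (fun s => direction w s * (π * (x s / d (ε * s))))
      (π ^ 2 * regAction d ε x w t / d (ε * t) ^ 2) (Ici t) t := by
  have h1 := (((h.hasDerivWithinAt_pos ht).fun_div (hasDerivAt_dist hd ε t).hasDerivWithinAt
    (hpos _).ne').const_mul π).const_mul (direction w t)
  refine (h1.congr_of_eventuallyEq ?_ rfl).congr_deriv ?_
  · filter_upwards [h.eventually_eq_right ht] with s hs
    simp only [direction, hs]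
  · have h2 := (direction_mul_momentum hpos (hf t (Ico_subset_Icc_self ht))).1
    have := (hpos (ε * t)).ne'
    have := pi_pos.ne'
    rw [regAction, ← h2, momentum]
    field_simp

/-- The equation of the regularized action. -/
theorem IsRightMotion.hasDerivWithinAt_regAction (hd : ContDiff ℝ ∞ d) (hpos : ∀ τ, 0 < d τ)
    (h : IsRightMotion d ε T x w) (hf : IsFast d ε T x w) {t : ℝ} (ht : t ∈ Ico 0 T) :
    HasDerivWithinAt (regAction d ε x w)
      (-(ε ^ 2 * d (ε * t) * iteratedDeriv 2 d (ε * t) / π ^ 2 *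
        (direction w t * (π * (x t / d (ε * t)))))) (Ici t) t := by
  have h1 := ((((hasDerivAt_dist hd ε t).hasDerivWithinAt (s := Ici t)).mul_const (w t)).fun_sub
    ((((hasDerivAt_deriv_dist hd ε t).hasDerivWithinAt (s := Ici t)).const_mul ε).fun_mul
      (h.hasDerivWithinAt_pos ht))).const_mul (direction w t / π)
  have hev : ∀ᶠ s in 𝓝[≥] t, s ∈ Icc 0 T :=
    mem_of_superset (Icc_mem_nhdsGE ht.2) fun s hs => ⟨ht.1.trans hs.1, hs.2⟩
  refine (h1.congr_of_eventuallyEq_of_mem ?_ self_mem_Ici).congr_deriv ?_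
  · filter_upwards [h.eventually_eq_right ht, hev] with s hs hs2
    have h2 := (direction_mul_momentum hpos (hf s hs2)).1
    rw [regAction, ← h2, momentum]
    simp only [direction, hs]
    ring
  · have := (hpos (ε * t)).ne'
    have := pi_pos.ne'
    field_simp
    ring

/-- At an impact, where `y` is `0` or `1`, both directions give the same point of the circle. -/
theorem exp_eq_of_direction {y σ σ' : ℝ} (hσ : σ = 1 ∨ σ = -1) (hσ' : σ' = 1 ∨ σ' = -1)
    (h : σ = σ' ∨ y = 0 ∨ y = 1) :
    Complex.exp ((σ * (π * y) : ℝ) * Complex.I) = Complex.exp ((σ' * (π * y) : ℝ) * Complex.I) := by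
  rcases h with rfl | rfl | rfl
  · rfl
  · simp
  · rcases hσ with rfl | rfl <;> rcases hσ' with rfl | rfl <;>
      simp [Complex.exp_neg, Complex.exp_pi_mul_I]

theorem direction_eq (w : ℝ → ℝ) (t : ℝ) : direction w t = 1 ∨ direction w t = -1 := by
  by_cases h : 0 < w t <;> simp [direction, h]

theorem IsRightMotion.continuousOn_circlePhase (hd : ContDiff ℝ ∞ d) (hpos : ∀ τ, 0 < d τ)
    (h : IsRightMotion d ε T x w) :
    ContinuousOn (circlePhase d ε x w) (Icc 0 T) := by
  have key : ∀ (t σ : ℝ) (l : Filter ℝ), l ≤ 𝓝 t → Tendsto x l (𝓝 (x t)) →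
      Tendsto (fun s => Complex.exp ((σ * (π * (x s / d (ε * s))) : ℝ) * Complex.I)) l
        (𝓝 (Complex.exp ((σ * (π * (x t / d (ε * t))) : ℝ) * Complex.I))) :=
    fun t σ l hl hx => by
      have hdc := hd.continuous
      have h1 : Tendsto (fun s => d (ε * s)) l (𝓝 (d (ε * t))) :=
        ((by fun_prop : Continuous fun s => d (ε * s)).tendsto t).mono_left hl
      have h2 : Continuous fun y : ℝ => Complex.exp ((σ * (π * y) : ℝ) * Complex.I) := by fun_prop
      exact (h2.tendsto _).comp (hx.div h1 (hpos _).ne')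
  refine continuousOn_Icc_of_oneSided (fun t ht => ?_) fun t ht => ?_
  · obtain ⟨u, hu, hu2⟩ := h.left t ht
    have h1 := key t (if 0 < u then 1 else -1) _ nhdsWithin_le_nhds (h.tendsto_left ht)
    have h2 : Complex.exp (((if 0 < u then 1 else -1) * (π * (x t / d (ε * t))) : ℝ) * Complex.I)
        = circlePhase d ε x w t := by
      refine exp_eq_of_direction (by split_ifs <;> simp) (direction_eq w t) ?_
      rcases h.cases (Ioc_subset_Icc_self ht) with hb | hb | hb
      · left
        rw [hu2.1 hb, direction]
      · right; left
        rw [hb, zero_div]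
      · right; right
        rw [hb, div_self (hpos _).ne']
    rw [h2] at h1
    refine h1.congr' (hu.mono fun s hs => ?_)
    rw [circlePhase, direction, hs.2]
  · have h1 := key t (direction w t) _ nhdsWithin_le_nhds (h.tendsto_right ht)
    refine h1.congr' ((h.right t ht).mono fun s hs => ?_)
    simp only [circlePhase, direction, hs.2]

theorem sawtooth_eq_of_exp_eq {φ θ : ℝ} (hθ : θ ∈ Ico (-π) π)
    (h : Complex.exp (φ * Complex.I) = Complex.exp (θ * Complex.I)) : sawtooth φ = θ := by
  obtain ⟨n, hn⟩ := Complex.exp_eq_exp_iff_exists_int.1 h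
  refine sawtooth_eq_iff.2 ⟨hθ, n, ?_⟩
  have h1 : (φ : ℂ) * Complex.I = ((θ + n * (2 * π) : ℝ) : ℂ) * Complex.I := by
    rw [hn]
    push_cast
    ring
  exact_mod_cast mul_right_cancel₀ Complex.I_ne_zero h1

/-- A fast motion has a lift, obtained by integrating the equation of the phase. -/
theorem IsRightMotion.exists_isLift (hd : ContDiff ℝ ∞ d) (hpos : ∀ τ, 0 < d τ)
    (h : IsRightMotion d ε T x w) (hf : IsFast d ε T x w) (h0 : IsBetween d ε x 0) (hT : 0 ≤ T) :
    ∃ φ, IsLift d ε T φ (regAction d ε x w) ∧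
      ∀ t ∈ Icc 0 T, Complex.exp (φ t * Complex.I) = circlePhase d ε x w t := by
  have hPc := h.continuousOn_regAction hd
  have hdc := hd.continuous
  have hgc : ContinuousOn (fun t => π ^ 2 * regAction d ε x w t / d (ε * t) ^ 2) (Icc 0 T) := by
    refine (continuousOn_const.mul hPc).div
      (by fun_prop : Continuous fun t => d (ε * t) ^ 2).continuousOn fun t _ => ?_
    exact pow_ne_zero 2 (hpos _).ne'
  set g : ℝ → ℝ := IccExtend hT
    ((Icc 0 T).domRestrict fun t => π ^ 2 * regAction d ε x w t / d (ε * t) ^ 2) with hg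
  have hgcont : Continuous g := (continuousOn_iff_continuous_domRestrict.1 hgc).Icc_extend'
  have hgeq : ∀ t ∈ Icc 0 T, g t = π ^ 2 * regAction d ε x w t / d (ε * t) ^ 2 := fun t ht => by
    rw [hg, IccExtend_of_mem _ _ ht, domRestrict_apply]
  set φ : ℝ → ℝ := fun t => direction w 0 * (π * (x 0 / d (ε * 0))) + ∫ s in (0 : ℝ)..t, g s
    with hφ
  have hφd : ∀ t, HasDerivAt φ (g t) t := fun t =>
    (intervalIntegral.integral_hasDerivAt_right (hgcont.intervalIntegrable _ _)
      (hgcont.stronglyMeasurableAtFilter _ _) hgcont.continuousAt).const_add _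
  have hφc : Continuous φ := continuous_iff_continuousAt.2 fun t => (hφd t).continuousAt
  have hexp : ∀ t ∈ Icc 0 T, Complex.exp (φ t * Complex.I) = circlePhase d ε x w t := by
    -- the quotient of the two sides has zero derivative
    have h1 := constant_of_has_deriv_right_zero
      (f := fun t => circlePhase d ε x w t * Complex.exp (-(φ t * Complex.I))) (a := 0) (b := T)
      ((h.continuousOn_circlePhase hd hpos).mul
        (by fun_prop : Continuous fun t => Complex.exp (-((φ t : ℂ) * Complex.I))).continuousOn)
      (fun t ht => by
        have e1 := ((h.hasDerivWithinAt_angle hd hpos hf ht).ofReal_comp.mul_const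
          Complex.I).cexp
        have e2 := (((hφd t).hasDerivWithinAt (s := Ici t)).ofReal_comp.mul_const
          Complex.I).fun_neg.cexp
        refine (e1.fun_mul e2).congr_deriv ?_
        rw [hgeq t (Ico_subset_Icc_self ht)]
        ring)
    intro t ht
    have h2 := h1 t ht
    have h3 : φ 0 = direction w 0 * (π * (x 0 / d (ε * 0))) := by simp [hφ]
    simp only [circlePhase, h3] at h2 ⊢
    rw [← Complex.exp_add, ← Complex.exp_add, add_neg_cancel, Complex.exp_zero,
      Complex.exp_add, Complex.exp_neg] at h2
    have h4 := Complex.exp_ne_zero (φ t * Complex.I)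
    exact ((mul_inv_eq_one₀ h4).1 h2).symm
  have hsaw : ∀ t ∈ Icc 0 T, sawtooth (φ t) = direction w t * (π * (x t / d (ε * t))) :=
    fun t ht => sawtooth_eq_of_exp_eq (h.direction_mul_mem hd hpos hf h0 ht) (hexp t ht)
  refine ⟨φ, ⟨hφc.continuousOn, hPc, fun t ht => ?_, fun t ht => ?_, fun t ht => ?_⟩, hexp⟩
  · exact div_pos ((abs_nonneg _).trans_lt (hf t ht)) pi_pos
  · exact (hφd t).hasDerivWithinAt.congr_deriv (hgeq t (Ico_subset_Icc_self ht))
  · rw [hsaw t (Ico_subset_Icc_self ht)]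
    exact h.hasDerivWithinAt_regAction hd hpos hf ht

/-- The action of the lift is the action of the motion. -/
theorem IsRightMotion.liftAction_eq (hd : ContDiff ℝ ∞ d) (hpos : ∀ τ, 0 < d τ)
    (h : IsRightMotion d ε T x w) (hf : IsFast d ε T x w) (h0 : IsBetween d ε x 0) {φ : ℝ → ℝ}
    {t : ℝ} (ht : t ∈ Icc 0 T) (hφ : Complex.exp (φ t * Complex.I) = circlePhase d ε x w t) :
    liftAction d ε φ (regAction d ε x w) t = |w t| * d (ε * t) / π := by
  have hsaw : sawtooth (φ t) = direction w t * (π * (x t / d (ε * t))) :=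
    sawtooth_eq_of_exp_eq (h.direction_mul_mem hd hpos hf h0 ht) hφ
  obtain ⟨h1, h2⟩ := direction_mul_momentum hpos (hf t ht)
  rw [liftAction, hsaw, regAction, ← h1, ← h2, momentum]
  have := (hpos (ε * t)).ne'
  have := pi_pos.ne'
  field_simp
  ring

/-- Just before an impact the particle is between the walls. -/
theorem IsRightMotion.eventually_isBetween (hd : ContDiff ℝ ∞ d) (hpos : ∀ τ, 0 < d τ)
    (h : IsRightMotion d ε T x w) (hf : IsFast d ε T x w) {t : ℝ} (ht : t ∈ Ioc 0 T)
    (hb : ¬ IsBetween d ε x t) : ∀ᶠ s in 𝓝[<] t, IsBetween d ε x s := by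
  obtain ⟨u, hu, hu1, hu2, hu3⟩ := h.left t ht
  have hx := h.tendsto_left ht
  have htI := Ioc_subset_Icc_self ht
  have hdt : Tendsto (fun s => d (ε * s)) (𝓝[<] t) (𝓝 (d (ε * t))) := by
    have hdc := hd.continuous
    exact ((by fun_prop : Continuous fun s => d (ε * s)).tendsto t).mono_left nhdsWithin_le_nhds
  rcases (h.cases htI).resolve_left hb with h0 | h0
  · have hw := h.pos_of_fixed hpos hf ht h0
    rw [h0] at hx
    filter_upwards [hu, Ioo_mem_nhdsLT ht.1, hx.eventually_lt hdt (hpos _)] with s hs hs2 hs3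
    have hsI : s ∈ Ioc 0 T := ⟨hs2.1, hs2.2.le.trans ht.2⟩
    refine ⟨lt_of_le_of_ne (h.confined s (Ioc_subset_Icc_self hsI)).1 fun h3 => ?_, hs3⟩
    have := h.pos_of_fixed hpos hf hsI h3.symm
    rw [hs.2, hu2 h0] at this
    linarith
  · have hw := h.neg_of_moving hd hpos hf ht h0
    have hft := hf t htI
    have hdp := hpos (ε * t)
    have h5 := (abs_momentum_of_nonpos hpos hft hw.le).1
    have hu0 : 0 < u := by
      have h1 := neg_abs_le (ε * deriv d (ε * t) * x t)
      rw [h5, momentum] at hft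
      rw [h0] at hft h1
      have h6 : 0 < d (ε * t) * u := by
        rw [hu3 h0]
        linarith
      exact (pos_iff_pos_of_mul_pos h6).1 hdp
    have hx0 : ∀ᶠ s in 𝓝[<] t, 0 < x s := hx.eventually (lt_mem_nhds (by rw [h0]; exact hdp))
    filter_upwards [hu, Ioo_mem_nhdsLT ht.1, hx0] with s hs hs2 hs3
    have hsI : s ∈ Ioc 0 T := ⟨hs2.1, hs2.2.le.trans ht.2⟩
    refine ⟨hs3, lt_of_le_of_ne (h.confined s (Ioc_subset_Icc_self hsI)).2 fun h3 => ?_⟩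
    have := h.neg_of_moving hd hpos hf hsI h3
    rw [hs.2] at this
    linarith

/-- A phase along a fast motion is a lift of the phase modulo `2 π`. -/
theorem IsRightMotion.exp_phase (hd : ContDiff ℝ ∞ d) (hpos : ∀ τ, 0 < d τ)
    (h : IsRightMotion d ε T x w) (hf : IsFast d ε T x w) (h0 : IsBetween d ε x 0) {v φ : ℝ → ℝ}
    (hv : ∀ t ∈ Icc 0 T, IsBetween d ε x t → w t = v t) (hφ : IsPhase d ε T x v φ) {t : ℝ}
    (ht : t ∈ Icc 0 T) : Complex.exp (φ t * Complex.I) = circlePhase d ε x w t := by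
  have key : ∀ t ∈ Icc 0 T, IsBetween d ε x t →
      Complex.exp (φ t * Complex.I) = circlePhase d ε x w t := fun t ht hb => by
    rw [circlePhase, Complex.exp_eq_exp_iff_exists_int]
    by_cases hw : 0 < w t
    · obtain ⟨n, hn⟩ := hφ.right t ht hb (by rwa [← hv t ht hb])
      refine ⟨n, ?_⟩
      rw [hn]
      simp only [direction, hw, if_true]
      push_cast
      ring
    · have hw2 := (abs_momentum_of_nonpos hpos (hf t ht) (not_lt.1 hw)).2
      obtain ⟨n, hn⟩ := hφ.left t ht hb (by rwa [← hv t ht hb])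
      refine ⟨n + 1, ?_⟩
      rw [hn]
      simp only [direction, hw, if_false]
      push_cast
      ring
  by_cases hb : IsBetween d ε x t
  · exact key t ht hb
  have ht0 : 0 < t := lt_of_le_of_ne ht.1 fun h1 => hb (h1 ▸ h0)
  have hle : 𝓝[<] t ≤ 𝓝[Icc 0 T] t := nhdsWithin_le_of_mem
    (mem_of_superset (Ico_mem_nhdsLT ht0) fun s hs => ⟨hs.1, hs.2.le.trans ht.2⟩)
  have h1 : Tendsto (fun s => Complex.exp (φ s * Complex.I)) (𝓝[<] t)
      (𝓝 (Complex.exp (φ t * Complex.I))) := by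
    have h2 : Continuous fun y : ℝ => Complex.exp (y * Complex.I) := by fun_prop
    exact (h2.tendsto _).comp ((hφ.continuousOn t ht).mono_left hle)
  have h3 := ((h.continuousOn_circlePhase hd hpos) t ht).mono_left hle
  refine tendsto_nhds_unique (h1.congr' ?_) h3
  filter_upwards [h.eventually_isBetween hd hpos hf ⟨ht0, ht.2⟩ hb, Ioo_mem_nhdsLT ht0] with s hs hs2
  exact key s ⟨hs2.1.le, hs2.2.le.trans ht.2⟩ hs

/-- Two continuous lifts of the same function to the circle differ by a multiple of `2 π`. -/
theorem exists_int_of_exp_eq {φ φ' : ℝ → ℝ} (hφ : ContinuousOn φ (Icc 0 T))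
    (hφ' : ContinuousOn φ' (Icc 0 T))
    (h : ∀ t ∈ Icc 0 T, Complex.exp (φ t * Complex.I) = Complex.exp (φ' t * Complex.I)) :
    ∃ n : ℤ, ∀ t ∈ Icc 0 T, φ t = φ' t + n * (2 * π) := by
  have hpi := pi_pos
  have h1 : ∀ t ∈ Icc 0 T, ∃ n : ℤ, (φ t - φ' t) / (2 * π) = n := fun t ht => by
    obtain ⟨n, hn⟩ := Complex.exp_eq_exp_iff_exists_int.1 (h t ht)
    refine ⟨n, ?_⟩
    have h2 : (φ t : ℂ) * Complex.I = ((φ' t + n * (2 * π) : ℝ) : ℂ) * Complex.I := by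
      rw [hn]
      push_cast
      ring
    have h3 : φ t = φ' t + n * (2 * π) := by
      exact_mod_cast mul_right_cancel₀ Complex.I_ne_zero h2
    rw [h3]
    field_simp
    ring
  have hc : ContinuousOn (fun t => (φ t - φ' t) / (2 * π)) (Icc 0 T) := (hφ.sub hφ').div_const _
  rcases lt_or_ge T 0 with hT | hT
  · exact ⟨0, fun t ht => absurd (ht.1.trans ht.2) (not_le.2 hT)⟩
  have h0 : (0 : ℝ) ∈ Icc 0 T := ⟨le_rfl, hT⟩
  obtain ⟨n, hn⟩ := h1 0 h0
  refine ⟨n, fun t ht => ?_⟩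
  have hconst : (φ t - φ' t) / (2 * π) = (φ 0 - φ' 0) / (2 * π) := by
    have hd : IsDiscrete (range ((↑) : ℤ → ℝ)) := by
      rw [← image_univ]
      exact IsDiscrete.univ.image Int.isClosedEmbedding_coe_real.isEmbedding.isInducing
    exact isPreconnected_Icc.constant_of_mapsTo hd hc
      (fun s hs => by
        obtain ⟨m, hm⟩ := h1 s hs
        exact ⟨m, hm.symm⟩) ht h0
  rw [hn, div_eq_iff (by positivity)] at hconst
  linarith

/-- The equations of the lift are invariant under translations of the phase by multiples of
`2 π`. -/
theorem IsLift.congr {φ φ' P : ℝ → ℝ} (h : IsLift d ε T φ' P) {n : ℤ}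
    (hφ : ∀ t ∈ Icc 0 T, φ t = φ' t + n * (2 * π)) : IsLift d ε T φ P where
  continuousOn_φ := (h.continuousOn_φ.add continuousOn_const).congr hφ
  continuousOn_P := h.continuousOn_P
  pos := h.pos
  deriv_φ t ht := by
    refine ((h.deriv_φ t ht).add_const (n * (2 * π))).congr_of_eventuallyEq ?_
      (hφ t (Ico_subset_Icc_self ht))
    filter_upwards [Icc_mem_nhdsGE ht.2] with s hs using hφ s ⟨ht.1.trans hs.1, hs.2⟩
  deriv_P t ht := by
    have : sawtooth (φ t) = sawtooth (φ' t) := by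
      rw [hφ t (Ico_subset_Icc_self ht)]
      exact sawtooth_periodic.int_mul n _
    rw [this]
    exact h.deriv_P t ht

end rightMotion
end FermiUlam

namespace FermiUlam
open SymPoly

/-! ### From the lift back to the motion -/

/-- Continuous induction: a lower bound that improves itself persists. -/
theorem lt_of_forall_le_imp_lt {f : ℝ → ℝ} {m T : ℝ} (hf : ContinuousOn f (Icc 0 T)) (h0 : m < f 0)
    (h : ∀ t ∈ Icc 0 T, (∀ s ∈ Icc 0 t, m ≤ f s) → m < f t) : ∀ t ∈ Icc 0 T, m < f t := by
  intro t ht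
  by_contra hn
  have hc : IsCompact (Icc 0 T ∩ f ⁻¹' Iic m) :=
    isCompact_Icc.of_isClosed_subset (hf.preimage_isClosed_of_isClosed isClosed_Icc isClosed_Iic)
      inter_subset_left
  obtain ⟨t₀, ht₀, hmin⟩ := hc.exists_isLeast ⟨t, ht, not_lt.1 hn⟩
  have h1 : ∀ s ∈ Icc 0 t₀, f s ≤ m → s = t₀ := fun s hs hsm =>
    le_antisymm hs.2 (hmin ⟨⟨hs.1, hs.2.trans ht₀.1.2⟩, hsm⟩)
  obtain ⟨s, hs, hsm⟩ := intermediate_value_Icc' ht₀.1.1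
    (hf.mono (Icc_subset_Icc_right ht₀.1.2)) ⟨ht₀.2, h0.le⟩
  rw [h1 s hs hsm.le] at hsm
  refine (h t₀ ht₀.1 fun s' hs' => ?_).ne' hsm
  by_contra hlt
  have := h1 s' hs' (not_le.1 hlt).le
  rw [this, hsm] at hlt
  exact hlt le_rfl

section motion
variable {d : ℝ → ℝ} {c : ℝ} {U : Set ℝ}

/-- A motion remains fast. The bound for the action of the lift holds as long as the motion is fast,
and it implies that the regularized action stays away from the value at which this could fail. -/
theorem exists_isFast (hd : ContDiff ℝ ∞ d) (hc : 0 < c) (hcd : ∀ τ, c ≤ d τ)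
    (hU : ∀ n : ℕ, ∃ M : ℝ, ∀ τ ∈ U, |iteratedDeriv n d τ| ≤ M) (h0U : (0 : ℝ) ∈ U) (k : ℕ)
    {a b L : ℝ} (ha : 0 < a) (hab : a ≤ b) (hL : 0 < L) :
    ∃ ε₀ > 0, ∀ ε T : ℝ, 0 < ε → ε < ε₀ → 0 ≤ T → T ≤ L / ε ^ k → (∀ t ∈ Icc 0 T, ε * t ∈ U) →
      ∀ x w, IsRightMotion d ε T x w → IsBetween d ε x 0 → |w 0| * d (ε * 0) / π ∈ Icc a b →
      IsFast d ε T x w := by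
  have hpos : ∀ τ, 0 < d τ := fun τ => hc.trans_le (hcd τ)
  obtain ⟨C, hC, ε₁, hε₁, hreg⟩ := exists_bound_regularized hd hc hcd hU h0U k ha hab hL
  obtain ⟨M, hM, hMb⟩ := exists_bound_ev hc hcd hU ha (β := b) (Dn 0 * Dn 1)
  refine ⟨min ε₁ (min 1 (a / (4 * (C + M)))), by positivity,
    fun ε T hε hε' hT hTL hτ x w h h0 hI => ?_⟩
  obtain ⟨hε1, hε23⟩ := lt_min_iff.1 hε'
  obtain ⟨hε2, hε3⟩ := lt_min_iff.1 hε23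
  rw [lt_div_iff₀ (by positivity)] at hε3
  have hCε : 0 < C * ε := mul_pos hC hε
  have hMε : 0 < ε * M := mul_pos hε hM
  have hpi := pi_gt_three
  have hoff : ∀ t ∈ Icc 0 T, |ε * deriv d (ε * t) * x t| ≤ ε * M := fun t ht => by
    have h1 := hMb ε ⟨hε.le, hε2.le⟩ a ⟨le_rfl, hab⟩ _ (hτ t ht) 0 ⟨by linarith, by linarith⟩
    simp only [map_mul, ev_Dn, iteratedDeriv_zero, iteratedDeriv_one, abs_mul,
      abs_of_pos (hpos (ε * t))] at h1
    obtain ⟨h2, h3⟩ := h.confined t ht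
    rw [abs_mul, abs_mul, abs_of_pos hε, abs_of_nonneg h2, mul_assoc]
    refine mul_le_mul_of_nonneg_left (le_trans ?_ h1) hε.le
    rw [mul_comm]
    exact mul_le_mul_of_nonneg_right h3 (abs_nonneg _)
  have hfast : ∀ t ∈ Icc 0 T, a / 2 ≤ regAction d ε x w t →
      |ε * deriv d (ε * t) * x t| < |momentum d ε x w t| := fun t ht h1 => by
    rw [regAction, le_div_iff₀ pi_pos] at h1
    have := hoff t ht
    nlinarith
  have hstart : a / 2 < regAction d ε x w 0 := by
    have h1 := hoff 0 ⟨le_rfl, hT⟩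
    have h2 := hI.1
    have h3 := abs_sub_abs_le_abs_sub (d (ε * 0) * w 0) (ε * deriv d (ε * 0) * x 0)
    rw [abs_mul, abs_of_pos (hpos (ε * 0))] at h3
    rw [le_div_iff₀ pi_pos] at h2
    rw [regAction, lt_div_iff₀ pi_pos, momentum]
    nlinarith
  have hall := lt_of_forall_le_imp_lt (h.continuousOn_regAction hd) hstart fun t ht hle => by
    have hm := h.mono ht.2
    have hf : IsFast d ε t x w := fun s hs => hfast s ⟨hs.1, hs.2.trans ht.2⟩ (hle s hs)
    obtain ⟨φ, hφ, hexp⟩ := hm.exists_isLift hd hpos hf h0 ht.1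
    have h0t : (0 : ℝ) ∈ Icc 0 t := ⟨le_rfl, ht.1⟩
    have hA := hm.liftAction_eq hd hpos hf h0 h0t (hexp 0 h0t)
    have h1 := (hreg ε t hε hε1 (ht.2.trans hTL) (fun s hs => hτ s ⟨hs.1, hs.2.trans ht.2⟩) φ _ hφ
      (by rw [hA]; exact hI) t ⟨ht.1, le_rfl⟩).2
    rw [hA] at h1
    have h2 := (abs_le.1 h1).1
    have h3 := hI.1
    linarith
  exact fun t ht => hfast t ht (hall t ht).le

/-- A motion has a lift with the same action, and each of its phases is the phase of such a lift. -/
theorem exists_lift_of_isMotion (hd : ContDiff ℝ ∞ d) (hc : 0 < c) (hcd : ∀ τ, c ≤ d τ)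
    (hU : ∀ n : ℕ, ∃ M : ℝ, ∀ τ ∈ U, |iteratedDeriv n d τ| ≤ M) (h0U : (0 : ℝ) ∈ U) (k : ℕ)
    {a b L : ℝ} (ha : 0 < a) (hab : a ≤ b) (hL : 0 < L) :
    ∃ ε₀ > 0, ∀ ε T : ℝ, 0 < ε → ε < ε₀ → 0 ≤ T → T ≤ L / ε ^ k → (∀ t ∈ Icc 0 T, ε * t ∈ U) →
      ∀ x v, IsMotion d ε T x v → IsBetween d ε x 0 → action d ε v 0 ∈ Icc a b →
      ∃ φ P, (IsLift d ε T φ P ∧ ∀ t ∈ Icc 0 T, IsBetween d ε x t →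
          liftAction d ε φ P t = action d ε v t) ∧
        ∀ φ', IsPhase d ε T x v φ' → IsLift d ε T φ' P ∧ ∀ t ∈ Icc 0 T, IsBetween d ε x t →
          liftAction d ε φ' P t = action d ε v t ∧ ¬ IsOddPi (φ' t) := by
  have hpos : ∀ τ, 0 < d τ := fun τ => hc.trans_le (hcd τ)
  obtain ⟨ε₀, hε₀, hfast⟩ := exists_isFast hd hc hcd hU h0U k ha hab hL
  refine ⟨ε₀, hε₀, fun ε T hε hε' hT hTL hτ x v hm h0 hI => ?_⟩
  obtain ⟨w, h, hw⟩ := hm.exists_isRightMotion hpos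
  have hf : IsFast d ε T x w := hfast ε T hε hε' hT hTL hτ x w h h0 (by
    rw [hw 0 ⟨le_rfl, hT⟩ h0]
    exact hI)
  obtain ⟨φ, hφ, hexp⟩ := h.exists_isLift hd hpos hf h0 hT
  have hact : ∀ φ' : ℝ → ℝ, ∀ t ∈ Icc 0 T,
      Complex.exp (φ' t * Complex.I) = circlePhase d ε x w t → IsBetween d ε x t →
      liftAction d ε φ' (regAction d ε x w) t = action d ε v t := fun φ' t ht h1 hb => by
    rw [h.liftAction_eq hd hpos hf h0 ht h1, hw t ht hb, action]
  refine ⟨φ, _, ⟨hφ, fun t ht hb => hact φ t ht (hexp t ht) hb⟩, fun φ' hφ' => ?_⟩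
  have hexp' : ∀ t ∈ Icc 0 T, Complex.exp (φ' t * Complex.I) = circlePhase d ε x w t :=
    fun t ht => h.exp_phase hd hpos hf h0 hw hφ' ht
  obtain ⟨n, hn⟩ := exists_int_of_exp_eq hφ'.continuousOn hφ.continuousOn_φ
    fun t ht => (hexp' t ht).trans (hexp t ht).symm
  refine ⟨hφ.congr hn, fun t ht hb => ⟨hact φ' t ht (hexp' t ht) hb, fun hodd => ?_⟩⟩
  rw [isOddPi_iff, sawtooth_eq_of_exp_eq (h.direction_mul_mem hd hpos hf h0 ht) (hexp' t ht)]
    at hodd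
  have h1 : 0 < x t / d (ε * t) := div_pos hb.1 (hpos _)
  have h2 : x t / d (ε * t) < 1 := (div_lt_one (hpos _)).2 hb.2
  have hpi := pi_pos
  rcases direction_eq w t with h3 | h3 <;> rw [h3] at hodd <;> nlinarith

end motion

/-- The slow times that occur in a motion of length at most `L / ε ^ k`. They fill a bounded
interval for `k ≤ 1` but not for `k ≥ 2`, where `d` and its derivatives are bounded by assumption. -/
def slowTimes (k : ℕ) (L : ℝ) : Set ℝ := if k ≤ 1 then Icc 0 L else univ

theorem zero_mem_slowTimes (k : ℕ) {L : ℝ} (hL : 0 < L) : (0 : ℝ) ∈ slowTimes k L := by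
  unfold slowTimes
  split_ifs
  · exact ⟨le_rfl, hL.le⟩
  · exact mem_univ _

theorem mul_mem_slowTimes {k : ℕ} {L ε T : ℝ} (hε : 0 < ε) (hε1 : ε ≤ 1) (hT : T ≤ L / ε ^ k)
    (hL : 0 < L) : ∀ t ∈ Icc 0 T, ε * t ∈ slowTimes k L := by
  intro t ht
  unfold slowTimes
  split_ifs with hk
  · refine ⟨mul_nonneg hε.le ht.1, ?_⟩
    have h1 : ε * t ≤ ε * (L / ε ^ k) := mul_le_mul_of_nonneg_left (ht.2.trans hT) hε.le
    interval_cases k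
    · rw [pow_zero, div_one] at h1
      nlinarith
    · rwa [pow_one, mul_div_cancel₀ _ hε.ne'] at h1
  · exact mem_univ _

theorem exists_bound_slowTimes {d : ℝ → ℝ} (hd : ContDiff ℝ ∞ d) {k : ℕ}
    (hbdd : 1 < k → ∀ n : ℕ, ∃ M : ℝ, ∀ τ, |iteratedDeriv n d τ| ≤ M) (L : ℝ) (n : ℕ) :
    ∃ M : ℝ, ∀ τ ∈ slowTimes k L, |iteratedDeriv n d τ| ≤ M := by
  unfold slowTimes
  split_ifs with hk
  · exact isCompact_Icc.exists_bound_of_continuousOn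
      (hd.continuous_iteratedDeriv n (by exact_mod_cast le_top)).continuousOn
  · obtain ⟨M, hM⟩ := hbdd (not_le.1 hk) n
    exact ⟨M, fun τ _ => hM τ⟩

end FermiUlam

theorem mainTheorem3 (d : ℝ → ℝ) (hd : ContDiff ℝ ∞ d) (hpos : ∃ c > 0, ∀ τ, c ≤ d τ)
    (k : ℕ) (hbdd : 1 < k → ∀ n : ℕ, ∃ M : ℝ, ∀ τ, |iteratedDeriv n d τ| ≤ M) :
    -- the action is preserved to accuracy `O(ε)`
    (∀ a b L : ℝ, 0 < a → a ≤ b → 0 < L → ∃ C ε₀ : ℝ, 0 < C ∧ 0 < ε₀ ∧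
      ∀ ε T : ℝ, 0 < ε → ε < ε₀ → 0 ≤ T → T ≤ L / ε ^ k → ∀ x v : ℝ → ℝ,
      FermiUlam.IsMotion d ε T x v → FermiUlam.IsBetween d ε x 0 →
      FermiUlam.action d ε v 0 ∈ Icc a b →
      ∀ t ∈ Icc 0 T, FermiUlam.IsBetween d ε x t →
        |FermiUlam.action d ε v t - FermiUlam.action d ε v 0| ≤ C * ε) ∧
    -- the description of the action and the phase through the change of variables
    (∀ r : ℕ, 1 ≤ r →
      (∃ S K, FermiUlam.IsAdiabaticChange d r S K) ∧
      ∀ S K, FermiUlam.IsAdiabaticChange d r S K →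
      ∀ a b L : ℝ, 0 < a → a ≤ b → 0 < L → ∃ C ε₀ : ℝ, 0 < C ∧ 0 < ε₀ ∧
      ∀ ε T : ℝ, 0 < ε → ε < ε₀ → 0 ≤ T → T ≤ L / ε ^ k → ∀ x v φ : ℝ → ℝ,
      FermiUlam.IsMotion d ε T x v → FermiUlam.IsPhase d ε T x v φ →
      FermiUlam.IsBetween d ε x 0 → FermiUlam.action d ε v 0 ∈ Icc a b →
      -- the initial value `J` of the new action
      (∃! J : ℝ, J ∈ Icc (a / 2) (2 * b) ∧
        FermiUlam.action d ε v 0 = FermiUlam.oldAction S r ε J (φ 0) 0) ∧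
      ∀ J ∈ Icc (a / 2) (2 * b),
      FermiUlam.action d ε v 0 = FermiUlam.oldAction S r ε J (φ 0) 0 →
      -- the approximate new angle `ψ`
      ∀ ψ : ℝ → ℝ, ψ 0 = FermiUlam.newAngle S r ε J (φ 0) 0 →
      (∀ t ∈ Icc 0 T, HasDerivWithinAt ψ
        (deriv (fun j => FermiUlam.sumH K r ε j (ε * t)) J) (Icc 0 T) t) →
      ∀ t ∈ Icc 0 T,
        (FermiUlam.IsBetween d ε x t →
          |FermiUlam.action d ε v t - FermiUlam.oldAction S r ε J (φ t) (ε * t)|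
            ≤ C * ε ^ r) ∧
        (∃! p : ℝ, FermiUlam.newAngle S r ε J p (ε * t) = ψ t) ∧
        ∀ p : ℝ, FermiUlam.newAngle S r ε J p (ε * t) = ψ t →
          |φ t - p| ≤ C * ε ^ ((r : ℤ) - (k : ℤ)) ∧
          (FermiUlam.IsBetween d ε x t → (∀ q ∈ uIcc (φ t) p, ¬ FermiUlam.IsOddPi q) →
            |FermiUlam.action d ε v t - FermiUlam.oldAction S r ε J p (ε * t)|
              ≤ C * (ε ^ r + ε ^ ((r : ℤ) - (k : ℤ) + 1)))) := by
  obtain ⟨c, hc, hcd⟩ := hpos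
  have hpos : ∀ τ, 0 < d τ := fun τ => hc.trans_le (hcd τ)
  refine ⟨fun a b L ha hab hL => ?_, fun r hr => ?_⟩
  · have hU := FermiUlam.exists_bound_slowTimes hd hbdd L
    have h0U := FermiUlam.zero_mem_slowTimes k hL
    obtain ⟨ε₁, hε₁, hlift⟩ := FermiUlam.exists_lift_of_isMotion hd hc hcd hU h0U k ha hab hL
    obtain ⟨C, hC, ε₂, hε₂, hreg⟩ :=
      FermiUlam.exists_bound_regularized hd hc hcd hU h0U k ha hab hL
    refine ⟨C, min ε₁ (min ε₂ 1), hC, by positivity,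
      fun ε T hε hε' hT hTL x v hm h0 hI t ht hb => ?_⟩
    obtain ⟨hε1, hε23⟩ := lt_min_iff.1 hε'
    obtain ⟨hε2, hε3⟩ := lt_min_iff.1 hε23
    have hτ := FermiUlam.mul_mem_slowTimes hε hε3.le hTL hL
    obtain ⟨φ, P, ⟨hφ, hact⟩, -⟩ := hlift ε T hε hε1 hT hTL hτ x v hm h0 hI
    have h1 := hact 0 ⟨le_rfl, hT⟩ h0
    have h2 := (hreg ε T hε hε2 hTL hτ φ P hφ (by rwa [h1]) t ht).1
    rwa [h1, hact t ht hb] at h2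
  · obtain ⟨s, κ, hs⟩ := FermiUlam.SymPoly.exists_isProcedure hd hpos
      (show 2 ≤ r + 2 * k + 1 by omega)
    have hrR : r ≤ r + 2 * k + 1 := by omega
    have hproc := FermiUlam.isAdiabaticChange_proc hd hpos hs hr hrR
    refine ⟨⟨_, _, hproc⟩, fun S K hSK a b L ha hab hL => ?_⟩
    have hS : ∀ n < r, 1 ≤ n → ∀ J > 0, ∀ φ τ, S n J φ τ = FermiUlam.procS d s n J φ τ :=
      fun n hn => (hSK.unique hpos hproc n hn).1
    have hK : ∀ n < r, ∀ J > 0, ∀ τ, K n J τ = FermiUlam.procK d κ n J τ :=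
      fun n hn => (hSK.unique hpos hproc n hn).2
    have hU := FermiUlam.exists_bound_slowTimes hd hbdd L
    have h0U := FermiUlam.zero_mem_slowTimes k hL
    obtain ⟨ε₁, hε₁, hlift⟩ := FermiUlam.exists_lift_of_isMotion hd hc hcd hU h0U k ha hab hL
    obtain ⟨C, hC, ε₂, hε₂, hmain⟩ :=
      FermiUlam.exists_bound_lift hd hc hcd hU h0U hr hs ha hab hL
    refine ⟨C, min ε₁ (min ε₂ 1), hC, by positivity,
      fun ε T hε hε' hT hTL x v φ hm hphase h0 hI => ?_⟩
    obtain ⟨hε1, hε23⟩ := lt_min_iff.1 hε'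
    obtain ⟨hε2, hε3⟩ := lt_min_iff.1 hε23
    have hτ := FermiUlam.mul_mem_slowTimes hε hε3.le hTL hL
    obtain ⟨φ', P, -, hφ'⟩ := hlift ε T hε hε1 hT hTL hτ x v hm h0 hI
    obtain ⟨hφ, hact⟩ := hφ' φ hphase
    have hpJ : ∀ J ∈ Icc (a / 2) (2 * b), 0 < J := fun J hJ => (half_pos ha).trans_le hJ.1
    -- away from the odd multiples of `π` the functions of the theorem are those of the procedure
    have hold : ∀ J ∈ Icc (a / 2) (2 * b), ∀ τ φ, ¬ FermiUlam.IsOddPi φ →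
        FermiUlam.oldAction S r ε J φ τ =
          FermiUlam.SymPoly.ev d ε J τ (FermiUlam.sawtooth φ) (FermiUlam.SymPoly.actP s r) :=
      fun J hJ τ φ hφ => (FermiUlam.oldAction_congr hS (hpJ J hJ) ε φ τ).trans
        (FermiUlam.oldAction_procS hd hpos hs hrR (hpJ J hJ) ε τ hφ)
    have hnew : ∀ J ∈ Icc (a / 2) (2 * b), ∀ τ φ, FermiUlam.newAngle S r ε J φ τ =
        φ + ε * FermiUlam.SymPoly.ev d ε J τ (FermiUlam.sawtooth φ)
          (FermiUlam.SymPoly.dAct (FermiUlam.SymPoly.genP s r)) :=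
      fun J hJ τ φ => (FermiUlam.newAngle_congr hS (hpJ J hJ) ε φ τ).trans
        (FermiUlam.newAngle_procS hd hpos hs hrR (hpJ J hJ) ε φ τ)
    obtain ⟨h1, hodd⟩ := hact 0 ⟨le_rfl, hT⟩ h0
    obtain ⟨hJ, hmot⟩ := hmain ε T hε hε2 hTL hτ φ P hφ (by rwa [h1])
    rw [h1] at hJ hmot
    refine ⟨(existsUnique_congr fun J => ?_).1 hJ, fun J hJ hJI ψ hψ0 hψ t ht => ?_⟩
    · exact and_congr_right fun hJ => by rw [hold J hJ 0 _ hodd]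
    rw [hold J hJ 0 _ hodd] at hJI
    rw [hnew J hJ] at hψ0
    obtain ⟨hb1, hb2, hb3⟩ := hmot J hJ hJI ψ hψ0 (fun t ht => (hψ t ht).congr_deriv
      ((FermiUlam.deriv_sumH_congr hK (hpJ J hJ) ε (ε * t)).trans
        (FermiUlam.deriv_sumH_procK hd hpos hs hrR (hpJ J hJ) ε (ε * t) 0))) t ht
    simp only [hnew J hJ]
    refine ⟨fun hb => ?_, hb2, fun p hp => ⟨(hb3 p hp).1, fun hb hq => ?_⟩⟩
    · obtain ⟨h2, h3⟩ := hact t ht hb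
      rwa [hold J hJ _ _ h3, ← h2]
    · rw [hold J hJ _ _ (hq p right_mem_uIcc), ← (hact t ht hb).1]
      exact (hb3 p hp).2 hq
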